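/- Let $N\in\mathbb N$, $1\le p<\infty$, and let $B_j$ be the closed ball of radius $j$ about $0$ in $\mathbb R^N$. For $V=\mathbb R^N$ or $V=\mathbb R^{N\times N}$, a Borel function $f:\mathbb R\times\mathbb R^N\to V$ satisfies (C2) if for every compact $K\subset\mathbb R^N$ there is $m^K\in L^p_{loc}(\mathbb R)$ such that for a.e. $t$, $|f(t,x)|\le m^K(t)$ for all $x\in K$. Let $\mathfrak{LC}_p$ be the set of Borel functions $f:\mathbb R\times\mathbb R^N\to\mathbb R^N$ with (C2) such that for every compact $K$ there is $l^K\in L^p_{loc}(\mathbb R)$ such that for a.e. $t$, $|f(t,x)-f(t,y)|\le l^K(t)|x-y|$ for all $x,y\in K$. Write $f_t(s,x)=f(s+t,x)$. Let $f\in\mathfrak{LC}_p$ have $L^1_{loc}$-equicontinuous $m$-bounds: with $m^j(t)=\sup_{x\in B_j}|f(t,x)|$, for all $j\in\mathbb N$, $r>0$ and $\varepsilon>0$ there is $\delta>0$ such that $\sup_{\tau\in\mathbb R}\int_s^t m^j(u+\tau)\,du<\varepsilon$ whenever $-r\le s\le t\le r$ and $t-s<\delta$. Put $$\theta_j(s)=\sup_{t\in\mathbb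 R}\int_t^{t+s}m^j(u)\,du\quad(s\ge 0),\qquad \Theta=(\theta_j)_{j\in\mathbb N}.$$ For $I=[q_1,q_2]$ with $q_1,q_2\in\mathbb Q$ and $j\in\mathbb N$ let $\mathcal K^I_j$ be the set of continuous $x:I\to B_j$ with $|x(t)-x(s)|\le\theta_j(|t-s|)$ for all $s,t\in I$. Let $\Theta\mathfrak C_p(V)$ be the set of Borel functions $F:\mathbb R\times\mathbb R^N\to V$ with (C2) such that, for all $I,j$ as above, $\int_I|F(t,x_n(t))-F(t,x(t))|^p\,dt\to0$ whenever $x_n,x\in\mathcal K^I_j$ and $x_n\to x$ uniformly on $I$. In each of the sets $\mathfrak{LC}_p$, $\Theta\mathfrak C_p(V)$, functions that are equal a.e. in $\mathbb R\times\mathbb R^N$ are identified, and each of these spaces carries the topology $\mathcal T_\Theta$ generated by the seminorms $p_{I,j}(g)=\sup_{x\in\mathcal K^I_j}\big(\int_I|g(t,x(t))|^p\,dt\big)^{1/p}$. Let $\mathrm{Hull}(f)$ be the closure of $\{f_t: t\in\mathbb R\}$ in $(\mathfrak{LC}_p,\mathcal T_\Theta)$. For $g\in\mathrm{Hull}(f)$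 and $x_0\in\mathbb R^N$ let $x(\cdot,g,x_0)$ be the maximal Carathéodory solution of $\dot x=g(t,x)$, $x(0)=x_0$, and $I_{g,x_0}$ its interval of definition. (i) For every $g\in\mathrm{Hull}(f)$ and $x_0\in\mathbb R^N$ this maximal solution exists, is unique, does not depend on the representative of $g$, and $I_{g,x_0}$ is open. The set $\mathcal U_1=\{(t,g,x_0): g\in\mathrm{Hull}(f),\ x_0\in\mathbb R^N,\ t\in I_{g,x_0}\}$ is open in $\mathbb R\times\mathrm{Hull}(f)\times\mathbb R^N$, and $\Phi_1(t,g,x_0)=(g_t,x(t,g,x_0))$ defines a local continuous skew-product flow on $\mathrm{Hull}(f)\times\mathbb R^N$ with domain $\mathcal U_1$. (ii) Let $F\in\Theta\mathfrak C_p(\mathbb R^{N\times N})$, $h\in\Theta\mathfrak C_p(\mathbb R^N)$, and let $\mathbb H$ be the closure of $\{(f_t,F_t,h_t): t\in\mathbb R\}$ in $\mathfrak{LC}_p\times\Theta\mathfrak C_p(\mathbb R^{N\times N})\times\Theta\mathfrak C_p(\mathbb R^N)$ with the product of the topologies $\mathcal T_\Theta$. For every $(g,G,k)\in\mathbb H$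 and $x_0,y_0\in\mathbb R^N$ the system $\dot x=g(t,x)$, $\dot y=G(t,x)y+k(t,x)$, $x(0)=x_0$, $y(0)=y_0$ has a unique maximal Carathéodory solution $(x(\cdot,g,x_0),y(\cdot,g,G,k,x_0,y_0))$; it is defined on $I_{g,x_0}$ and does not depend on the representatives of $g,G,k$. The set $\mathcal U_2=\{(t,g,G,k,x_0,y_0): (g,G,k)\in\mathbb H,\ x_0,y_0\in\mathbb R^N,\ t\in I_{g,x_0}\}$ is open in $\mathbb R\times\mathbb H\times\mathbb R^N\times\mathbb R^N$, and $$\Phi_2(t,g,G,k,x_0,y_0)=\big(g_t,G_t,k_t,x(t,g,x_0),y(t,g,G,k,x_0,y_0)\big)$$ defines a local continuous skew-product flow on $\mathbb H\times\mathbb R^N\times\mathbb R^N$ with domain $\mathcal U_2$. Here $\Phi$, with domain $\mathcal U\subset\mathbb R\times X$, $X=H\times Z$, is a local continuous skew-product flow on $X$ if: its first component is a continuous flow $(t,b)\mapsto b_t$ of $\mathbb R$ on $H$; $\mathcal U$ is open in $\mathbb R\times X$; for every $w\in X$ the set $\{t:(t,w)\in\mathcal U\}$ is an interval containing $0$; $\Phi:\mathcal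 U\to X$ is continuous; $\Phi(0,w)=w$; and if $(s,w)\in\mathcal U$, then $(t,\Phi(s,w))\in\mathcal U$ if and only if $(s+t,w)\in\mathcal U$, in which case $\Phi(s+t,w)=\Phi(t,\Phi(s,w))$. -/

import Mathlib

open MeasureTheory Set Filter Topology
open scoped ENNReal NNReal

set_option linter.unusedSectionVars false

noncomputable section

namespace Caratheodory

/-- `N`-dimensional Euclidean space. -/
abbrev E (N : ℕ) : Type := EuclideanSpace ℝ (Fin N)

section Spaces

variable {N : ℕ} {V : Type} [NormedAddCommGroup V] [MeasurableSpace V]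

/-- Time translation: `(shift t f) (s, x) = f (s + t, x)`. -/
def shift {α β : Type} (t : ℝ) (f : ℝ × α → β) : ℝ × α → β := fun q => f (q.1 + t, q.2)

/-- Real functions that are `p`-integrable on every compact interval. -/
def LpLoc (p : ℝ≥0∞) (m : ℝ → ℝ) : Prop :=
  ∀ a b : ℝ, MemLp m p (volume.restrict (Icc a b))

/-- Condition (C2): existence of an `m`-bound in `L^p_loc` on every compact set. -/
def HasMBounds (p : ℝ≥0∞) (f : ℝ × E N → V) : Prop :=
  ∀ K : Set (E N), IsCompact K →
    ∃ m : ℝ → ℝ, LpLoc p m ∧ ∀ᵐ t : ℝ, ∀ x ∈ K, ‖f (t, x)‖ ≤ m t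

/-- Condition (L): existence of an `l`-bound in `L^p_loc` on every compact set. -/
def HasLBounds (p : ℝ≥0∞) (f : ℝ × E N → V) : Prop :=
  ∀ K : Set (E N), IsCompact K →
    ∃ l : ℝ → ℝ, LpLoc p l ∧
      ∀ᵐ t : ℝ, ∀ x ∈ K, ∀ y ∈ K, ‖f (t, x) - f (t, y)‖ ≤ l t * ‖x - y‖

/-- Lipschitz Carathéodory functions `ℝ × ℝ^N → V`. -/
def LC (p : ℝ≥0∞) (N : ℕ) (V : Type) [NormedAddCommGroup V] [MeasurableSpace V] :
    Set (ℝ × E N → V) :=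
  {f | Measurable f ∧ HasMBounds p f ∧ HasLBounds p f}

/-- The optimal `m`-bound of `f` on the closed ball `B_j`, with values in `[0, ∞]`
(for a function satisfying (C2) it is finite almost everywhere). -/
def optMBound (f : ℝ × E N → V) (j : ℕ) (t : ℝ) : ℝ≥0∞ :=
  ⨆ x ∈ Metric.closedBall (0 : E N) j, ‖f (t, x)‖ₑ

/-- `L^1_loc`-equicontinuity of a set of nonnegative functions. -/
def L1LocEquicontinuous (S : Set (ℝ → ℝ≥0∞)) : Prop :=
  ∀ r : ℝ, 0 < r → ∀ ε : ℝ≥0∞, 0 < ε → ∃ δ : ℝ, 0 < δ ∧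
    ∀ s t : ℝ, -r ≤ s → s ≤ t → t ≤ r → t - s < δ → (⨆ m ∈ S, ∫⁻ u in Icc s t, m u) < ε

/-- `f` has `L^1_loc`-equicontinuous `m`-bounds: for every `j`, the set of the optimal `m`-bounds
on `B_j` of all the time translates of `f` is `L^1_loc`-equicontinuous. -/
def HasL1LocEquicontinuousMBounds (f : ℝ × E N → V) : Prop :=
  ∀ j : ℕ, L1LocEquicontinuous (range fun τ : ℝ => optMBound (shift τ f) j)

/-- A suitable set of moduli of continuity `θ^I_j`, `I = [a, b]` with rational end points.
Moduli are functions from `[0, ∞)` to `[0, ∞)`. -/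
structure Moduli where
  /-- `θ a b j` is the modulus for the interval `[a, b]` and the index `j`. -/
  θ : ℚ → ℚ → ℕ → ℝ≥0 → ℝ≥0
  continuous_θ : ∀ a b j, Continuous (θ a b j)
  monotone_θ : ∀ a b j, Monotone (θ a b j)
  θ_zero : ∀ a b j, θ a b j 0 = 0
  θ_le : ∀ a b a' b' j j', a' ≤ a → a ≤ b → b ≤ b' → j ≤ j' → ∀ s, θ a b j s ≤ θ a' b' j' s

/-- The set `𝒦^I_j`, `I = [a, b]`: continuous functions from `I` to `B_j` having `θ^I_j` as a
modulus of continuity.  (Only the values on `I` matter.) -/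
def admissible (Θ : Moduli) (N : ℕ) (a b : ℚ) (j : ℕ) : Set (ℝ → E N) :=
  {x | ContinuousOn x (Icc (a : ℝ) b) ∧ (∀ t ∈ Icc (a : ℝ) b, ‖x t‖ ≤ j) ∧
    ∀ s ∈ Icc (a : ℝ) b, ∀ t ∈ Icc (a : ℝ) b, ‖x s - x t‖ ≤ Θ.θ a b j (nndist s t)}

/-- Condition (T). -/
def ThetaContinuous (Θ : Moduli) (p : ℝ≥0∞) (f : ℝ × E N → V) : Prop :=
  ∀ (a b : ℚ) (j : ℕ) (x : ℕ → ℝ → E N) (x' : ℝ → E N),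
    (∀ n, x n ∈ admissible Θ N a b j) → x' ∈ admissible Θ N a b j →
    TendstoUniformlyOn x x' atTop (Icc (a : ℝ) b) →
    Tendsto (fun n => eLpNorm (fun t => f (t, x n t) - f (t, x' t)) p
      (volume.restrict (Icc (a : ℝ) b))) atTop (𝓝 0)

/-- `Θ`-Carathéodory functions `ℝ × ℝ^N → V`. -/
def ThetaC (Θ : Moduli) (p : ℝ≥0∞) (N : ℕ) (V : Type) [NormedAddCommGroup V]
    [MeasurableSpace V] : Set (ℝ × E N → V) :=
  {f | Measurable f ∧ HasMBounds p f ∧ ThetaContinuous Θ p f}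

/-- The seminorms `p_{I,j}`, `I = [a, b]` (finite under (C2)). -/
def thetaSeminorm (Θ : Moduli) (p : ℝ≥0∞) (a b : ℚ) (j : ℕ) (f : ℝ × E N → V) : ℝ≥0∞ :=
  ⨆ x ∈ admissible Θ N a b j, eLpNorm (fun t => f (t, x t)) p (volume.restrict (Icc (a : ℝ) b))

/-- The topology generated by the seminorms `p_{I,j}` on a set `S` of functions. -/
@[reducible] def thetaTopology (Θ : Moduli) (p : ℝ≥0∞) (S : Set (ℝ × E N → V)) : TopologicalSpace S :=
  TopologicalSpace.generateFrom
    {B | ∃ (g : S) (a b : ℚ) (j : ℕ) (ε : ℝ≥0∞), 0 < ε ∧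
      B = {f : S | thetaSeminorm Θ p a b j (f.1 - g.1) < ε}}

/-- Equality almost everywhere on `ℝ × ℝ^N`, as an equivalence relation on `S`. -/
def aeSetoid (S : Set (ℝ × E N → V)) : Setoid S where
  r f g := f.1 =ᵐ[volume] g.1
  iseqv := ⟨fun _ => Filter.EventuallyEq.rfl, fun h => h.symm, fun h h' => h.trans h'⟩

/-- The space `(S, 𝒯_Θ)`, two functions in `S` being identified when they coincide almost
everywhere. -/
def ThetaSpace (Θ : Moduli) (p : ℝ≥0∞) (S : Set (ℝ × E N → V)) : Type :=
  let _ := Θ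
  let _ := p
  Quotient (aeSetoid S)

instance (Θ : Moduli) (p : ℝ≥0∞) (S : Set (ℝ × E N → V)) :
    TopologicalSpace (ThetaSpace Θ p S) :=
  @instTopologicalSpaceQuotient S (aeSetoid S) (thetaTopology Θ p S)

/-- The class of a function of `S`. -/
def ThetaSpace.mk (Θ : Moduli) (p : ℝ≥0∞) {S : Set (ℝ × E N → V)} (f : ℝ × E N → V)
    (hf : f ∈ S) : ThetaSpace Θ p S :=
  Quotient.mk (aeSetoid S) ⟨f, hf⟩

/-- A chosen representative. -/
def ThetaSpace.rep {Θ : Moduli} {p : ℝ≥0∞} {S : Set (ℝ × E N → V)} (g : ThetaSpace Θ p S) :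
    ℝ × E N → V :=
  (Quotient.out (s := aeSetoid S) g).1

/-- `f` is a representative (in `S`) of the class `g`. -/
def ThetaSpace.IsRep {Θ : Moduli} {p : ℝ≥0∞} {S : Set (ℝ × E N → V)} (g : ThetaSpace Θ p S)
    (f : ℝ × E N → V) : Prop :=
  ∃ hf : f ∈ S, ThetaSpace.mk Θ p f hf = g

end Spaces

section Translation

variable {N : ℕ} {V : Type} [NormedAddCommGroup V] [MeasurableSpace V]

theorem LpLoc.shift {p : ℝ≥0∞} {m : ℝ → ℝ} (hm : LpLoc p m) (t : ℝ) :
    LpLoc p (fun s => m (s + t)) := by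
  intro a b
  have h := (measurePreserving_add_right volume t).restrict_preimage
    (measurableSet_Icc (a := a + t) (b := b + t))
  have e : (fun s : ℝ => s + t) ⁻¹' Icc (a + t) (b + t) = Icc a b := by
    ext s; simp
  rw [e] at h
  exact (hm (a + t) (b + t)).comp_measurePreserving h

theorem ae_add {P : ℝ → Prop} (h : ∀ᵐ s : ℝ, P s) (t : ℝ) : ∀ᵐ s : ℝ, P (s + t) :=
  (measurePreserving_add_right volume t).quasiMeasurePreserving.ae h

theorem measurable_shift {f : ℝ × E N → V} (hf : Measurable f) (t : ℝ) :
    Measurable (shift t f) :=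
  hf.comp ((measurable_fst.add_const t).prodMk measurable_snd)

theorem HasMBounds.shift {p : ℝ≥0∞} {f : ℝ × E N → V} (hf : HasMBounds p f) (t : ℝ) :
    HasMBounds p (shift t f) := by
  intro K hK
  obtain ⟨m, hm, h⟩ := hf K hK
  exact ⟨_, hm.shift t, ae_add h t⟩

theorem HasLBounds.shift {p : ℝ≥0∞} {f : ℝ × E N → V} (hf : HasLBounds p f) (t : ℝ) :
    HasLBounds p (shift t f) := by
  intro K hK
  obtain ⟨m, hm, h⟩ := hf K hK
  exact ⟨_, hm.shift t, ae_add h t⟩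

theorem shift_mem_LC {p : ℝ≥0∞} {f : ℝ × E N → V} (hf : f ∈ LC p N V) (t : ℝ) :
    shift t f ∈ LC p N V :=
  ⟨measurable_shift hf.1 t, hf.2.1.shift t, hf.2.2.shift t⟩

theorem nndist_max_min_le (c d r s : ℝ) :
    nndist (max c (min d r)) (max c (min d s)) ≤ nndist r s := by
  rw [← NNReal.coe_le_coe, coe_nndist, coe_nndist, Real.dist_eq, Real.dist_eq]
  calc |max c (min d r) - max c (min d s)| ≤ |min d r - min d s| := by
        have := abs_max_sub_max_le_max c (min d r) c (min d s)
        simpa using this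
    _ ≤ |r - s| := by
        have := abs_min_sub_min_le_max d r d s
        simpa using this

/-- Translation and extension by constants send `𝒦^I_j` to `𝒦^J_j`, for a suitable larger `J`. -/
theorem admissible_extend {Θ : Moduli} {a b a' b' : ℚ} {j : ℕ} (ha : a' ≤ a) (hab : a ≤ b)
    (hb : b ≤ b') (t : ℝ) {x : ℝ → E N} (hx : x ∈ admissible Θ N a b j) :
    (fun r => x (max (a : ℝ) (min b (r - t)))) ∈ admissible Θ N a' b' j := by
  have hab' : (a : ℝ) ≤ b := by exact_mod_cast hab
  have hmem : ∀ r : ℝ, max (a : ℝ) (min b (r - t)) ∈ Icc (a : ℝ) b := fun r =>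
    ⟨le_max_left _ _, max_le hab' (min_le_left _ _)⟩
  refine ⟨?_, fun r _ => hx.2.1 _ (hmem r), fun r _ s _ => ?_⟩
  · have hc : Continuous fun r : ℝ => max (a : ℝ) (min b (r - t)) := by fun_prop
    exact hx.1.comp hc.continuousOn (fun r _ => hmem r)
  · refine (hx.2.2 _ (hmem r) _ (hmem s)).trans ?_
    refine NNReal.coe_le_coe.2 ((Θ.monotone_θ a b j ?_).trans
      (Θ.θ_le a b a' b' j j ha hab hb le_rfl _))
    refine (nndist_max_min_le _ _ _ _).trans (le_of_eq ?_)
    rw [← NNReal.coe_inj, coe_nndist, coe_nndist, dist_sub_right]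

theorem ThetaContinuous.shift {Θ : Moduli} {p : ℝ≥0∞} {f : ℝ × E N → V}
    (hf : ThetaContinuous Θ p f) (t : ℝ) :
    ThetaContinuous Θ p (shift t f) := by
  intro a b j x x' hx hx' hu
  rcases lt_or_ge b a with hba | hab
  · have : Icc (a : ℝ) b = ∅ := Icc_eq_empty (by exact_mod_cast not_le.2 hba)
    simp [this]
  obtain ⟨a', ha'⟩ := exists_rat_lt (min (a : ℝ) (a + t))
  obtain ⟨b', hb'⟩ := exists_rat_gt (max (b : ℝ) (b + t))
  rw [lt_min_iff] at ha'
  rw [max_lt_iff] at hb'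
  have ha : a' ≤ a := by exact_mod_cast ha'.1.le
  have hb : b ≤ b' := by exact_mod_cast hb'.1.le
  have hab' : (a : ℝ) ≤ b := by exact_mod_cast hab
  have hmem : ∀ r : ℝ, max (a : ℝ) (min b (r - t)) ∈ Icc (a : ℝ) b := fun r =>
    ⟨le_max_left _ _, max_le hab' (min_le_left _ _)⟩
  have key := hf a' b' j (fun n r => x n (max (a : ℝ) (min b (r - t))))
    (fun r => x' (max (a : ℝ) (min b (r - t))))
    (fun n => admissible_extend ha hab hb t (hx n)) (admissible_extend ha hab hb t hx') (by
      intro u hu'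
      filter_upwards [hu u hu'] with n hn r _
      exact hn _ (hmem r))
  refine tendsto_of_tendsto_of_tendsto_of_le_of_le tendsto_const_nhds key
    (fun _ => zero_le) (fun n => ?_)
  have hmp := (measurePreserving_add_right volume t).restrict_preimage
    (measurableSet_Icc (a := (a : ℝ) + t) (b := b + t))
  have e : (fun s : ℝ => s + t) ⁻¹' Icc ((a : ℝ) + t) (b + t) = Icc (a : ℝ) b := by
    ext s; simp
  rw [e] at hmp
  have hemb : MeasurableEmbedding fun s : ℝ => s + t :=
    (MeasurableEquiv.addRight t).measurableEmbedding
  set g : ℝ → V := fun r => f (r, x n (max (a : ℝ) (min b (r - t)))) -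
    f (r, x' (max (a : ℝ) (min b (r - t)))) with hg
  have h1 : eLpNorm (fun s => Caratheodory.shift t f (s, x n s) -
      Caratheodory.shift t f (s, x' s)) p (volume.restrict (Icc (a : ℝ) b)) =
      eLpNorm (g ∘ fun s => s + t) p (volume.restrict (Icc (a : ℝ) b)) := by
    refine eLpNorm_congr_ae ?_
    filter_upwards [ae_restrict_mem measurableSet_Icc] with s hs
    simp [hg, Caratheodory.shift, min_eq_right hs.2, max_eq_right hs.1]
  rw [h1, ← hemb.eLpNorm_map_measure, hmp.map_eq]
  exact eLpNorm_mono_measure _ (Measure.restrict_mono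
    (Icc_subset_Icc ha'.2.le hb'.2.le) le_rfl)

theorem shift_mem_ThetaC {Θ : Moduli} {p : ℝ≥0∞} {f : ℝ × E N → V} (hf : f ∈ ThetaC Θ p N V)
    (t : ℝ) : shift t f ∈ ThetaC Θ p N V :=
  ⟨measurable_shift hf.1 t, hf.2.1.shift t, hf.2.2.shift t⟩

theorem shift_ae_eq {f g : ℝ × E N → V} (h : f =ᵐ[volume] g) (t : ℝ) :
    shift t f =ᵐ[volume] shift t g := by
  have hmp : MeasurePreserving (fun q : ℝ × E N => (q.1 + t, q.2)) volume volume :=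
    (measurePreserving_add_right volume t).prod (MeasurePreserving.id volume)
  exact hmp.quasiMeasurePreserving.ae_eq_comp h

/-- Time translation on classes of functions. -/
def ThetaSpace.translate {Θ : Moduli} {p : ℝ≥0∞} {S : Set (ℝ × E N → V)}
    (hS : ∀ f ∈ S, ∀ t, shift t f ∈ S) (t : ℝ) : ThetaSpace Θ p S → ThetaSpace Θ p S :=
  Quotient.map (sa := aeSetoid S) (sb := aeSetoid S) (fun f => ⟨shift t f.1, hS f.1 f.2 t⟩)
    (fun _ _ h => shift_ae_eq h t)

end Translation

/-- `(𝔏ℭ_p(V), 𝒯_Θ)`. -/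
abbrev LCSpace (Θ : Moduli) (p : ℝ≥0∞) (N : ℕ) (V : Type) [NormedAddCommGroup V]
    [MeasurableSpace V] : Type :=
  ThetaSpace Θ p (LC p N V)

/-- `(Θℭ_p(V), 𝒯_Θ)`. -/
abbrev ThetaCSpace (Θ : Moduli) (p : ℝ≥0∞) (N : ℕ) (V : Type) [NormedAddCommGroup V]
    [MeasurableSpace V] : Type :=
  ThetaSpace Θ p (ThetaC Θ p N V)

section Hulls

variable {N : ℕ} {V W : Type} [NormedAddCommGroup V] [MeasurableSpace V]
  [NormedAddCommGroup W] [MeasurableSpace W]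

/-- The time translation `g ↦ g_t` on `𝔏ℭ_p`. -/
def translateLC {Θ : Moduli} {p : ℝ≥0∞} (t : ℝ) : LCSpace Θ p N V → LCSpace Θ p N V :=
  ThetaSpace.translate (fun _ hf t => shift_mem_LC hf t) t

/-- The time translation `g ↦ g_t` on `Θℭ_p`. -/
def translateThetaC {Θ : Moduli} {p : ℝ≥0∞} (t : ℝ) :
    ThetaCSpace Θ p N V → ThetaCSpace Θ p N V :=
  ThetaSpace.translate (fun _ hf t => shift_mem_ThetaC hf t) t

/-- The time translation on `𝔏ℭ_p × Θℭ_p × Θℭ_p`. -/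
def translateTriple {Θ : Moduli} {p : ℝ≥0∞} (t : ℝ)
    (c : LCSpace Θ p N V × ThetaCSpace Θ p N W × ThetaCSpace Θ p N V) :
    LCSpace Θ p N V × ThetaCSpace Θ p N W × ThetaCSpace Θ p N V :=
  (translateLC t c.1, translateThetaC t c.2.1, translateThetaC t c.2.2)

/-- The hull of a point `b` for a family of translations `σ`: the closure of its orbit. -/
def hull {B : Type} [TopologicalSpace B] (σ : ℝ → B → B) (b : B) : Set B :=
  closure (range fun t => σ t b)

end Hulls

section ModuliOfFunction

variable {N : ℕ} {V : Type} [NormedAddCommGroup V] [MeasurableSpace V]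

/-- `θ_j(s) = sup_t ∫_t^{t+s} m^j(u) du`, with values in `[0, ∞]`. -/
def thetaENN (f : ℝ × E N → V) (j : ℕ) (s : ℝ≥0) : ℝ≥0∞ :=
  ⨆ t : ℝ, ∫⁻ u in Icc t (t + s), optMBound f j u

theorem thetaENN_zero (f : ℝ × E N → V) (j : ℕ) : thetaENN f j 0 = 0 := by
  simp [thetaENN]

theorem thetaENN_mono (f : ℝ × E N → V) (j : ℕ) : Monotone (thetaENN f j) := by
  intro s s' h
  refine iSup_mono fun t => lintegral_mono_set (Icc_subset_Icc le_rfl ?_)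
  have : (s : ℝ) ≤ s' := by exact_mod_cast h
  linarith

theorem thetaENN_mono_index (f : ℝ × E N → V) {j j' : ℕ} (h : j ≤ j') (s : ℝ≥0) :
    thetaENN f j s ≤ thetaENN f j' s := by
  refine iSup_mono fun t => lintegral_mono fun u => ?_
  exact biSup_mono fun x hx => Metric.closedBall_subset_closedBall (by exact_mod_cast h) hx

theorem thetaENN_add_le (f : ℝ × E N → V) (j : ℕ) (s s' : ℝ≥0) :
    thetaENN f j (s + s') ≤ thetaENN f j s + thetaENN f j s' := by
  refine iSup_le fun t => ?_
  have hs : Icc t (t + ((s + s' : ℝ≥0) : ℝ)) ⊆ Icc t (t + s) ∪ Icc (t + s) (t + s + s') := by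
    intro u hu
    rcases le_total u (t + s) with h | h
    · exact Or.inl ⟨hu.1, h⟩
    · refine Or.inr ⟨h, ?_⟩
      have := hu.2
      push_cast at this
      linarith
  calc ∫⁻ u in Icc t (t + ((s + s' : ℝ≥0) : ℝ)), optMBound f j u
      ≤ ∫⁻ u in Icc t (t + s) ∪ Icc (t + s) (t + s + s'), optMBound f j u := lintegral_mono_set hs
    _ ≤ _ := lintegral_union_le _ _ _
    _ ≤ _ := add_le_add (le_iSup (fun t : ℝ => ∫⁻ u in Icc t (t + s), optMBound f j u) t)
        (le_iSup (fun t : ℝ => ∫⁻ u in Icc t (t + s'), optMBound f j u) (t + s))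

theorem exists_thetaENN_lt {f : ℝ × E N → V} (hf : HasL1LocEquicontinuousMBounds f) (j : ℕ)
    {ε : ℝ≥0∞} (hε : 0 < ε) : ∃ δ : ℝ≥0, 0 < δ ∧ thetaENN f j δ ≤ ε := by
  obtain ⟨δ, hδ, h⟩ := hf j 1 one_pos ε hε
  refine ⟨(min (δ / 2) 1).toNNReal, ?_, iSup_le fun t => ?_⟩
  · exact Real.toNNReal_pos.2 (lt_min (by positivity) one_pos)
  have hd0' : 0 ≤ min (δ / 2) 1 := le_min (by positivity) zero_le_one
  rw [Real.coe_toNNReal _ hd0']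
  set d : ℝ := min (δ / 2) 1 with hd
  have hd0 : 0 ≤ d := hd0'
  have hd1 : d ≤ 1 := min_le_right _ _
  have hd2 : d ≤ δ / 2 := min_le_left _ _
  have h1 := h 0 d (by norm_num) hd0 hd1 (by linarith)
  have h2 : ∫⁻ u in Icc (0 : ℝ) d, optMBound (shift t f) j u < ε :=
    lt_of_le_of_lt (le_iSup₂ (f := fun (m : ℝ → ℝ≥0∞)
      (_ : m ∈ range fun τ : ℝ => optMBound (shift τ f) j) => ∫⁻ u in Icc (0 : ℝ) d, m u)
      _ (mem_range_self t)) h1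
  have hmp := (measurePreserving_add_right volume t).restrict_preimage
    (measurableSet_Icc (a := t) (b := t + d))
  have e : (fun s : ℝ => s + t) ⁻¹' Icc t (t + d) = Icc 0 d := by
    ext s
    simp only [mem_preimage, mem_Icc]
    constructor <;> rintro ⟨h, h'⟩ <;> constructor <;> linarith
  rw [e] at hmp
  have hemb : MeasurableEmbedding fun s : ℝ => s + t :=
    (MeasurableEquiv.addRight t).measurableEmbedding
  have h3 := hmp.lintegral_comp_emb hemb (optMBound f j)
  exact h3 ▸ h2.le

theorem thetaENN_ne_top {f : ℝ × E N → V} (hf : HasL1LocEquicontinuousMBounds f) (j : ℕ)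
    (s : ℝ≥0) : thetaENN f j s ≠ ∞ := by
  obtain ⟨δ, hδ, h⟩ := exists_thetaENN_lt hf j (ε := 1) one_pos
  have hn : ∀ n : ℕ, thetaENN f j (n * δ) ≤ n := by
    intro n
    induction n with
    | zero => simp [thetaENN_zero]
    | succ n ih =>
      have : ((n + 1 : ℕ) : ℝ≥0) * δ = n * δ + δ := by push_cast; ring
      rw [this]
      push_cast
      exact (thetaENN_add_le f j _ _).trans (add_le_add ih h)
  obtain ⟨n, hn'⟩ := exists_nat_ge (s / δ)
  have hs : s ≤ n * δ := (div_le_iff₀ hδ).1 hn'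
  exact ne_top_of_le_ne_top (ENNReal.natCast_ne_top n) ((thetaENN_mono f j hs).trans (hn n))

theorem continuous_thetaENN_toNNReal {f : ℝ × E N → V} (hf : HasL1LocEquicontinuousMBounds f)
    (j : ℕ) : Continuous fun s => (thetaENN f j s).toNNReal := by
  rw [Metric.continuous_iff]
  intro s ε hε
  obtain ⟨δ, hδ, h⟩ := exists_thetaENN_lt hf j (ε := ENNReal.ofReal (ε / 2)) (by simpa using hε)
  have hsub : ∀ u v : ℝ≥0, u ≤ v → (v : ℝ) - u < δ →
      |((thetaENN f j v).toNNReal : ℝ) - (thetaENN f j u).toNNReal| < ε := by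
    intro u v huv hd
    have h1 : thetaENN f j v ≤ thetaENN f j u + ENNReal.ofReal (ε / 2) := by
      have hv : v ≤ u + δ := by
        rw [← NNReal.coe_le_coe]; push_cast; linarith
      exact (thetaENN_mono f j hv).trans
        ((thetaENN_add_le f j u δ).trans (add_le_add le_rfl h))
    have h2 : (thetaENN f j v).toReal ≤ (thetaENN f j u).toReal + ε / 2 := by
      have := ENNReal.toReal_mono
        (ENNReal.add_ne_top.2 ⟨thetaENN_ne_top hf j u, ENNReal.ofReal_ne_top⟩) h1
      rwa [ENNReal.toReal_add (thetaENN_ne_top hf j u) ENNReal.ofReal_ne_top,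
        ENNReal.toReal_ofReal (by positivity)] at this
    have h3 : (thetaENN f j u).toReal ≤ (thetaENN f j v).toReal :=
      ENNReal.toReal_mono (thetaENN_ne_top hf j v) (thetaENN_mono f j huv)
    change |(thetaENN f j v).toReal - (thetaENN f j u).toReal| < ε
    rw [abs_of_nonneg (by linarith)]
    linarith
  refine ⟨δ, by exact_mod_cast hδ, fun u hu => ?_⟩
  rw [NNReal.dist_eq] at hu ⊢
  rcases le_total u s with hus | hus
  · rw [abs_sub_comm] at hu ⊢
    exact hsub u s hus ((le_abs_self _).trans_lt hu)
  · exact hsub s u hus ((le_abs_self _).trans_lt hu)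

/-- The suitable set of moduli of continuity `Θ = (θ_j)_j`,
`θ_j(s) = sup_t ∫_t^{t+s} m^j(u) du`, where `m^j` is the optimal `m`-bound of `f` on `B_j`. -/
def moduliOf (f : ℝ × E N → V) (hf : HasL1LocEquicontinuousMBounds f) : Moduli where
  θ _ _ j s := (thetaENN f j s).toNNReal
  continuous_θ _ _ j := continuous_thetaENN_toNNReal hf j
  monotone_θ _ _ j _ s' h := ENNReal.toNNReal_mono (thetaENN_ne_top hf j s') (thetaENN_mono f j h)
  θ_zero _ _ j := by simp [thetaENN_zero]
  θ_le _ _ _ _ _ j' _ _ _ h s :=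
    ENNReal.toNNReal_mono (thetaENN_ne_top hf j' s) (thetaENN_mono_index f h s)

end ModuliOfFunction

section ODE

variable {W : Type} [NormedAddCommGroup W] [NormedSpace ℝ W]

/-- `z` is, on the interval `J ∋ 0`, a Carathéodory solution of `ż = f(t, z)`, `z(0) = w`. -/
structure IsSolutionOn (f : ℝ × W → W) (w : W) (J : Set ℝ) (z : ℝ → W) : Prop where
  ordConnected : J.OrdConnected
  zero_mem : (0 : ℝ) ∈ J
  continuousOn : ContinuousOn z J
  intervalIntegrable : ∀ t ∈ J, IntervalIntegrable (fun s => f (s, z s)) volume 0 t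
  eq_integral : ∀ t ∈ J, z t = w + ∫ s in (0 : ℝ)..t, f (s, z s)

/-- The union of all the intervals on which the Cauchy problem has a solution. -/
def maxInterval (f : ℝ × W → W) (w : W) : Set ℝ :=
  {t | ∃ (J : Set ℝ) (z : ℝ → W), IsSolutionOn f w J z ∧ t ∈ J}

open Classical in
/-- The value at `t` of a solution of the Cauchy problem defined at `t`
(the value is `0` if there is none). -/
def maxSolution (f : ℝ × W → W) (w : W) (t : ℝ) : W :=
  if h : ∃ z : ℝ → W, ∃ J : Set ℝ, IsSolutionOn f w J z ∧ t ∈ J then h.choose t else 0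

/-- `z`, defined on the open interval `I`, is the unique maximal solution of the Cauchy problem:
every solution on an interval is a restriction of it. -/
structure IsMaximalSolution (f : ℝ × W → W) (w : W) (I : Set ℝ) (z : ℝ → W) : Prop where
  isOpen : IsOpen I
  isSolutionOn : IsSolutionOn f w I z
  unique : ∀ (J : Set ℝ) (u : ℝ → W), IsSolutionOn f w J u → J ⊆ I ∧ EqOn u z J

/-- The vector field of the triangular system `ẋ = f(t, x)`, `ẏ = F(t, x) y + h(t, x)`. -/
def triangular (f : ℝ × W → W) (F : ℝ × W → W →L[ℝ] W) (h : ℝ × W → W) :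
    ℝ × (W × W) → W × W :=
  fun q => (f (q.1, q.2.1), F (q.1, q.2.1) q.2.2 + h (q.1, q.2.1))

end ODE

section Solutions

variable {N : ℕ} {Θ : Moduli} {p : ℝ≥0∞}

/-- The maximal interval `I_{g,x₀}`, for a class `g`. -/
def solInterval (g : LCSpace Θ p N (E N)) (x₀ : E N) : Set ℝ := maxInterval g.rep x₀

/-- The solution `x(t, g, x₀)`, for a class `g`. -/
def solX (t : ℝ) (g : LCSpace Θ p N (E N)) (x₀ : E N) : E N := maxSolution g.rep x₀ t

/-- The triples `(g, G, k)` of coefficients; matrices are linear endomorphisms of `ℝ^N`. -/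
abbrev Coeff (Θ : Moduli) (p : ℝ≥0∞) (N : ℕ) : Type :=
  LCSpace Θ p N (E N) × ThetaCSpace Θ p N (E N →L[ℝ] E N) × ThetaCSpace Θ p N (E N)

/-- The component `y(t, g, G, k, x₀, y₀)` of the solution of the triangular system. -/
def solY (t : ℝ) (c : Coeff Θ p N) (x₀ y₀ : E N) : E N :=
  (maxSolution (triangular c.1.rep c.2.1.rep c.2.2.rep) (x₀, y₀) t).2

/-- The hull of `f` in `(𝔏ℭ_p, 𝒯_Θ)`, for the moduli `Θ` determined by `f`. -/
def hullLC (p : ℝ≥0∞) (f : ℝ × E N → E N) (hf : f ∈ LC p N (E N))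
    (hm : HasL1LocEquicontinuousMBounds f) : Set (LCSpace (moduliOf f hm) p N (E N)) :=
  hull translateLC (ThetaSpace.mk (moduliOf f hm) p f hf)

/-- The hull of `(f, F, h)` in `𝔏ℭ_p × Θℭ_p(ℝ^{N×N}) × Θℭ_p`, with the product topology
`𝒯_Θ × 𝒯_Θ × 𝒯_Θ`, for the moduli `Θ` determined by `f`. -/
def hullTriple (p : ℝ≥0∞) (f : ℝ × E N → E N) (hf : f ∈ LC p N (E N))
    (hm : HasL1LocEquicontinuousMBounds f)
    (F : ThetaCSpace (moduliOf f hm) p N (E N →L[ℝ] E N))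
    (h : ThetaCSpace (moduliOf f hm) p N (E N)) : Set (Coeff (moduliOf f hm) p N) :=
  hull translateTriple (ThetaSpace.mk (moduliOf f hm) p f hf, F, h)

/-- The set `𝒰₁`, for the hull `H`. -/
def domain₁ (H : Set (LCSpace Θ p N (E N))) : Set (ℝ × LCSpace Θ p N (E N) × E N) :=
  {q | q.2.1 ∈ H ∧ q.1 ∈ solInterval q.2.1 q.2.2}

/-- The set `𝒰₂`, for the hull `H`. -/
def domain₂ (H : Set (Coeff Θ p N)) : Set (ℝ × Coeff Θ p N × (E N × E N)) :=
  {q | q.2.1 ∈ H ∧ q.1 ∈ solInterval q.2.1.1 q.2.2.1}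

end Solutions

/-- `(t, b, z) ↦ (σ t b, φ (t, b, z))`, with domain `U`, is a local continuous skew-product flow on
`H × Z` with base flow `σ` on the subspace `H` of `B`; the set `U` is open in `ℝ × H × Z`. -/
structure IsLocalSkewProductFlow {B Z : Type} [TopologicalSpace B] [TopologicalSpace Z]
    (H : Set B) (σ : ℝ → B → B) (U : Set (ℝ × B × Z)) (φ : ℝ × B × Z → Z) : Prop where
  base_mapsTo : ∀ t, MapsTo (σ t) H H
  base_zero : ∀ b ∈ H, σ 0 b = b
  base_add : ∀ s t, ∀ b ∈ H, σ (s + t) b = σ t (σ s b)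
  base_continuousOn : ContinuousOn (fun q : ℝ × B => σ q.1 q.2) (univ ×ˢ H)
  isOpen_domain : ∃ O : Set (ℝ × B × Z), IsOpen O ∧ U = O ∩ {q | q.2.1 ∈ H}
  zero_mem : ∀ b ∈ H, ∀ z, (0, b, z) ∈ U
  ordConnected : ∀ b z, {t : ℝ | (t, b, z) ∈ U}.OrdConnected
  continuousOn : ContinuousOn (fun q : ℝ × B × Z => (σ q.1 q.2.1, φ q)) U
  map_zero : ∀ b ∈ H, ∀ z, φ (0, b, z) = z
  mem_add_iff : ∀ s t b z, (s, b, z) ∈ U →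
    ((t, σ s b, φ (s, b, z)) ∈ U ↔ (s + t, b, z) ∈ U)
  map_add : ∀ s t b z, (s, b, z) ∈ U → (s + t, b, z) ∈ U →
    φ (s + t, b, z) = φ (t, σ s b, φ (s, b, z))

end Caratheodory

end

open Caratheodory

/-!
Every element `g` of the hull is a limit of translates of `f`, and the topology `𝒯_Θ` controls
`g_n - g` only along curves with the moduli `θ_j`.  Everything rests on the fact that solutions are
such curves.  Since `g_n(·, x) → g(·, x)` in `L^1` for each constant `x`, monotone convergence over a
countable dense subset of `B_j` gives `∫_t^{t+d} m^j_g ≤ θ_j(d)` for all `g` in the hull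
(`mboundsDominated_of_mem_hullLC`); so every solution of `ẋ = g(t, x)` with values in `B_j` has the
modulus of continuity `θ_j`.

Local existence and continuous dependence are both obtained by truncation.  Let `π` be the radial
retraction onto `B_j`.  The field `g(t, π x)` is Lipschitz in `x` on the whole space with an
`L^1_loc` constant, so its solutions are global (`exists_solution_of_lipschitz`, a contraction in a
supremum norm weighted by `exp (-2 |∫ l|)`).  As `π` does not increase distances, `π ∘ ζ` belongs to
`𝒦^I_j` whenever `ζ` solves a truncated equation (`ballRetract_mem_admissible`).  If `g_n → g` and
`x_n → x₀`, then `∫ |(g_n - g)(t, π ζ_n(t))| dt` is at most a constant times `p_{I,j}(g_n - g)`, and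
Gronwall's inequality with the `l`-bound of `g` alone yields `ζ_n → x(·, g, x₀)` uniformly on `I`
(`tendstoUniformlyOn_maxSolution`).  In particular `ζ_n` stays in `B_j` for large `n` and solves the
original equation, so that no exit times need to be followed.  For the second equation, the
definition of `Θℭ_p` gives `G_n(t, x_n(t)) → G(t, x(t))` and `k_n(t, x_n(t)) → k(t, x(t))` in `L^1`,
and a second application of Gronwall's inequality concludes (`tendstoUniformlyOn_linField`).

The spaces are first countable (`ThetaSpace.nhds_eq`), so openness of the domains and continuity of
the flows can be tested on sequences.  Two functions of `Θℭ_p` that coincide a.e. coincide along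
every admissible curve (`ae_eq_along_of_ae_eq`, by Fubini and a small constant shift of the curve);
this gives the independence of the representatives.  The translation flow is continuous
(`ThetaSpace.continuous_translate`) because `𝒦^I_j` is compact, by Arzelà–Ascoli, and translations
are continuous in `L^p`; here `p < ∞` is used.  The cocycle identities express the uniqueness of
maximal solutions.
-/

noncomputable section

namespace Caratheodory

/-! ### Admissible curves and the seminorms `p_{I,j}` -/

section Seminorm

variable {N : ℕ} {Θ : Moduli} {p : ℝ≥0∞}

theorem admissible_mono_index {a b : ℚ} {j j' : ℕ} (hj : j ≤ j') :
    admissible Θ N a b j ⊆ admissible Θ N a b j' := by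
  intro x hx
  refine ⟨hx.1, fun t ht => (hx.2.1 t ht).trans (by exact_mod_cast hj), fun s hs t ht => ?_⟩
  have hab : a ≤ b := by exact_mod_cast hs.1.trans hs.2
  exact (hx.2.2 s hs t ht).trans
    (NNReal.coe_le_coe.2 (Θ.θ_le a b a b j j' le_rfl hab le_rfl hj _))

theorem admissible_congr {a b : ℚ} {j : ℕ} {x y : ℝ → E N} (h : EqOn x y (Icc (a : ℝ) b))
    (hx : x ∈ admissible Θ N a b j) : y ∈ admissible Θ N a b j := by
  refine ⟨hx.1.congr h.symm, fun t ht => h ht ▸ hx.2.1 t ht, fun s hs t ht => ?_⟩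
  rw [← h hs, ← h ht]
  exact hx.2.2 s hs t ht

/-- Extension by constants sends `𝒦^I_j` to `𝒦^J_j` for `I ⊆ J`. -/
theorem continuous_clamp {X : Type*} [TopologicalSpace X] {a b : ℝ} (hab : a ≤ b) {x : ℝ → X}
    (hx : ContinuousOn x (Icc a b)) : Continuous fun r => x (max a (min b r)) := by
  have hc : Continuous fun r : ℝ => max a (min b r) := by fun_prop
  exact hx.comp_continuous hc (fun r => ⟨le_max_left _ _, max_le hab (min_le_left _ _)⟩)

theorem clamp_eq {a b r : ℝ} (hr : r ∈ Icc a b) : max a (min b r) = r := by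
  rw [min_eq_right hr.2, max_eq_right hr.1]

theorem clamp_mem {a b : ℝ} (hab : a ≤ b) (r : ℝ) : max a (min b r) ∈ Icc a b :=
  ⟨le_max_left _ _, max_le hab (min_le_left _ _)⟩

theorem add_const_mem_admissible {a b : ℚ} {j : ℕ} {x : ℝ → E N}
    (hx : x ∈ admissible Θ N a b j) {c : E N} (hc : ‖c‖ ≤ 1) :
    (fun t => x t + c) ∈ admissible Θ N a b (j + 1) := by
  have hx' := admissible_mono_index (Nat.le_succ j) hx
  refine ⟨hx.1.add continuousOn_const, fun t ht => ?_, fun s hs t ht => ?_⟩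
  · have := norm_add_le (x t) c
    have := hx.2.1 t ht
    push_cast
    linarith
  · simpa using hx'.2.2 s hs t ht

variable {V : Type} [NormedAddCommGroup V] [MeasurableSpace V] [BorelSpace V]
  [SecondCountableTopology V]

theorem aestronglyMeasurable_comp_curve {f : ℝ × E N → V} (hf : Measurable f) {a b : ℝ}
    {x : ℝ → E N} (hx : ContinuousOn x (Icc a b)) :
    AEStronglyMeasurable (fun t => f (t, x t)) (volume.restrict (Icc a b)) :=
  (hf.comp_aemeasurable
    (aemeasurable_id.prodMk (hx.aemeasurable measurableSet_Icc))).aestronglyMeasurable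

theorem eLpNorm_le_thetaSeminorm {a b : ℚ} {j : ℕ} {x : ℝ → E N}
    (hx : x ∈ admissible Θ N a b j) (f : ℝ × E N → V) :
    eLpNorm (fun t => f (t, x t)) p (volume.restrict (Icc (a : ℝ) b)) ≤
      thetaSeminorm Θ p a b j f :=
  le_iSup₂ (f := fun (x : ℝ → E N) (_ : x ∈ admissible Θ N a b j) =>
    eLpNorm (fun t => f (t, x t)) p (volume.restrict (Icc (a : ℝ) b))) x hx

theorem thetaSeminorm_sub_le (hp : 1 ≤ p) {f g h : ℝ × E N → V} (hf : Measurable f)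
    (hg : Measurable g) (hh : Measurable h) (a b : ℚ) (j : ℕ) :
    thetaSeminorm Θ p a b j (f - h) ≤
      thetaSeminorm Θ p a b j (f - g) + thetaSeminorm Θ p a b j (g - h) := by
  refine iSup₂_le fun x hx => ?_
  have e : (fun t => (f - h) (t, x t)) =
      (fun t => (f - g) (t, x t)) + (fun t => (g - h) (t, x t)) := by
    ext t; simp
  rw [e]
  exact (eLpNorm_add_le (aestronglyMeasurable_comp_curve (hf.sub hg) hx.1)
    (aestronglyMeasurable_comp_curve (hg.sub hh) hx.1) hp).trans
    (add_le_add (eLpNorm_le_thetaSeminorm hx _) (eLpNorm_le_thetaSeminorm hx _))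

theorem thetaSeminorm_sub_comm (f g : ℝ × E N → V) (a b : ℚ) (j : ℕ) :
    thetaSeminorm Θ p a b j (f - g) = thetaSeminorm Θ p a b j (g - f) := by
  unfold thetaSeminorm
  refine iSup_congr fun x => iSup_congr fun _ => ?_
  rw [← eLpNorm_neg]
  congr 1
  ext t
  simp

theorem thetaSeminorm_eq_zero_of_lt {a b : ℚ} (h : b < a) (j : ℕ) (f : ℝ × E N → V) :
    thetaSeminorm Θ p a b j f = 0 := by
  have : Icc (a : ℝ) b = ∅ := Icc_eq_empty (by exact_mod_cast not_le.2 h)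
  simp [thetaSeminorm, this]

/-- Two `Θ`-Carathéodory functions that coincide a.e. coincide along every admissible curve.
By Fubini this holds along the curve `x + c` for almost every constant `c`, and `x + c` is
admissible for the next index; then `c → 0`. -/
theorem ae_eq_along_of_ae_eq (hp : 1 ≤ p) {f g : ℝ × E N → V} (hf : f ∈ ThetaC Θ p N V)
    (hg : g ∈ ThetaC Θ p N V) (hfg : f =ᵐ[volume] g) {a b : ℚ} {j : ℕ} {x : ℝ → E N}
    (hx : x ∈ admissible Θ N a b j) :
    ∀ᵐ t ∂volume.restrict (Icc (a : ℝ) b), f (t, x t) = g (t, x t) := by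
  rcases lt_or_ge b a with hab | hab
  · have : Icc (a : ℝ) b = ∅ := Icc_eq_empty (by exact_mod_cast not_le.2 hab)
    simp [this]
  have hab' : (a : ℝ) ≤ b := by exact_mod_cast hab
  set xc : ℝ → E N := fun r => x (max (a : ℝ) (min b r)) with hxc
  have hxcont : Continuous xc := continuous_clamp hab' hx.1
  have h1 : ∀ᵐ t : ℝ, ∀ᵐ y : E N, f (t, y) = g (t, y) := by
    rw [Measure.volume_eq_prod] at hfg
    exact Measure.ae_ae_of_ae_prod hfg
  have h2 : ∀ᵐ t : ℝ, ∀ᵐ c : E N, f (t, xc t + c) = g (t, xc t + c) := by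
    filter_upwards [h1] with t ht
    exact (measurePreserving_add_left volume (xc t)).quasiMeasurePreserving.ae ht
  have hT : Measurable fun q : ℝ × E N => (q.1, xc q.1 + q.2) :=
    measurable_fst.prodMk ((hxcont.measurable.comp measurable_fst).add measurable_snd)
  have h3 : ∀ᵐ c : E N, ∀ᵐ t : ℝ, f (t, xc t + c) = g (t, xc t + c) := by
    refine (Measure.ae_ae_comm (p := fun t c => f (t, xc t + c) = g (t, xc t + c)) ?_).1 h2
    exact measurableSet_eq_fun (hf.1.comp hT) (hg.1.comp hT)
  -- almost every shift `c` of the curve is good, so there are arbitrarily small good ones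
  have h4 : ∀ n : ℕ, ∃ c : E N, ‖c‖ < 1 / ((n : ℝ) + 1) ∧
      ∀ᵐ t : ℝ, f (t, xc t + c) = g (t, xc t + c) := by
    intro n
    obtain ⟨c, hc, hc'⟩ := (Measure.dense_of_ae h3).exists_dist_lt 0
      (ε := 1 / ((n : ℝ) + 1)) (by positivity)
    exact ⟨c, by simpa using hc', hc⟩
  choose c hc hcfg using h4
  have hc1 : ∀ n, ‖c n‖ ≤ 1 := fun n => (hc n).le.trans (by
    rw [div_le_one (by positivity)]; simp)
  have hxn : ∀ n, (fun t => x t + c n) ∈ admissible Θ N a b (j + 1) := fun n =>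
    add_const_mem_admissible hx (hc1 n)
  have hunif : TendstoUniformlyOn (fun n t => x t + c n) x atTop (Icc (a : ℝ) b) := by
    rw [Metric.tendstoUniformlyOn_iff]
    intro ε hε
    have := tendsto_one_div_add_atTop_nhds_zero_nat (𝕜 := ℝ)
    filter_upwards [this.eventually (gt_mem_nhds hε)] with n hn t _
    simpa using (hc n).trans hn
  have hx' := admissible_mono_index (Nat.le_succ j) hx
  have kf := hf.2.2 a b (j + 1) _ x hxn hx' hunif
  have kg := hg.2.2 a b (j + 1) _ x hxn hx' hunif
  have hzero : eLpNorm (fun t => f (t, x t) - g (t, x t)) p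
      (volume.restrict (Icc (a : ℝ) b)) = 0 := by
    refine le_antisymm (ge_of_tendsto' (by simpa using kf.add kg) fun n => ?_) zero_le
    rw [add_comm]
    have hae : (fun t => f (t, x t) - g (t, x t)) =ᵐ[volume.restrict (Icc (a : ℝ) b)]
        (fun t => g (t, x t + c n) - g (t, x t)) -
          (fun t => f (t, x t + c n) - f (t, x t)) := by
      filter_upwards [ae_restrict_of_ae (hcfg n), ae_restrict_mem measurableSet_Icc] with t ht hI
      simp only [hxc, clamp_eq hI] at ht
      simp [ht]
    rw [eLpNorm_congr_ae hae]
    have m1 : ∀ {u : ℝ × E N → V}, Measurable u → AEStronglyMeasurable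
        (fun t => u (t, x t + c n) - u (t, x t)) (volume.restrict (Icc (a : ℝ) b)) := fun hu =>
      (aestronglyMeasurable_comp_curve hu (hxn n).1).sub (aestronglyMeasurable_comp_curve hu hx.1)
    exact eLpNorm_sub_le (m1 hg.1) (m1 hf.1) hp
  filter_upwards [(eLpNorm_eq_zero_iff ((aestronglyMeasurable_comp_curve hf.1 hx.1).sub
    (aestronglyMeasurable_comp_curve hg.1 hx.1)) (one_pos.trans_le hp).ne').1 hzero] with t ht
  exact sub_eq_zero.1 ht

theorem thetaSeminorm_sub_eq_zero (hp : 1 ≤ p) {f g : ℝ × E N → V} (hf : f ∈ ThetaC Θ p N V)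
    (hg : g ∈ ThetaC Θ p N V) (hfg : f =ᵐ[volume] g) (a b : ℚ) (j : ℕ) :
    thetaSeminorm Θ p a b j (f - g) = 0 := by
  refine le_antisymm (iSup₂_le fun x hx => ?_) zero_le
  rw [eLpNorm_congr_ae (g := 0), eLpNorm_zero]
  filter_upwards [ae_eq_along_of_ae_eq hp hf hg hfg hx] with t ht
  simp [ht]

end Seminorm

/-! ### The topology of the space of classes -/

section Topology

variable {N : ℕ} {Θ : Moduli} {p : ℝ≥0∞} {V : Type} [NormedAddCommGroup V] [MeasurableSpace V]
  {S : Set (ℝ × E N → V)}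

theorem ThetaSpace.rep_mem (g : ThetaSpace Θ p S) : g.rep ∈ S :=
  (Quotient.out (s := aeSetoid S) g).2

theorem ThetaSpace.mk_rep (g : ThetaSpace Θ p S) : ThetaSpace.mk Θ p g.rep g.rep_mem = g :=
  Quotient.out_eq (s := aeSetoid S) g

theorem ThetaSpace.isRep_rep (g : ThetaSpace Θ p S) : g.IsRep g.rep := ⟨g.rep_mem, g.mk_rep⟩

theorem ThetaSpace.mk_eq_mk {f g : ℝ × E N → V} {hf : f ∈ S} {hg : g ∈ S} :
    ThetaSpace.mk Θ p f hf = ThetaSpace.mk Θ p g hg ↔ f =ᵐ[volume] g :=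
  Quotient.eq (r := aeSetoid S)

theorem ThetaSpace.IsRep.ae_eq_rep {g : ThetaSpace Θ p S} {f : ℝ × E N → V} (h : g.IsRep f) :
    f =ᵐ[volume] g.rep := by
  obtain ⟨hf, h⟩ := h
  rw [← g.mk_rep] at h
  exact ThetaSpace.mk_eq_mk.1 h

variable [BorelSpace V] [SecondCountableTopology V]

/-- In the space of functions, a filter converges to `f` iff all the seminorms of the difference
tend to zero. -/
theorem tendsto_thetaTopology_iff (hp : 1 ≤ p) (hS : S ⊆ ThetaC Θ p N V) {ι : Type*}
    {l : Filter ι} {u : ι → S} {f : S} :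
    Tendsto u l (@nhds S (thetaTopology Θ p S) f) ↔
      ∀ a b j, Tendsto (fun i => thetaSeminorm Θ p a b j ((u i).1 - f.1)) l (𝓝 0) := by
  rw [TopologicalSpace.tendsto_nhds_generateFrom_iff]
  constructor
  · intro h a b j
    rw [ENNReal.tendsto_nhds_zero]
    intro ε hε
    have := h _ ⟨f, a, b, j, ε, hε, rfl⟩ (by
      rw [mem_ofPred_eq, thetaSeminorm_sub_eq_zero hp (hS f.2) (hS f.2) EventuallyEq.rfl]
      exact hε)
    filter_upwards [this] with i hi
    exact le_of_lt hi
  · rintro h _ ⟨g, a, b, j, ε, hε, rfl⟩ hf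
    have hf' : thetaSeminorm Θ p a b j (f.1 - g.1) < ε := hf
    have h1 : Tendsto (fun i => thetaSeminorm Θ p a b j ((u i).1 - f.1) +
        thetaSeminorm Θ p a b j (f.1 - g.1)) l (𝓝 (0 + thetaSeminorm Θ p a b j (f.1 - g.1))) :=
      (h a b j).add tendsto_const_nhds
    rw [zero_add] at h1
    filter_upwards [h1.eventually (gt_mem_nhds hf')] with i hi
    exact (thetaSeminorm_sub_le hp (hS (u i).2).1 (hS f.2).1 (hS g.2).1 a b j).trans_lt hi

/-- The topology on functions is induced from the topology on classes: functions that
coincide a.e. are topologically indistinguishable. -/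
theorem isInducing_mk (hp : 1 ≤ p) (hS : S ⊆ ThetaC Θ p N V) :
    @IsInducing S (ThetaSpace Θ p S) (thetaTopology Θ p S) _
      (fun f => ThetaSpace.mk Θ p f.1 f.2) := by
  let _ := thetaTopology Θ p S
  set π : S → ThetaSpace Θ p S := fun f => ThetaSpace.mk Θ p f.1 f.2 with hπ
  have hsat : ∀ U : Set S, IsOpen U → ∀ f g : S, f.1 =ᵐ[volume] g.1 → f ∈ U → g ∈ U := by
    intro U hU f g hfg hf
    have ht : Tendsto (fun _ : ℕ => g) atTop (𝓝 f) := by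
      refine (tendsto_thetaTopology_iff hp hS).2 fun a b j => ?_
      simp [thetaSeminorm_sub_eq_zero hp (hS g.2) (hS f.2) hfg.symm]
    obtain ⟨n, hn⟩ := (ht.eventually (hU.mem_nhds hf)).exists
    exact hn
  have hpre : ∀ U : Set S, IsOpen U → π ⁻¹' (π '' U) = U := by
    intro U hU
    refine Subset.antisymm ?_ (subset_preimage_image _ _)
    rintro f ⟨g, hg, hgf⟩
    exact hsat U hU g f (ThetaSpace.mk_eq_mk.1 hgf) hg
  refine ⟨TopologicalSpace.ext (Set.ext fun U => ⟨fun hU => ?_, ?_⟩)⟩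
  · refine ⟨π '' U, ?_, hpre U hU⟩
    change IsOpen (π ⁻¹' (π '' U))
    rw [hpre U hU]
    exact hU
  · rintro ⟨D, hD, rfl⟩
    exact hD

theorem ThetaSpace.tendsto_nhds_iff (hp : 1 ≤ p) (hS : S ⊆ ThetaC Θ p N V) {ι : Type*}
    {l : Filter ι} {u : ι → ThetaSpace Θ p S} {g : ThetaSpace Θ p S} :
    Tendsto u l (𝓝 g) ↔
      ∀ a b j, Tendsto (fun i => thetaSeminorm Θ p a b j ((u i).rep - g.rep)) l (𝓝 0) := by
  let _ := thetaTopology Θ p S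
  have h := (isInducing_mk hp hS).tendsto_nhds_iff
    (f := fun i => (⟨(u i).rep, (u i).rep_mem⟩ : S)) (l := l) (y := ⟨g.rep, g.rep_mem⟩)
  rw [tendsto_thetaTopology_iff hp hS] at h
  rw [h]
  have e : ((fun f : S => ThetaSpace.mk Θ p f.1 f.2) ∘
      fun i => (⟨(u i).rep, (u i).rep_mem⟩ : S)) = u :=
    funext fun i => (u i).mk_rep
  rw [e]
  change _ ↔ Tendsto u l (𝓝 (ThetaSpace.mk Θ p g.rep g.rep_mem))
  rw [g.mk_rep]

theorem ThetaSpace.nhds_eq (hp : 1 ≤ p) (hS : S ⊆ ThetaC Θ p N V) (g : ThetaSpace Θ p S) :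
    𝓝 g = ⨅ q : ℚ × ℚ × ℕ, comap (fun u : ThetaSpace Θ p S =>
      thetaSeminorm Θ p q.1 q.2.1 q.2.2 (u.rep - g.rep)) (𝓝 0) := by
  have key : ∀ l : Filter (ThetaSpace Θ p S), l ≤ 𝓝 g ↔ l ≤ ⨅ q : ℚ × ℚ × ℕ,
      comap (fun u : ThetaSpace Θ p S =>
        thetaSeminorm Θ p q.1 q.2.1 q.2.2 (u.rep - g.rep)) (𝓝 0) := by
    intro l
    rw [← tendsto_id', ThetaSpace.tendsto_nhds_iff hp hS, ← tendsto_id', tendsto_iInf]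
    simp only [tendsto_comap_iff, Prod.forall, Function.comp_def, id]
  exact le_antisymm ((key _).1 le_rfl) ((key _).2 le_rfl)

theorem ThetaSpace.firstCountableTopology (hp : 1 ≤ p) (hS : S ⊆ ThetaC Θ p N V) :
    FirstCountableTopology (ThetaSpace Θ p S) :=
  ⟨fun g => by rw [ThetaSpace.nhds_eq hp hS]; infer_instance⟩

/-- The seminorms of a difference of classes can be computed with any representatives. -/
theorem thetaSeminorm_congr (hp : 1 ≤ p) {f f' g g' : ℝ × E N → V} (hf : f ∈ ThetaC Θ p N V)
    (hf' : f' ∈ ThetaC Θ p N V) (hg : g ∈ ThetaC Θ p N V) (hg' : g' ∈ ThetaC Θ p N V)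
    (h : f =ᵐ[volume] f') (h' : g =ᵐ[volume] g') (a b : ℚ) (j : ℕ) :
    thetaSeminorm Θ p a b j (f - g) = thetaSeminorm Θ p a b j (f' - g') := by
  have key : ∀ {f f' g g' : ℝ × E N → V}, f ∈ ThetaC Θ p N V → f' ∈ ThetaC Θ p N V →
      g ∈ ThetaC Θ p N V → g' ∈ ThetaC Θ p N V → f =ᵐ[volume] f' → g =ᵐ[volume] g' →
      thetaSeminorm Θ p a b j (f - g) ≤ thetaSeminorm Θ p a b j (f' - g') := by
    intro f f' g g' hf hf' hg hg' h h'
    have h1 := thetaSeminorm_sub_le (Θ := Θ) hp hf.1 hf'.1 hg.1 a b j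
    have h2 := thetaSeminorm_sub_le (Θ := Θ) hp hf'.1 hg'.1 hg.1 a b j
    rw [thetaSeminorm_sub_eq_zero hp hf hf' h, zero_add] at h1
    rw [thetaSeminorm_sub_eq_zero hp hg' hg h'.symm, add_zero] at h2
    exact h1.trans h2
  exact le_antisymm (key hf hf' hg hg' h h') (key hf' hf hg' hg h.symm h'.symm)

end Topology

/-! ### Lipschitz Carathéodory functions are `Θ`-Carathéodory -/

section LipschitzIsTheta

variable {N : ℕ} {Θ : Moduli} {p : ℝ≥0∞} {V : Type} [NormedAddCommGroup V] [MeasurableSpace V]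

theorem LC_subset_ThetaC : LC p N V ⊆ ThetaC Θ p N V := by
  rintro f ⟨hf, hm, hl⟩
  refine ⟨hf, hm, fun a b j x x' hx hx' hu => ?_⟩
  obtain ⟨l, hl, hlip⟩ := hl (Metric.closedBall 0 j) (isCompact_closedBall _ _)
  have hl2 : eLpNorm l p (volume.restrict (Icc (a : ℝ) b)) ≠ ∞ := (hl a b).eLpNorm_ne_top
  rw [ENNReal.tendsto_nhds_zero]
  intro ε hε
  obtain ⟨δ, hδ, hδε⟩ : ∃ δ : ℝ≥0, 0 < δ ∧
      (δ : ℝ≥0∞) * eLpNorm l p (volume.restrict (Icc (a : ℝ) b)) < ε := by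
    obtain ⟨δ, h0, h⟩ := ENNReal.exists_nnreal_pos_mul_lt hl2 hε.ne'
    exact ⟨δ, h0, h⟩
  have hu' := Metric.tendstoUniformlyOn_iff.1 hu δ (by exact_mod_cast hδ)
  filter_upwards [hu'] with n hn
  refine le_trans ?_ hδε.le
  have := eLpNorm_le_nnreal_smul_eLpNorm_of_ae_le_mul (c := δ) (p := p)
    (μ := volume.restrict (Icc (a : ℝ) b)) (f := fun t => f (t, x n t) - f (t, x' t)) (g := l) ?_
  · simpa [ENNReal.smul_def] using this
  filter_upwards [ae_restrict_of_ae hlip, ae_restrict_mem measurableSet_Icc] with t ht hI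
  have h1 := ht (x n t) (by simpa using (hx n).2.1 t hI) (x' t) (by simpa using hx'.2.1 t hI)
  have h2 : ‖x n t - x' t‖ ≤ δ := by
    have := hn t hI
    rw [dist_comm, dist_eq_norm] at this
    exact this.le
  rw [← NNReal.coe_le_coe]
  push_cast
  calc ‖f (t, x n t) - f (t, x' t)‖ ≤ l t * ‖x n t - x' t‖ := h1
    _ ≤ ‖l t‖ * δ := mul_le_mul (le_abs_self _) h2 (norm_nonneg _) (norm_nonneg _)
    _ = δ * ‖l t‖ := mul_comm _ _

end LipschitzIsTheta

/-! ### Continuity of the translation flow -/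

section TranslationFlow

theorem eLpNorm_comp_add_le {V : Type*} [NormedAddCommGroup V] {p : ℝ≥0∞} (g : ℝ → V)
    {a b a' b' t : ℝ} (ha : a' ≤ a + t) (hb : b + t ≤ b') :
    eLpNorm (fun s => g (s + t)) p (volume.restrict (Icc a b)) ≤
      eLpNorm g p (volume.restrict (Icc a' b')) := by
  have hmp := (measurePreserving_add_right volume t).restrict_preimage
    (measurableSet_Icc (a := a + t) (b := b + t))
  have e : (fun s : ℝ => s + t) ⁻¹' Icc (a + t) (b + t) = Icc a b := by
    ext s; simp
  rw [e] at hmp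
  have hemb : MeasurableEmbedding fun s : ℝ => s + t :=
    (MeasurableEquiv.addRight t).measurableEmbedding
  change eLpNorm (g ∘ fun s => s + t) p _ ≤ _
  rw [← hemb.eLpNorm_map_measure, hmp.map_eq]
  exact eLpNorm_mono_measure _ (Measure.restrict_mono (Icc_subset_Icc ha hb) le_rfl)

theorem tendsto_eLpNorm_translate {V : Type*} [NormedAddCommGroup V] {p : ℝ≥0∞} (hp : 1 ≤ p)
    (hp' : p ≠ ∞) {H : ℝ → V} (hH : MemLp H p volume) {T : ℕ → ℝ} {t : ℝ}
    (hT : Tendsto T atTop (𝓝 t)) :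
    Tendsto (fun n => eLpNorm (fun s => H (s + T n) - H (s + t)) p volume) atTop (𝓝 0) := by
  have : Fact (1 ≤ p) := ⟨hp⟩
  let τ : ℝ → C(ℝ, ℝ) := fun r => ⟨fun s => s + r, by fun_prop⟩
  have hτ : Continuous τ := by
    refine ContinuousMap.continuous_of_continuous_uncurry _ ?_
    change Continuous fun q : ℝ × ℝ => q.2 + q.1
    fun_prop
  have hmp : ∀ r, MeasurePreserving (τ r) volume volume := fun r =>
    measurePreserving_add_right volume r
  have h := Filter.Tendsto.compMeasurePreservingLp (E := V) (p := p)
    (tendsto_const_nhds (x := hH.toLp H) (f := (atTop : Filter ℕ)))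
    ((hτ.tendsto t).comp hT) (fun n => hmp (T n)) (hmp t) hp'
  exact (Lp.tendsto_Lp_iff_tendsto_eLpNorm'' (fun n => H ∘ τ (T n))
    (fun n => hH.comp_measurePreserving (hmp (T n))) (H ∘ τ t)
    (hH.comp_measurePreserving (hmp t))).1 h

variable {N : ℕ} {Θ : Moduli} {p : ℝ≥0∞}

/-- Compactness of `𝒦^I_j` (Arzelà–Ascoli), in sequential form. -/
theorem exists_subseq_tendstoUniformlyOn {a b : ℚ} {j : ℕ} (hab : a ≤ b) {x : ℕ → ℝ → E N}
    (hx : ∀ n, x n ∈ admissible Θ N a b j) :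
    ∃ x' ∈ admissible Θ N a b j, ∃ ψ : ℕ → ℕ, StrictMono ψ ∧
      TendstoUniformlyOn (fun n => x (ψ n)) x' atTop (Icc (a : ℝ) b) := by
  have hab' : (a : ℝ) ≤ b := by exact_mod_cast hab
  let I := Icc (a : ℝ) b
  let A : Set (BoundedContinuousFunction I (E N)) :=
    {u | (∀ s, ‖u s‖ ≤ j) ∧ ∀ s t : I, ‖u s - u t‖ ≤ Θ.θ a b j (nndist (s : ℝ) t)}
  have hclosed : IsClosed A := by
    have : A = (⋂ s, {u | ‖u s‖ ≤ j}) ∩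
        ⋂ s : I, ⋂ t : I, {u : BoundedContinuousFunction I (E N) |
          ‖u s - u t‖ ≤ Θ.θ a b j (nndist (s : ℝ) t)} := by
      ext u; simp [A]
    rw [this]
    have hev : ∀ s : I, Continuous fun u : BoundedContinuousFunction I (E N) => u s := fun s =>
      (BoundedContinuousFunction.evalCLM ℝ s).continuous
    refine (isClosed_iInter fun s => isClosed_le (hev s).norm continuous_const).inter
      (isClosed_iInter fun s => isClosed_iInter fun t =>
        isClosed_le ((hev s).sub (hev t)).norm continuous_const)
  have hcomp : IsCompact A := by
    refine BoundedContinuousFunction.arzela_ascoli₂ (Metric.closedBall 0 j)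
      (isCompact_closedBall _ _) A hclosed (fun u s hu => by simpa using hu.1 s) ?_
    refine fun s => Metric.equicontinuousAt_of_continuity_modulus
      (fun t : I => (Θ.θ a b j (nndist (s : ℝ) t) : ℝ)) ?_ _
      (Eventually.of_forall fun t u => ?_)
    · have hc : Continuous fun t : I => (Θ.θ a b j (nndist (s : ℝ) t) : ℝ) :=
        NNReal.continuous_coe.comp ((Θ.continuous_θ a b j).comp
          (continuous_const.nndist continuous_subtype_val))
      simpa [Θ.θ_zero] using hc.tendsto s
    · rw [dist_eq_norm]
      exact u.2.2 s t
  let u : ℕ → BoundedContinuousFunction I (E N) := fun n =>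
    BoundedContinuousFunction.mkOfCompact ⟨I.domRestrict (x n), (hx n).1.domRestrict⟩
  have hu : ∀ n, u n ∈ A := fun n =>
    ⟨fun s => (hx n).2.1 s s.2, fun s t => (hx n).2.2 s s.2 t t.2⟩
  obtain ⟨v, hv, ψ, hψ, hlim⟩ := hcomp.tendsto_subseq hu
  have hv' : ∀ s (hs : s ∈ I), IccExtend hab' v s = v ⟨s, hs⟩ := fun s hs =>
    IccExtend_of_mem hab' v hs
  refine ⟨IccExtend hab' v, ⟨(v.continuous.Icc_extend' (h := hab')).continuousOn,
    fun t ht => ?_, fun s hs t ht => ?_⟩, ψ, hψ, ?_⟩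
  · rw [hv' t ht]; exact hv.1 _
  · rw [hv' t ht, hv' s hs]; exact hv.2 ⟨s, hs⟩ ⟨t, ht⟩
  · rw [Metric.tendstoUniformlyOn_iff]
    intro ε hε
    filter_upwards [Metric.tendsto_nhds.1 hlim ε hε] with n hn t ht
    rw [hv' t ht, dist_comm]
    exact (BoundedContinuousFunction.dist_coe_le_dist (f := u (ψ n)) (g := v) ⟨t, ht⟩).trans_lt hn

variable {V : Type} [NormedAddCommGroup V] [MeasurableSpace V] [BorelSpace V]
  [SecondCountableTopology V]

theorem thetaSeminorm_shift_le {a b a' b' : ℚ} {j : ℕ} {t : ℝ} (ha : a' ≤ a) (hb : b ≤ b')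
    (ha' : (a' : ℝ) ≤ a + t) (hb' : (b : ℝ) + t ≤ b') (f : ℝ × E N → V) :
    thetaSeminorm Θ p a b j (shift t f) ≤ thetaSeminorm Θ p a' b' j f := by
  rcases lt_or_ge b a with hab | hab
  · simp [thetaSeminorm_eq_zero_of_lt hab]
  refine iSup₂_le fun x hx => ?_
  refine le_trans ?_ (eLpNorm_le_thetaSeminorm (admissible_extend ha hab hb t hx) f)
  refine le_trans (eLpNorm_congr_ae ?_).le (eLpNorm_comp_add_le
    (fun r => f (r, x (max (a : ℝ) (min b (r - t))))) ha' hb')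
  filter_upwards [ae_restrict_mem measurableSet_Icc] with s hs
  simp [shift, min_eq_right hs.2, max_eq_right hs.1]

theorem memLp_indicator_curve {f : ℝ × E N → V} (hf : Measurable f) (hm : HasMBounds p f)
    {x : ℝ → E N} (hx : Continuous x) (a b : ℝ) :
    MemLp ((Icc a b).indicator fun t => f (t, x t)) p volume := by
  rw [memLp_indicator_iff_restrict measurableSet_Icc]
  obtain ⟨m, hm, hle⟩ := hm (x '' Icc a b) (isCompact_Icc.image hx)
  refine (hm a b).mono' (aestronglyMeasurable_comp_curve hf hx.continuousOn) ?_
  filter_upwards [ae_restrict_of_ae hle, ae_restrict_mem measurableSet_Icc] with t ht hI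
  exact ht _ (mem_image_of_mem _ hI)

/-- Along one uniformly convergent sequence of admissible curves, translation is continuous.
With `h r = f (r, x (r - t))`, the difference splits into two terms that tend to `0` by
`Θ`-continuity and into a translation of the `L^p` function `h`. -/
theorem tendsto_eLpNorm_shift_curve (hp : 1 ≤ p) (hp' : p ≠ ∞) {f : ℝ × E N → V}
    (hf : f ∈ ThetaC Θ p N V) {T : ℕ → ℝ} {t : ℝ} (hT : Tendsto T atTop (𝓝 t)) {a b : ℚ} {j : ℕ}
    (hab : a ≤ b) {x : ℕ → ℝ → E N} {x' : ℝ → E N} (hx : ∀ n, x n ∈ admissible Θ N a b j)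
    (hx' : x' ∈ admissible Θ N a b j) (hu : TendstoUniformlyOn x x' atTop (Icc (a : ℝ) b)) :
    Tendsto (fun n => eLpNorm (fun s => f (s + T n, x n s) - f (s + t, x n s)) p
      (volume.restrict (Icc (a : ℝ) b))) atTop (𝓝 0) := by
  have hab' : (a : ℝ) ≤ b := by exact_mod_cast hab
  obtain ⟨a', ha'⟩ := exists_rat_lt (min (a : ℝ) (a + t - 1))
  obtain ⟨b', hb'⟩ := exists_rat_gt (max (b : ℝ) (b + t + 1))
  rw [lt_min_iff] at ha'
  rw [max_lt_iff] at hb'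
  have ha : a' ≤ a := by exact_mod_cast ha'.1.le
  have hb : b ≤ b' := by exact_mod_cast hb'.1.le
  set c : ℝ → ℝ := fun r => max (a : ℝ) (min b r) with hc
  have hcmem : ∀ r, c r ∈ Icc (a : ℝ) b := clamp_mem hab'
  have hx'c : Continuous fun r => x' (c r) := continuous_clamp hab' hx'.1
  -- With `h r = f (r, x' (r - t))`, the integrand is a sum of three differences, each tending to
  -- zero in `L^p`: along the curves `x n (· - T n)`, which converge uniformly to `x' (· - t)`;
  -- between the translates of the fixed function `h` by `T n` and by `t`; and along the curves
  -- `x n`, for the translate of `f` by `t`.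
  have k1 := hf.2.2 a' b' j (fun n r => x n (c (r - T n))) (fun r => x' (c (r - t)))
    (fun n => admissible_extend ha hab hb (T n) (hx n)) (admissible_extend ha hab hb t hx') (by
      rw [Metric.tendstoUniformlyOn_iff]
      intro ε hε
      have hθ : Tendsto (fun n => (Θ.θ a b j (nndist (T n) t) : ℝ)) atTop (𝓝 0) := by
        have h1 : Tendsto (fun n => nndist (T n) t) atTop (𝓝 0) := by
          have := hT.nndist (tendsto_const_nhds (x := t))
          simpa using this
        have h2 := ((Θ.continuous_θ a b j).tendsto 0).comp h1
        rw [Θ.θ_zero] at h2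
        exact_mod_cast (NNReal.continuous_coe.tendsto _).comp h2
      filter_upwards [Metric.tendstoUniformlyOn_iff.1 hu (ε / 2) (half_pos hε),
        hθ.eventually (gt_mem_nhds (half_pos hε))] with n hn hn' r _
      have e1 := hn _ (hcmem (r - T n))
      have e2 : dist (x' (c (r - t))) (x' (c (r - T n))) ≤ Θ.θ a b j (nndist (T n) t) := by
        rw [dist_eq_norm]
        refine (hx'.2.2 _ (hcmem _) _ (hcmem _)).trans
          (NNReal.coe_le_coe.2 (Θ.monotone_θ a b j ?_))
        refine (nndist_max_min_le _ _ _ _).trans (le_of_eq ?_)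
        rw [← NNReal.coe_inj, coe_nndist, coe_nndist, dist_sub_left, dist_comm]
      calc _ ≤ dist (x' (c (r - t))) (x' (c (r - T n))) +
            dist (x' (c (r - T n))) (x n (c (r - T n))) := dist_triangle _ _ _
        _ < ε := by linarith)
  set h : ℝ → V := (Icc (a' : ℝ) b').indicator fun r => f (r, x' (c (r - t))) with hh
  have k2 := tendsto_eLpNorm_translate hp hp' (memLp_indicator_curve hf.1 hf.2.1
    (hx'c.comp (continuous_id.sub continuous_const)) a' b' : MemLp h p volume) hT
  have k3 := (hf.2.2.shift t) a b j x x' hx hx' hu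
  have hsum := (k1.add k2).add k3
  rw [add_zero, add_zero] at hsum
  refine tendsto_of_tendsto_of_tendsto_of_le_of_le' tendsto_const_nhds hsum
    (Eventually.of_forall fun _ => zero_le) ?_
  filter_upwards [Metric.tendsto_nhds.1 hT 1 one_pos] with n hn
  rw [Real.dist_eq, abs_lt] at hn
  set μ := volume.restrict (Icc (a : ℝ) b)
  set A : ℝ → V := fun s => f (s + T n, x n (c s)) - f (s + T n, x' (c (s + T n - t))) with hA
  set B : ℝ → V := fun s => h (s + T n) - h (s + t) with hB
  set C : ℝ → V := fun s => shift t f (s, x n (c s)) - shift t f (s, x' (c s)) with hC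
  have hxnc : Continuous fun r => x n (c r) := continuous_clamp hab' (hx n).1
  have hhm : Measurable h := ((hf.1.comp (measurable_id.prodMk
    (hx'c.comp (continuous_id.sub continuous_const)).measurable))).indicator measurableSet_Icc
  have mA : AEStronglyMeasurable A μ := by
    refine Measurable.aestronglyMeasurable (Measurable.sub ?_ ?_)
    · exact hf.1.comp ((measurable_id.add_const _).prodMk hxnc.measurable)
    · exact hf.1.comp ((measurable_id.add_const _).prodMk
        (hx'c.comp ((continuous_id.add continuous_const).sub continuous_const)).measurable)
  have mB : AEStronglyMeasurable B μ :=
    ((hhm.comp (measurable_id.add_const _)).sub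
      (hhm.comp (measurable_id.add_const _))).aestronglyMeasurable
  have mC : AEStronglyMeasurable C μ := by
    refine Measurable.aestronglyMeasurable (Measurable.sub ?_ ?_)
    · exact (measurable_shift hf.1 t).comp (measurable_id.prodMk hxnc.measurable)
    · exact (measurable_shift hf.1 t).comp (measurable_id.prodMk hx'c.measurable)
  have hae : (fun s => f (s + T n, x n s) - f (s + t, x n s)) =ᵐ[μ] A + B - C := by
    filter_upwards [ae_restrict_mem measurableSet_Icc] with s hs
    have i1 : s + T n ∈ Icc (a' : ℝ) b' :=
      ⟨by linarith [hs.1, ha'.2], by linarith [hs.2, hb'.2]⟩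
    have i2 : s + t ∈ Icc (a' : ℝ) b' :=
      ⟨by linarith [hs.1, ha'.2], by linarith [hs.2, hb'.2]⟩
    have hcs : c s = s := clamp_eq hs
    simp only [hA, hB, hC, hh, Pi.add_apply, Pi.sub_apply, indicator_of_mem i1,
      indicator_of_mem i2, hcs, shift, add_sub_cancel_right]
    abel
  rw [eLpNorm_congr_ae hae]
  refine (eLpNorm_sub_le (mA.add mB) mC hp).trans (add_le_add
    ((eLpNorm_add_le mA mB hp).trans (add_le_add ?_ ?_)) ?_)
  · refine le_trans (eLpNorm_congr_ae ?_).le (eLpNorm_comp_add_le (t := T n)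
      (fun r => f (r, x n (c (r - T n))) - f (r, x' (c (r - t))))
      (by linarith [ha'.2]) (by linarith [hb'.2]))
    filter_upwards with s
    simp [hA]
  · exact eLpNorm_mono_measure _ Measure.restrict_le_self
  · refine (eLpNorm_congr_ae ?_).le
    filter_upwards [ae_restrict_mem measurableSet_Icc] with s hs
    have hcs : c s = s := clamp_eq hs
    simp [hC, hcs]

/-- Continuity of the translation of a single function, uniformly over the compact set `𝒦^I_j`. -/
theorem tendsto_thetaSeminorm_shift (hp : 1 ≤ p) (hp' : p ≠ ∞) {f : ℝ × E N → V}
    (hf : f ∈ ThetaC Θ p N V) {T : ℕ → ℝ} {t : ℝ} (hT : Tendsto T atTop (𝓝 t)) (a b : ℚ) (j : ℕ) :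
    Tendsto (fun n => thetaSeminorm Θ p a b j (shift (T n) f - shift t f)) atTop (𝓝 0) := by
  rcases lt_or_ge b a with hab | hab
  · simp [thetaSeminorm_eq_zero_of_lt hab]
  rw [ENNReal.tendsto_nhds_zero]
  intro ε hε
  by_contra hcon
  obtain ⟨φ, hφ, hφ'⟩ := extraction_of_frequently_atTop (not_eventually.1 hcon)
  have : ∀ n, ∃ x ∈ admissible Θ N a b j, ε < eLpNorm
      (fun s => f (s + T (φ n), x s) - f (s + t, x s)) p (volume.restrict (Icc (a : ℝ) b)) := by
    intro n
    have h := not_le.1 (hφ' n)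
    simp only [thetaSeminorm, lt_iSup_iff] at h
    obtain ⟨x, hx, h⟩ := h
    exact ⟨x, hx, h⟩
  choose x hx hlt using this
  obtain ⟨x', hx', ψ, hψ, hu⟩ := exists_subseq_tendstoUniformlyOn hab hx
  have h := tendsto_eLpNorm_shift_curve hp hp' hf
    (hT.comp (hφ.tendsto_atTop.comp hψ.tendsto_atTop)) hab (fun n => hx (ψ n)) hx' hu
  obtain ⟨n, hn⟩ := (h.eventually (gt_mem_nhds hε)).exists
  exact absurd hn (not_lt.2 (hlt (ψ n)).le)

variable {S : Set (ℝ × E N → V)}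

theorem ThetaSpace.isRep_translate (hS : ∀ f ∈ S, ∀ t, shift t f ∈ S) (t : ℝ)
    {g : ThetaSpace Θ p S} {g' : ℝ × E N → V} (h : g.IsRep g') :
    (ThetaSpace.translate hS t g).IsRep (shift t g') := by
  obtain ⟨hg', rfl⟩ := h
  exact ⟨hS _ hg' t, rfl⟩

theorem ThetaSpace.translate_zero (hS : ∀ f ∈ S, ∀ t, shift t f ∈ S) (g : ThetaSpace Θ p S) :
    ThetaSpace.translate hS 0 g = g := by
  obtain ⟨f, hf, rfl⟩ : ∃ f hf, ThetaSpace.mk Θ p f hf = g := ⟨_, _, g.mk_rep⟩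
  change ThetaSpace.mk Θ p (shift 0 f) _ = _
  refine ThetaSpace.mk_eq_mk.2 (Eventually.of_forall fun q => ?_)
  simp [shift]

theorem ThetaSpace.translate_add (hS : ∀ f ∈ S, ∀ t, shift t f ∈ S) (s t : ℝ)
    (g : ThetaSpace Θ p S) :
    ThetaSpace.translate hS (s + t) g = ThetaSpace.translate hS t (ThetaSpace.translate hS s g) := by
  rw [← g.mk_rep]
  change ThetaSpace.mk Θ p (shift (s + t) g.rep) _ = ThetaSpace.mk Θ p (shift t (shift s g.rep)) _
  refine ThetaSpace.mk_eq_mk.2 (Eventually.of_forall fun q => ?_)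
  simp only [shift]
  rw [add_assoc, add_comm s t]

/-- Translation is a continuous flow on the space of classes. -/
theorem ThetaSpace.continuous_translate (hp : 1 ≤ p) (hp' : p ≠ ∞) (hST : S ⊆ ThetaC Θ p N V)
    (hS : ∀ f ∈ S, ∀ t, shift t f ∈ S) :
    Continuous fun q : ℝ × ThetaSpace Θ p S => ThetaSpace.translate hS q.1 q.2 := by
  have := ThetaSpace.firstCountableTopology (Θ := Θ) hp hST
  refine continuous_iff_seqContinuous.2 fun q q₀ hq => ?_
  have hT : Tendsto (fun n => (q n).1) atTop (𝓝 q₀.1) := (continuous_fst.tendsto _).comp hq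
  have hg : Tendsto (fun n => (q n).2) atTop (𝓝 q₀.2) := (continuous_snd.tendsto _).comp hq
  rw [ThetaSpace.tendsto_nhds_iff hp hST] at hg ⊢
  intro a b j
  obtain ⟨a', ha'⟩ := exists_rat_lt (min (a : ℝ) (a + q₀.1 - 1))
  obtain ⟨b', hb'⟩ := exists_rat_gt (max (b : ℝ) (b + q₀.1 + 1))
  rw [lt_min_iff] at ha'
  rw [max_lt_iff] at hb'
  have ha : a' ≤ a := by exact_mod_cast ha'.1.le
  have hb : b ≤ b' := by exact_mod_cast hb'.1.le
  have h0 := (hg a' b' j).add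
    (tendsto_thetaSeminorm_shift (Θ := Θ) hp hp' (hST q₀.2.rep_mem) hT a b j)
  rw [add_zero] at h0
  refine tendsto_of_tendsto_of_tendsto_of_le_of_le' tendsto_const_nhds h0
    (Eventually.of_forall fun _ => zero_le) ?_
  filter_upwards [Metric.tendsto_nhds.1 hT 1 one_pos] with n hn
  rw [Real.dist_eq, abs_lt] at hn
  have r1 := (ThetaSpace.isRep_translate hS (q n).1 (q n).2.isRep_rep).ae_eq_rep
  have r2 := (ThetaSpace.isRep_translate hS q₀.1 q₀.2.isRep_rep).ae_eq_rep
  have m1 := hST (hS _ (q n).2.rep_mem (q n).1)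
  have m2 := hST (hS _ q₀.2.rep_mem q₀.1)
  have m3 := hST (hS _ q₀.2.rep_mem (q n).1)
  rw [Function.comp_apply, ← thetaSeminorm_congr hp m1
    (hST (ThetaSpace.rep_mem _)) m2 (hST (ThetaSpace.rep_mem _)) r1 r2]
  refine (thetaSeminorm_sub_le hp m1.1 m3.1 m2.1 a b j).trans (add_le_add ?_ le_rfl)
  exact thetaSeminorm_shift_le ha hb (by linarith [ha'.2]) (by linarith [hb'.2])
    ((q n).2.rep - q₀.2.rep)

end TranslationFlow

/-! ### Gronwall's inequality with an integrable coefficient -/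

section Gronwall

theorem absolutelyContinuousOnInterval_lipschitz_comp {h L : ℝ → ℝ} {a b : ℝ} {K : ℝ≥0}
    (hh : LipschitzOnWith K h (L '' uIcc a b)) (hL : AbsolutelyContinuousOnInterval L a b) :
    AbsolutelyContinuousOnInterval (fun t => h (L t)) a b := by
  have h0 : Tendsto (fun E : ℕ × (ℕ → ℝ × ℝ) =>
      (K : ℝ) * ∑ i ∈ Finset.range E.1, dist (L (E.2 i).1) (L (E.2 i).2))
      (AbsolutelyContinuousOnInterval.totalLengthFilter ⊓
        𝓟 (AbsolutelyContinuousOnInterval.disjWithin a b)) (𝓝 0) := by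
    simpa using Tendsto.const_mul (K : ℝ) hL
  refine squeeze_zero' (Eventually.of_forall fun E => Finset.sum_nonneg fun i _ => dist_nonneg)
    ?_ h0
  filter_upwards [mem_inf_of_right (mem_principal_self _)] with E hE
  rw [Finset.mul_sum]
  exact Finset.sum_le_sum fun i hi =>
    hh.dist_le_mul _ (mem_image_of_mem _ (hE.1 i hi).1) _ (mem_image_of_mem _ (hE.1 i hi).2)

variable {l : ℝ → ℝ}

theorem continuous_primitive_of_intervalIntegrable {W : Type*} [NormedAddCommGroup W]
    [NormedSpace ℝ W] {l : ℝ → W} (hl : ∀ a b, IntervalIntegrable l volume a b) :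
    Continuous fun t => ∫ s in (0 : ℝ)..t, l s :=
  intervalIntegral.continuous_primitive hl 0

/-- With `L t = ∫_0^t l`, the fundamental theorem of calculus for the absolutely continuous
function `exp (2 L)`. -/
theorem integral_mul_exp_primitive (hl : ∀ a b, IntervalIntegrable l volume a b) (t : ℝ) :
    ∫ s in (0 : ℝ)..t, l s * Real.exp (2 * ∫ u in (0 : ℝ)..s, l u) =
      (Real.exp (2 * ∫ u in (0 : ℝ)..t, l u) - 1) / 2 := by
  set L : ℝ → ℝ := fun s => ∫ u in (0 : ℝ)..s, l u with hL
  have hLc : Continuous L := continuous_primitive_of_intervalIntegrable hl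
  have hLac : AbsolutelyContinuousOnInterval L 0 t :=
    (hl 0 t).absolutelyContinuousOnInterval_intervalIntegral (by simp)
  obtain ⟨K, hK⟩ : ∃ K, LipschitzOnWith K (fun y : ℝ => Real.exp (2 * y)) (L '' uIcc 0 t) := by
    obtain ⟨R, hR⟩ := (isCompact_uIcc.image hLc).isBounded.subset_closedBall 0
    have h1 : ContDiffOn ℝ 1 (fun y : ℝ => Real.exp (2 * y)) (Metric.closedBall 0 R) := by
      fun_prop
    obtain ⟨K, hK⟩ := h1.exists_lipschitzOnWith (by decide) (convex_closedBall _ _)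
      (isCompact_closedBall _ _)
    exact ⟨K, hK.mono hR⟩
  have hF := (absolutelyContinuousOnInterval_lipschitz_comp hK hLac).integral_deriv_eq_sub
  have hae : ∀ᵐ s, s ∈ uIoc 0 t →
      deriv (fun s => Real.exp (2 * L s)) s = 2 * (l s * Real.exp (2 * L s)) := by
    filter_upwards [(hl 0 t).ae_hasDerivAt_integral] with s hs hs'
    have hd : HasDerivAt L (l s) s := hs (uIoc_subset_uIcc hs') 0 (by simp)
    rw [((hd.const_mul 2).exp).deriv]
    ring
  rw [intervalIntegral.integral_congr_ae hae, intervalIntegral.integral_const_mul] at hF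
  have hL0 : L 0 = 0 := by simp [hL]
  rw [hL0] at hF
  simp only [mul_zero, Real.exp_zero] at hF
  linarith

/-- The weight `exp (2 |∫_0^t l|)` makes the integral operator with kernel `l` a
contraction with constant `1 / 2`, on both sides of `0`. -/
theorem abs_integral_mul_exp_abs_le (hl : ∀ a b, IntervalIntegrable l volume a b)
    (h0 : ∀ t, 0 ≤ l t) (t : ℝ) :
    |∫ s in (0 : ℝ)..t, l s * Real.exp (2 * |∫ u in (0 : ℝ)..s, l u|)| ≤
      Real.exp (2 * |∫ u in (0 : ℝ)..t, l u|) / 2 := by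
  have main : ∀ l : ℝ → ℝ, (∀ a b, IntervalIntegrable l volume a b) → (∀ t, 0 ≤ l t) →
      ∀ t, 0 ≤ t → |∫ s in (0 : ℝ)..t, l s * Real.exp (2 * |∫ u in (0 : ℝ)..s, l u|)| ≤
        Real.exp (2 * |∫ u in (0 : ℝ)..t, l u|) / 2 := by
    intro l hl h0 t ht
    have hpos : ∀ s, 0 ≤ s → 0 ≤ ∫ u in (0 : ℝ)..s, l u := fun s hs =>
      intervalIntegral.integral_nonneg hs fun u _ => h0 u
    have e : ∫ s in (0 : ℝ)..t, l s * Real.exp (2 * |∫ u in (0 : ℝ)..s, l u|) =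
        ∫ s in (0 : ℝ)..t, l s * Real.exp (2 * ∫ u in (0 : ℝ)..s, l u) := by
      refine intervalIntegral.integral_congr fun s hs => ?_
      rw [uIcc_of_le ht] at hs
      simp only [abs_of_nonneg (hpos s hs.1)]
    rw [e, integral_mul_exp_primitive hl, abs_of_nonneg (hpos t ht), abs_of_nonneg]
    · linarith
    · have := Real.one_le_exp (x := 2 * ∫ u in (0 : ℝ)..t, l u)
        (mul_nonneg zero_le_two (hpos t ht))
      linarith
  rcases le_total 0 t with ht | ht
  · exact main l hl h0 t ht
  · have hneg : ∀ s : ℝ, ∫ u in (0 : ℝ)..s, l (-u) = -∫ u in (0 : ℝ)..(-s), l u := by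
      intro s
      rw [intervalIntegral.integral_comp_neg, intervalIntegral.integral_symm]
      simp
    have hl' : ∀ a b, IntervalIntegrable (fun u => l (-u)) volume a b := fun a b => by
      simpa using (hl (-a) (-b)).comp_sub_left 0
    have h := main (fun u => l (-u)) hl' (fun u => h0 _) (-t) (by linarith)
    simp only [hneg, abs_neg, neg_neg] at h
    rw [intervalIntegral.integral_comp_neg
      (fun s => l s * Real.exp (2 * |∫ u in (0 : ℝ)..s, l u|)), intervalIntegral.integral_symm,
      abs_neg] at h
    simpa using h

theorem abs_intervalIntegral_le_of_mem_Icc {a b t : ℝ} (h0 : ∀ s, 0 ≤ l s)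
    (hl : IntegrableOn l (Icc a b)) (ha : a ≤ 0) (hb : 0 ≤ b) (ht : t ∈ Icc a b) :
    |∫ s in (0 : ℝ)..t, l s| ≤ ∫ s in Icc a b, l s := by
  have hsub : uIoc 0 t ⊆ Icc a b :=
    uIoc_subset_uIcc.trans (uIcc_subset_Icc ⟨ha, hb⟩ ht)
  rw [← Real.norm_eq_abs]
  refine (intervalIntegral.norm_integral_le_integral_norm_uIoc).trans ?_
  simp only [Real.norm_eq_abs, abs_of_nonneg (h0 _)]
  exact setIntegral_mono_set hl (Eventually.of_forall h0) hsub.eventuallyLE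

/-- Two-sided Gronwall inequality, with an integrable coefficient. -/
theorem gronwall_le {u : ℝ → ℝ} {a b C : ℝ} (ha : a ≤ 0) (hb : 0 ≤ b) (hC : 0 ≤ C)
    (h0 : ∀ t, 0 ≤ l t) (hl : IntegrableOn l (Icc a b)) (hu : ContinuousOn u (Icc a b))
    (hu0 : ∀ t ∈ Icc a b, 0 ≤ u t)
    (h : ∀ t ∈ Icc a b, u t ≤ C + |∫ s in (0 : ℝ)..t, l s * u s|) :
    ∀ t ∈ Icc a b, u t ≤ 2 * C * Real.exp (2 * ∫ s in Icc a b, l s) := by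
  set k : ℝ → ℝ := (Icc a b).indicator l with hk
  have hk0 : ∀ t, 0 ≤ k t := fun t => indicator_nonneg (fun s _ => h0 s) t
  have hki : Integrable k := (integrable_indicator_iff measurableSet_Icc).2 hl
  have hkI : ∀ a b, IntervalIntegrable k volume a b := fun _ _ => hki.intervalIntegrable
  set L : ℝ → ℝ := fun t => ∫ s in (0 : ℝ)..t, k s with hL
  have hLc : Continuous L := continuous_primitive_of_intervalIntegrable hkI
  have h0mem : (0 : ℝ) ∈ Icc a b := ⟨ha, hb⟩
  have hw : ContinuousOn (fun t => Real.exp (-(2 * |L t|)) * u t) (Icc a b) :=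
    (Continuous.continuousOn (by fun_prop)).mul hu
  obtain ⟨t₀, ht₀, hmax⟩ := isCompact_Icc.exists_isMaxOn ⟨0, h0mem⟩ hw
  set M := Real.exp (-(2 * |L t₀|)) * u t₀ with hM
  have hM0 : 0 ≤ M := mul_nonneg (Real.exp_pos _).le (hu0 _ ht₀)
  have hle : ∀ t ∈ Icc a b, u t ≤ M * Real.exp (2 * |L t|) := by
    intro t ht
    have h1 : Real.exp (-(2 * |L t|)) * u t ≤ M := hmax ht
    have h2 := mul_le_mul_of_nonneg_right h1 (Real.exp_pos (2 * |L t|)).le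
    have h3 : Real.exp (-(2 * |L t|)) * Real.exp (2 * |L t|) = 1 := by
      rw [← Real.exp_add]; simp
    calc u t = Real.exp (-(2 * |L t|)) * Real.exp (2 * |L t|) * u t := by rw [h3, one_mul]
      _ = Real.exp (-(2 * |L t|)) * u t * Real.exp (2 * |L t|) := by ring
      _ ≤ _ := h2
  have hint : ‖∫ s in (0 : ℝ)..t₀, l s * u s‖ ≤
      |∫ s in (0 : ℝ)..t₀, M * (k s * Real.exp (2 * |L s|))| := by
    refine intervalIntegral.norm_integral_le_abs_of_norm_le ?_ ?_
    · filter_upwards [ae_restrict_mem measurableSet_uIoc] with s hs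
      have hs' : s ∈ Icc a b := (uIoc_subset_uIcc.trans (uIcc_subset_Icc h0mem ht₀)) hs
      rw [hk, indicator_of_mem hs', norm_mul, Real.norm_of_nonneg (h0 s),
        Real.norm_of_nonneg (hu0 s hs')]
      calc l s * u s ≤ l s * (M * Real.exp (2 * |L s|)) :=
            mul_le_mul_of_nonneg_left (hle s hs') (h0 s)
        _ = _ := by ring
    · exact ((hkI 0 t₀).mul_continuousOn (by fun_prop)).const_mul M
  rw [intervalIntegral.integral_const_mul, abs_mul, abs_of_nonneg hM0, Real.norm_eq_abs] at hint
  have h5 := abs_integral_mul_exp_abs_le hkI hk0 t₀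
  have h6 : u t₀ ≤ C + M * (Real.exp (2 * |L t₀|) / 2) :=
    (h t₀ ht₀).trans (add_le_add le_rfl (hint.trans (mul_le_mul_of_nonneg_left h5 hM0)))
  have h7 : M ≤ C + M / 2 := by
    have e1 : Real.exp (-(2 * |L t₀|)) * Real.exp (2 * |L t₀|) = 1 := by
      rw [← Real.exp_add]; simp
    have e2 : Real.exp (-(2 * |L t₀|)) ≤ 1 := Real.exp_le_one_iff.2 (by
      have := abs_nonneg (L t₀); linarith)
    calc M ≤ Real.exp (-(2 * |L t₀|)) * (C + M * (Real.exp (2 * |L t₀|) / 2)) :=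
          mul_le_mul_of_nonneg_left h6 (Real.exp_pos _).le
      _ = Real.exp (-(2 * |L t₀|)) * C +
          (Real.exp (-(2 * |L t₀|)) * Real.exp (2 * |L t₀|)) * (M / 2) := by ring
      _ ≤ 1 * C + M / 2 := by
          rw [e1, one_mul]
          exact add_le_add (mul_le_mul_of_nonneg_right e2 hC) le_rfl
      _ = _ := by ring
  have hM2 : M ≤ 2 * C := by linarith
  intro t ht
  have hLt : |L t| ≤ ∫ s in Icc a b, l s := by
    have := abs_intervalIntegral_le_of_mem_Icc hk0 hki.integrableOn ha hb ht
    refine this.trans (le_of_eq (setIntegral_congr_fun measurableSet_Icc fun s hs => ?_))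
    exact indicator_of_mem hs l
  calc u t ≤ M * Real.exp (2 * |L t|) := hle t ht
    _ ≤ 2 * C * Real.exp (2 * ∫ s in Icc a b, l s) :=
        mul_le_mul hM2 (Real.exp_le_exp.2 (by linarith)) (Real.exp_pos _).le (by linarith)

end Gronwall

/-! ### Carathéodory solutions: comparison and global existence -/

section Solutions

variable {W : Type} [NormedAddCommGroup W] [NormedSpace ℝ W]

theorem IsSolutionOn.mono {φ : ℝ × W → W} {w : W} {J J' : Set ℝ} {z : ℝ → W}
    (h : IsSolutionOn φ w J z) (hJ : J' ⊆ J) (hJ' : J'.OrdConnected) (h0 : (0 : ℝ) ∈ J') :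
    IsSolutionOn φ w J' z :=
  ⟨hJ', h0, h.continuousOn.mono hJ, fun t ht => h.intervalIntegrable t (hJ ht),
    fun t ht => h.eq_integral t (hJ ht)⟩

theorem IsSolutionOn.map_zero {φ : ℝ × W → W} {w : W} {J : Set ℝ} {z : ℝ → W}
    (h : IsSolutionOn φ w J z) : z 0 = w := by
  simpa using h.eq_integral 0 h.zero_mem

/-- Whether a curve is a solution depends only on the values of the curve on the interval and,
for almost every time, on the value of the field on the curve. -/
theorem IsSolutionOn.congr {φ φ' : ℝ × W → W} {w : W} {J : Set ℝ} {z z' : ℝ → W}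
    (h : IsSolutionOn φ w J z) (hz : EqOn z' z J)
    (hφ : ∀ t ∈ J, ∀ᵐ s ∂volume.restrict (uIoc 0 t), φ' (s, z s) = φ (s, z s)) :
    IsSolutionOn φ' w J z' := by
  have key : ∀ t ∈ J, ∀ᵐ s ∂volume.restrict (uIoc 0 t), φ (s, z s) = φ' (s, z' s) := by
    intro t ht
    filter_upwards [hφ t ht, ae_restrict_mem measurableSet_uIoc] with s hs hs'
    rw [← hs, hz (h.ordConnected.uIcc_subset h.zero_mem ht (uIoc_subset_uIcc hs'))]
  refine ⟨h.ordConnected, h.zero_mem, h.continuousOn.congr hz, fun t ht => ?_, fun t ht => ?_⟩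
  · exact (h.intervalIntegrable t ht).congr_ae (key t ht)
  · rw [hz ht, h.eq_integral t ht]
    congr 1
    refine intervalIntegral.integral_congr_ae_restrict (key t ht)

theorem IsSolutionOn.sub_eq {φ : ℝ × W → W} {w : W} {J : Set ℝ} {z : ℝ → W} {s t : ℝ}
    (h : IsSolutionOn φ w J z) (hs : s ∈ J) (ht : t ∈ J) :
    z t - z s = ∫ r in s..t, φ (r, z r) := by
  rw [h.eq_integral t ht, h.eq_integral s hs, add_sub_add_left_eq_sub,
    intervalIntegral.integral_interval_sub_left (h.intervalIntegrable t ht)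
      (h.intervalIntegrable s hs)]

/-- Comparison of the solutions of two Cauchy problems. -/
theorem norm_sub_le_of_isSolutionOn {φ₁ φ₂ : ℝ × W → W} {w₁ w₂ : W} {z₁ z₂ : ℝ → W} {a b : ℝ}
    {l e : ℝ → ℝ} (h₁ : IsSolutionOn φ₁ w₁ (Icc a b) z₁) (h₂ : IsSolutionOn φ₂ w₂ (Icc a b) z₂)
    (hl0 : ∀ t, 0 ≤ l t) (hl : IntegrableOn l (Icc a b)) (he0 : ∀ t, 0 ≤ e t)
    (he : IntegrableOn e (Icc a b))
    (hle : ∀ᵐ t ∂volume.restrict (Icc a b),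
      ‖φ₁ (t, z₁ t) - φ₂ (t, z₂ t)‖ ≤ l t * ‖z₁ t - z₂ t‖ + e t) :
    ∀ t ∈ Icc a b, ‖z₁ t - z₂ t‖ ≤
      2 * (‖w₁ - w₂‖ + ∫ s in Icc a b, e s) * Real.exp (2 * ∫ s in Icc a b, l s) := by
  obtain ⟨ha, hb⟩ := h₁.zero_mem
  have hcont : ContinuousOn (fun t => ‖z₁ t - z₂ t‖) (Icc a b) :=
    (h₁.continuousOn.sub h₂.continuousOn).norm
  have heI : 0 ≤ ∫ s in Icc a b, e s := integral_nonneg he0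
  refine gronwall_le ha hb (by positivity) hl0 hl hcont (fun _ _ => norm_nonneg _) fun t ht => ?_
  have hsub : uIcc 0 t ⊆ Icc a b := uIcc_subset_Icc h₁.zero_mem ht
  have hsub' : uIoc 0 t ⊆ Icc a b := uIoc_subset_uIcc.trans hsub
  have i1 := h₁.intervalIntegrable t ht
  have i2 := h₂.intervalIntegrable t ht
  have il : IntervalIntegrable l volume 0 t := intervalIntegrable_iff.2 (hl.mono_set hsub')
  have ie : IntervalIntegrable e volume 0 t := intervalIntegrable_iff.2 (he.mono_set hsub')
  have ilz : IntervalIntegrable (fun s => l s * ‖z₁ s - z₂ s‖) volume 0 t :=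
    il.mul_continuousOn (hcont.mono hsub)
  have e1 : z₁ t - z₂ t = (w₁ - w₂) + ∫ s in (0 : ℝ)..t, (φ₁ (s, z₁ s) - φ₂ (s, z₂ s)) := by
    rw [h₁.eq_integral t ht, h₂.eq_integral t ht, intervalIntegral.integral_sub i1 i2]
    abel
  have e2 : ‖∫ s in (0 : ℝ)..t, (φ₁ (s, z₁ s) - φ₂ (s, z₂ s))‖ ≤
      |∫ s in (0 : ℝ)..t, (l s * ‖z₁ s - z₂ s‖ + e s)| :=
    intervalIntegral.norm_integral_le_abs_of_norm_le
      (ae_restrict_of_ae_restrict_of_subset hsub' hle) (ilz.add ie)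
  rw [intervalIntegral.integral_add ilz ie] at e2
  have e3 := abs_intervalIntegral_le_of_mem_Icc he0 he ha hb ht
  have e4 := abs_add_le (∫ s in (0 : ℝ)..t, l s * ‖z₁ s - z₂ s‖) (∫ s in (0 : ℝ)..t, e s)
  have e5 := norm_add_le (w₁ - w₂) (∫ s in (0 : ℝ)..t, (φ₁ (s, z₁ s) - φ₂ (s, z₂ s)))
  rw [← e1] at e5
  linarith

/-- Global existence when the field is globally Lipschitz with an integrable constant: in the
weighted supremum norm the Picard operator is a contraction. -/
theorem exists_solution_of_lipschitz [CompleteSpace W] {φ : ℝ → W → W} {l : ℝ → ℝ}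
    (hl : Integrable l) (hl0 : ∀ t, 0 ≤ l t)
    (hlip : ∀ᵐ t, ∀ x y, ‖φ t x - φ t y‖ ≤ l t * ‖x - y‖)
    (hint : ∀ u : ℝ → W, Continuous u → Integrable fun t => φ t (u t)) (w : W) :
    ∃ z : ℝ → W, Continuous z ∧ ∀ t, z t = w + ∫ s in (0 : ℝ)..t, φ s (z s) := by
  have hlI : ∀ a b, IntervalIntegrable l volume a b := fun _ _ => hl.intervalIntegrable
  set L : ℝ → ℝ := fun t => ∫ s in (0 : ℝ)..t, l s with hL
  have hLc : Continuous L := continuous_primitive_of_intervalIntegrable hlI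
  set ω : ℝ → ℝ := fun t => Real.exp (2 * |L t|) with hω
  have hωc : Continuous ω := by fun_prop
  have hω1 : ∀ t, 1 ≤ ω t := fun t => Real.one_le_exp (by positivity)
  have hω0 : ∀ t, 0 < ω t := fun t => Real.exp_pos _
  have hωi : ∀ t, (ω t)⁻¹ ≤ 1 := fun t => inv_le_one_of_one_le₀ (hω1 t)
  have hz : ∀ v : BoundedContinuousFunction ℝ W, Continuous fun t => ω t • v t := fun v =>
    hωc.smul v.continuous
  have hi : ∀ (v : BoundedContinuousFunction ℝ W), Integrable fun t => φ t (ω t • v t) :=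
    fun v => hint _ (hz v)
  let P : BoundedContinuousFunction ℝ W → ℝ → W := fun v t =>
    (ω t)⁻¹ • (w + ∫ s in (0 : ℝ)..t, φ s (ω s • v s))
  have hP : ∀ v, Continuous (P v) := fun v =>
    (hωc.inv₀ fun t => (hω0 t).ne').smul (continuous_const.add
      (continuous_primitive_of_intervalIntegrable fun _ _ => (hi v).intervalIntegrable))
  have hPb : ∀ v t, ‖P v t‖ ≤ ‖w‖ + ∫ s, ‖φ s (ω s • v s)‖ := by
    intro v t
    rw [norm_smul, Real.norm_of_nonneg (inv_nonneg.2 (hω0 t).le)]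
    have h1 : ‖∫ s in (0 : ℝ)..t, φ s (ω s • v s)‖ ≤ ∫ s, ‖φ s (ω s • v s)‖ :=
      intervalIntegral.norm_integral_le_integral_norm_uIoc.trans
        (setIntegral_le_integral (hi v).norm (Eventually.of_forall fun _ => norm_nonneg _))
    calc _ ≤ 1 * ‖w + ∫ s in (0 : ℝ)..t, φ s (ω s • v s)‖ :=
          mul_le_mul_of_nonneg_right (hωi t) (norm_nonneg _)
      _ ≤ _ := by rw [one_mul]; exact (norm_add_le _ _).trans (add_le_add le_rfl h1)
  let T : BoundedContinuousFunction ℝ W → BoundedContinuousFunction ℝ W := fun v =>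
    BoundedContinuousFunction.ofNormedAddCommGroup (P v) (hP v) _ (hPb v)
  have hT : ContractingWith (1 / 2 : ℝ≥0) T := by
    refine ⟨by rw [← NNReal.coe_lt_coe]; norm_num, LipschitzWith.of_dist_le_mul fun v v' => ?_⟩
    rw [BoundedContinuousFunction.dist_le (by positivity)]
    intro t
    have e1 : T v t - T v' t =
        (ω t)⁻¹ • ∫ s in (0 : ℝ)..t, (φ s (ω s • v s) - φ s (ω s • v' s)) := by
      change P v t - P v' t = _
      rw [intervalIntegral.integral_sub (hi v).intervalIntegrable (hi v').intervalIntegrable,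
        ← smul_sub, add_sub_add_left_eq_sub]
    have e2 : ‖∫ s in (0 : ℝ)..t, (φ s (ω s • v s) - φ s (ω s • v' s))‖ ≤
        |∫ s in (0 : ℝ)..t, dist v v' * (l s * Real.exp (2 * |L s|))| := by
      refine intervalIntegral.norm_integral_le_abs_of_norm_le ?_
        (((hlI 0 t).mul_continuousOn hωc.continuousOn).const_mul _)
      filter_upwards [ae_restrict_of_ae hlip] with s hs
      refine (hs _ _).trans ?_
      rw [← smul_sub, norm_smul, Real.norm_of_nonneg (hω0 s).le, ← dist_eq_norm]
      calc l s * (ω s * dist (v s) (v' s)) ≤ l s * (ω s * dist v v') :=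
            mul_le_mul_of_nonneg_left (mul_le_mul_of_nonneg_left
              (BoundedContinuousFunction.dist_coe_le_dist s) (hω0 s).le) (hl0 s)
        _ = _ := by ring
    rw [intervalIntegral.integral_const_mul, abs_mul, abs_of_nonneg dist_nonneg] at e2
    have e3 := e2.trans (mul_le_mul_of_nonneg_left (abs_integral_mul_exp_abs_le hlI hl0 t)
      (dist_nonneg (x := v) (y := v')))
    rw [dist_eq_norm, e1, norm_smul, Real.norm_of_nonneg (inv_nonneg.2 (hω0 t).le)]
    calc _ ≤ (ω t)⁻¹ * (dist v v' * (ω t / 2)) :=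
          mul_le_mul_of_nonneg_left e3 (inv_nonneg.2 (hω0 t).le)
      _ = ((ω t)⁻¹ * ω t) * (dist v v' / 2) := by ring
      _ = ((1 / 2 : ℝ≥0) : ℝ) * dist v v' := by
          rw [inv_mul_cancel₀ (hω0 t).ne']
          push_cast
          ring
  obtain ⟨v, hv⟩ : ∃ v, T v = v := ⟨_, hT.fixedPoint_isFixedPt⟩
  refine ⟨fun t => ω t • v t, hz v, fun t => ?_⟩
  have h1 : v t = P v t := by
    conv_lhs => rw [← hv]
    rfl
  change ω t • v t = _
  rw [h1]
  exact smul_inv_smul₀ (hω0 t).ne' _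

theorem exists_isSolutionOn_Icc [CompleteSpace W] {φ : ℝ × W → W} {l : ℝ → ℝ} {a b : ℝ}
    (ha : a ≤ 0) (hb : 0 ≤ b) (hl : IntegrableOn l (Icc a b)) (hl0 : ∀ t, 0 ≤ l t)
    (hlip : ∀ᵐ t ∂volume.restrict (Icc a b), ∀ x y,
      ‖φ (t, x) - φ (t, y)‖ ≤ l t * ‖x - y‖)
    (hint : ∀ u : ℝ → W, Continuous u → IntegrableOn (fun t => φ (t, u t)) (Icc a b)) (w : W) :
    ∃ z : ℝ → W, Continuous z ∧ IsSolutionOn φ w (Icc a b) z := by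
  obtain ⟨z, hz, h⟩ := exists_solution_of_lipschitz
    (φ := fun t x => (Icc a b).indicator (fun t => φ (t, x)) t) (l := (Icc a b).indicator l)
    ((integrable_indicator_iff measurableSet_Icc).2 hl)
    (fun t => indicator_nonneg (fun s _ => hl0 s) t) (by
      filter_upwards [(ae_restrict_iff' measurableSet_Icc).1 hlip] with t ht x y
      by_cases hI : t ∈ Icc a b
      · simpa [hI] using ht hI x y
      · simp [hI]) (fun u hu => by
      have e : (fun t => (Icc a b).indicator (fun t => φ (t, u t)) t) =
          fun t => (Icc a b).indicator (fun s => φ (s, u t)) t := by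
        ext t
        by_cases hI : t ∈ Icc a b <;> simp [hI]
      rw [← e]
      exact (integrable_indicator_iff measurableSet_Icc).2 (hint u hu)) w
  have h0 : (0 : ℝ) ∈ Icc a b := ⟨ha, hb⟩
  refine ⟨z, hz, ordConnected_Icc, h0, hz.continuousOn, fun t ht => ?_, fun t ht => ?_⟩
  · exact intervalIntegrable_iff.2 ((hint z hz).mono_set
      (uIoc_subset_uIcc.trans (uIcc_subset_Icc h0 ht)))
  · rw [h t]
    congr 1
    refine intervalIntegral.integral_congr fun s hs => ?_
    simp [uIcc_subset_Icc h0 ht hs]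

end Solutions

/-! ### Maximal solutions and time translation -/

section Maximal

variable {W : Type} [NormedAddCommGroup W] [NormedSpace ℝ W] {φ : ℝ × W → W} {w : W}

theorem zero_mem_maxInterval (φ : ℝ × W → W) (w : W) : (0 : ℝ) ∈ maxInterval φ w := by
  refine ⟨{0}, fun _ => w, ⟨ordConnected_singleton, mem_singleton _, continuousOn_const,
    fun t ht => ?_, fun t ht => ?_⟩, mem_singleton _⟩
  · rw [mem_singleton_iff.1 ht]
  · rw [mem_singleton_iff.1 ht]; simp

theorem ordConnected_maxInterval (φ : ℝ × W → W) (w : W) : (maxInterval φ w).OrdConnected := by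
  refine ⟨fun s hs t ht r hr => ?_⟩
  obtain ⟨J, z, hz, hs⟩ := hs
  obtain ⟨J', z', hz', ht⟩ := ht
  rcases le_total 0 r with h | h
  · exact ⟨J', z', hz', hz'.ordConnected.out hz'.zero_mem ht ⟨h, hr.2⟩⟩
  · exact ⟨J, z, hz, hz.ordConnected.out hs hz.zero_mem ⟨hr.1, h⟩⟩

/-- If solutions are unique and the union of their intervals is open, they glue to a maximal
solution. -/
theorem isMaximalSolution_of_unique
    (huniq : ∀ J₁ z₁ J₂ z₂, IsSolutionOn φ w J₁ z₁ → IsSolutionOn φ w J₂ z₂ →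
      EqOn z₁ z₂ (J₁ ∩ J₂)) (hopen : IsOpen (maxInterval φ w)) :
    IsMaximalSolution φ w (maxInterval φ w) (maxSolution φ w) := by
  have heq : ∀ J z, IsSolutionOn φ w J z → EqOn (maxSolution φ w) z J := by
    intro J z hz t ht
    have h : ∃ z : ℝ → W, ∃ J : Set ℝ, IsSolutionOn φ w J z ∧ t ∈ J := ⟨z, J, hz, ht⟩
    rw [maxSolution, dif_pos h]
    obtain ⟨J', hJ', ht'⟩ := h.choose_spec
    exact huniq _ _ _ _ hJ' hz ⟨ht', ht⟩
  have hord := ordConnected_maxInterval φ w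
  have h0 := zero_mem_maxInterval φ w
  have hcont : ∀ s ∈ maxInterval φ w, ContinuousOn (maxSolution φ w) (uIcc 0 s) := by
    rintro s ⟨J, z, hz, hs⟩
    have hsub := hz.ordConnected.uIcc_subset hz.zero_mem hs
    exact (hz.continuousOn.mono hsub).congr fun r hr => heq J z hz (hsub hr)
  refine ⟨hopen, ⟨hord, h0, fun r hr => ?_, ?_, ?_⟩, fun J u hu =>
    ⟨fun t ht => ⟨J, u, hu, ht⟩, (heq J u hu).symm⟩⟩
  · obtain ⟨ε, hε, hball⟩ := Metric.isOpen_iff.1 hopen r hr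
    have hs : min 0 (r - ε / 2) ∈ maxInterval φ w := by
      rcases min_choice 0 (r - ε / 2) with h | h <;> rw [h]
      · exact h0
      · exact hball (by simp [abs_of_pos, hε])
    have ht : max 0 (r + ε / 2) ∈ maxInterval φ w := by
      rcases max_choice 0 (r + ε / 2) with h | h <;> rw [h]
      · exact h0
      · exact hball (by simp [abs_of_pos, hε])
    have hc := (hcont _ hs).union_of_isClosed (hcont _ ht) isClosed_Icc isClosed_Icc
    have hnhds : uIcc 0 (min 0 (r - ε / 2)) ∪ uIcc 0 (max 0 (r + ε / 2)) ∈ 𝓝 r := by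
      refine mem_of_superset (Icc_mem_nhds (show r - ε / 2 < r by linarith)
        (show r < r + ε / 2 by linarith)) fun q hq => ?_
      rcases le_total 0 q with h | h
      · exact Or.inr (mem_uIcc.2 (Or.inl ⟨h, hq.2.trans (le_max_right _ _)⟩))
      · exact Or.inl (mem_uIcc.2 (Or.inr ⟨(min_le_right _ _).trans hq.1, h⟩))
    exact (hc.continuousAt hnhds).continuousWithinAt
  · rintro t ⟨J, z, hz, ht⟩
    refine (hz.intervalIntegrable t ht).congr fun s hs => ?_
    rw [heq J z hz (hz.ordConnected.uIcc_subset hz.zero_mem ht (uIoc_subset_uIcc hs))]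
  · rintro t ⟨J, z, hz, ht⟩
    rw [heq J z hz ht, hz.eq_integral t ht]
    congr 1
    refine intervalIntegral.integral_congr fun s hs => ?_
    rw [heq J z hz (hz.ordConnected.uIcc_subset hz.zero_mem ht hs)]

theorem IsSolutionOn.shift {J : Set ℝ} {z : ℝ → W} (h : IsSolutionOn φ w J z) {s : ℝ}
    (hs : s ∈ J) :
    IsSolutionOn (shift s φ) (z s) {t | t + s ∈ J} (fun t => z (t + s)) := by
  refine ⟨⟨fun a ha b hb r hr => h.ordConnected.out ha hb ⟨by linarith [hr.1], by linarith [hr.2]⟩⟩,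
    by simpa using hs, ?_, fun t ht => ?_, fun t ht => ?_⟩
  · exact h.continuousOn.comp (by fun_prop) fun t ht => ht
  · have h1 : IntervalIntegrable (fun r => φ (r, z r)) volume s (t + s) :=
      (h.intervalIntegrable s hs).symm.trans (h.intervalIntegrable (t + s) ht)
    simpa [Caratheodory.shift] using h1.comp_add_right s
  · have h1 := h.sub_eq hs ht
    have h2 := intervalIntegral.integral_comp_add_right (a := 0) (b := t)
      (fun r => φ (r, z r)) s
    simp only [zero_add] at h2
    simp only [Caratheodory.shift]
    rw [h2, ← h1]
    abel

theorem shift_neg_shift {α β : Type} (s : ℝ) (f : ℝ × α → β) : shift (-s) (shift s f) = f := by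
  ext q
  simp [shift]

/-- The cocycle property of maximal solutions. -/
theorem IsMaximalSolution.translate {I I' : Set ℝ} {z z' : ℝ → W} {s : ℝ}
    (h : IsMaximalSolution φ w I z) (hs : s ∈ I)
    (h' : IsMaximalSolution (shift s φ) (z s) I' z') :
    (∀ t, t ∈ I' ↔ s + t ∈ I) ∧ ∀ t, s + t ∈ I → z (s + t) = z' t := by
  obtain ⟨h1, h2⟩ := h'.unique _ _ (h.isSolutionOn.shift hs)
  have hneg : -s ∈ I' := h1 (by simpa using h.isSolutionOn.zero_mem)
  have hz : z' (-s) = w := by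
    have := h2 (show -s ∈ {t | t + s ∈ I} by simpa using h.isSolutionOn.zero_mem)
    rw [← this]
    simpa using h.isSolutionOn.map_zero
  have h3 := h'.isSolutionOn.shift hneg
  rw [shift_neg_shift, hz] at h3
  obtain ⟨h4, -⟩ := h.unique _ _ h3
  refine ⟨fun t => ⟨fun ht => h4 (by simpa using ht), fun ht => h1 (by
    simpa [add_comm] using ht)⟩, fun t ht => ?_⟩
  rw [add_comm] at ht ⊢
  exact h2 ht

theorem IsMaximalSolution.eq {I I' : Set ℝ} {z z' : ℝ → W} (h : IsMaximalSolution φ w I z)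
    (h' : IsMaximalSolution φ w I' z') : I = I' ∧ EqOn z z' I :=
  ⟨(h'.unique _ _ h.isSolutionOn).1.antisymm (h.unique _ _ h'.isSolutionOn).1,
    (h'.unique _ _ h.isSolutionOn).2⟩

end Maximal

/-! ### Bounds and integrability along curves -/

section Bounds

variable {N : ℕ} {p : ℝ≥0∞}

theorem LpLoc.integrableOn (hp : 1 ≤ p) {m : ℝ → ℝ} (hm : LpLoc p m) (a b : ℝ) :
    IntegrableOn m (Icc a b) :=
  (hm a b).integrable hp

variable {V : Type} [NormedAddCommGroup V] [MeasurableSpace V]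

theorem HasLBounds.exists_nonneg (hp : 1 ≤ p) {f : ℝ × E N → V} (hf : HasLBounds p f) (r : ℝ) :
    ∃ l : ℝ → ℝ, (∀ t, 0 ≤ l t) ∧ (∀ a b, IntegrableOn l (Icc a b)) ∧
      ∀ᵐ t : ℝ, ∀ x y : E N, ‖x‖ ≤ r → ‖y‖ ≤ r → ‖f (t, x) - f (t, y)‖ ≤ l t * ‖x - y‖ := by
  obtain ⟨l, hl, h⟩ := hf (Metric.closedBall 0 r) (isCompact_closedBall _ _)
  refine ⟨fun t => |l t|, fun t => abs_nonneg _, fun a b => (hl.integrableOn hp a b).abs, ?_⟩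
  filter_upwards [h] with t ht x y hx hy
  exact (ht x (by simpa using hx) y (by simpa using hy)).trans
    (mul_le_mul_of_nonneg_right (le_abs_self _) (norm_nonneg _))

theorem LC.ae_continuous {f : ℝ × E N → V} (hf : f ∈ LC p N V) :
    ∀ᵐ t : ℝ, Continuous fun x => f (t, x) := by
  have h : ∀ n : ℕ, ∃ l : ℝ → ℝ, ∀ᵐ t : ℝ, ∀ x ∈ Metric.closedBall (0 : E N) n,
      ∀ y ∈ Metric.closedBall (0 : E N) n, ‖f (t, x) - f (t, y)‖ ≤ l t * ‖x - y‖ := fun n => by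
    obtain ⟨l, -, h⟩ := hf.2.2 (Metric.closedBall (0 : E N) n) (isCompact_closedBall _ _)
    exact ⟨l, h⟩
  choose l hl using h
  filter_upwards [ae_all_iff.2 hl] with t ht
  rw [continuous_iff_continuousAt]
  intro x
  obtain ⟨n, hn⟩ := exists_nat_gt ‖x‖
  have hlip : LipschitzOnWith (l n t).toNNReal (fun x => f (t, x)) (Metric.closedBall 0 n) := by
    refine LipschitzOnWith.of_dist_le_mul fun u hu v hv => ?_
    rw [dist_eq_norm, dist_eq_norm]
    exact (ht n u hu v hv).trans
      (mul_le_mul_of_nonneg_right (Real.le_coe_toNNReal _) (norm_nonneg _))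
  exact hlip.continuousOn.continuousAt
    (mem_of_superset (Metric.isOpen_ball.mem_nhds (by simpa using hn)) Metric.ball_subset_closedBall)

/-- Equivalent functions of `𝔏ℭ_p` coincide, for almost every `t`, at every point. -/
theorem LC.ae_forall_eq {f g : ℝ × E N → V} (hf : f ∈ LC p N V) (hg : g ∈ LC p N V)
    (hfg : f =ᵐ[volume] g) : ∀ᵐ t : ℝ, ∀ x, f (t, x) = g (t, x) := by
  rw [Measure.volume_eq_prod] at hfg
  filter_upwards [Measure.ae_ae_of_ae_prod hfg, LC.ae_continuous hf, LC.ae_continuous hg]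
    with t h1 h2 h3 x
  exact congrFun ((h2.ae_eq_iff_eq volume h3).1 h1) x

variable [BorelSpace V] [SecondCountableTopology V]

theorem integrableOn_comp_curve (hp : 1 ≤ p) {f : ℝ × E N → V} (hf : Measurable f)
    (hm : HasMBounds p f) {a b : ℝ} {x : ℝ → E N} (hx : ContinuousOn x (Icc a b)) :
    IntegrableOn (fun t => f (t, x t)) (Icc a b) := by
  obtain ⟨m, hm, hle⟩ := hm (x '' Icc a b) (isCompact_Icc.image_of_continuousOn hx)
  refine (hm.integrableOn hp a b).mono' (aestronglyMeasurable_comp_curve hf hx) ?_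
  filter_upwards [ae_restrict_of_ae hle, ae_restrict_mem measurableSet_Icc] with t ht hI
  exact ht _ (mem_image_of_mem _ hI)

end Bounds

/-! ### Truncation of a field by the retraction onto a ball -/

section Retraction

variable {F : Type*} [NormedAddCommGroup F] [InnerProductSpace ℝ F]

/-- The radial retraction of a Hilbert space onto the closed ball of radius `r` about `0`. -/
def ballRetract (r : ℝ) (x : F) : F := if ‖x‖ ≤ r then x else (r / ‖x‖) • x

theorem ballRetract_of_le {r : ℝ} {x : F} (h : ‖x‖ ≤ r) : ballRetract r x = x := if_pos h

theorem norm_ballRetract_le {r : ℝ} (hr : 0 ≤ r) (x : F) : ‖ballRetract r x‖ ≤ r := by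
  unfold ballRetract
  split_ifs with h
  · exact h
  · have hx : 0 < ‖x‖ := hr.trans_lt (not_le.1 h)
    rw [norm_smul, Real.norm_of_nonneg (by positivity), div_mul_cancel₀ _ hx.ne']

/-- The variational inequality that characterizes the metric projection. -/
theorem inner_sub_ballRetract_le {r : ℝ} (hr : 0 ≤ r) (x : F) {z : F} (hz : ‖z‖ ≤ r) :
    inner ℝ (x - ballRetract r x) (z - ballRetract r x) ≤ 0 := by
  unfold ballRetract
  split_ifs with h
  · simp
  · have hx : 0 < ‖x‖ := hr.trans_lt (not_le.1 h)
    have h1 : x - (r / ‖x‖) • x = (1 - r / ‖x‖) • x := by rw [sub_smul, one_smul]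
    have h2 : 0 ≤ 1 - r / ‖x‖ := by
      rw [sub_nonneg, div_le_one hx]; exact (not_le.1 h).le
    have h3 : inner ℝ x z ≤ ‖x‖ * r :=
      (real_inner_le_norm x z).trans (mul_le_mul_of_nonneg_left hz hx.le)
    have h4 : r / ‖x‖ * (‖x‖ * ‖x‖) = ‖x‖ * r := by field_simp
    rw [h1, inner_sub_right, inner_smul_left, inner_smul_left, inner_smul_right,
      real_inner_self_eq_norm_mul_norm, h4, ← mul_sub]
    exact mul_nonpos_of_nonneg_of_nonpos (by simpa using h2) (by linarith)

theorem norm_ballRetract_sub_le {r : ℝ} (hr : 0 ≤ r) (x y : F) :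
    ‖ballRetract r x - ballRetract r y‖ ≤ ‖x - y‖ := by
  have h1 := inner_sub_ballRetract_le hr x (norm_ballRetract_le hr y)
  have h2 := inner_sub_ballRetract_le hr y (norm_ballRetract_le hr x)
  set a := ballRetract r x
  set b := ballRetract r y
  have h3 : inner ℝ (a - b) (a - b) ≤ inner ℝ (x - y) (a - b) := by
    have e : inner ℝ (x - y) (a - b) - inner ℝ (a - b) (a - b) =
        -(inner ℝ (x - a) (b - a)) - inner ℝ (y - b) (a - b) := by
      rw [← inner_sub_left, ← neg_sub a b, inner_neg_right, neg_neg, ← inner_sub_left]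
      congr 1
      abel
    linarith
  rw [real_inner_self_eq_norm_mul_norm] at h3
  have h4 := h3.trans (real_inner_le_norm (x - y) (a - b))
  rcases (norm_nonneg (a - b)).eq_or_lt with h | h
  · rw [← h]; exact norm_nonneg _
  · exact le_of_mul_le_mul_right h4 h

theorem continuous_ballRetract {r : ℝ} (hr : 0 ≤ r) : Continuous (ballRetract r : F → F) :=
  (LipschitzWith.of_dist_le_mul (K := 1) fun x y => by
    simpa [dist_eq_norm] using norm_ballRetract_sub_le hr x y).continuous

end Retraction

section Truncation

variable {N : ℕ} {p : ℝ≥0∞}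

/-- The field `g(t, π x)`, with `π` the retraction onto the closed ball of radius `r`. -/
def truncField (g : ℝ × E N → E N) (r : ℝ) : ℝ × E N → E N :=
  fun q => g (q.1, ballRetract r q.2)

theorem IsSolutionOn.truncField_of_le {g : ℝ × E N → E N} {w : E N} {J : Set ℝ} {z : ℝ → E N}
    {r : ℝ} (h : IsSolutionOn g w J z) (hr : ∀ t ∈ J, ‖z t‖ ≤ r) :
    IsSolutionOn (truncField g r) w J z := by
  refine h.congr (fun _ _ => rfl) fun t ht => ?_
  filter_upwards [ae_restrict_mem measurableSet_uIoc] with s hs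
  have hs' := h.ordConnected.uIcc_subset h.zero_mem ht (uIoc_subset_uIcc hs)
  simp only [truncField, ballRetract_of_le (hr s hs')]

theorem IsSolutionOn.of_truncField {g : ℝ × E N → E N} {w : E N} {J : Set ℝ} {z : ℝ → E N}
    {r : ℝ} (h : IsSolutionOn (truncField g r) w J z) (hr : ∀ t ∈ J, ‖z t‖ ≤ r) :
    IsSolutionOn g w J z := by
  refine h.congr (fun _ _ => rfl) fun t ht => ?_
  filter_upwards [ae_restrict_mem measurableSet_uIoc] with s hs
  have hs' := h.ordConnected.uIcc_subset h.zero_mem ht (uIoc_subset_uIcc hs)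
  simp only [truncField, ballRetract_of_le (hr s hs')]

theorem exists_truncField_lipschitz (hp : 1 ≤ p) {g : ℝ × E N → E N} (hg : g ∈ LC p N (E N))
    {r : ℝ} (hr : 0 ≤ r) :
    ∃ l : ℝ → ℝ, (∀ t, 0 ≤ l t) ∧ (∀ a b, IntegrableOn l (Icc a b)) ∧
      ∀ᵐ t : ℝ, ∀ x y : E N, ‖truncField g r (t, x) - truncField g r (t, y)‖ ≤ l t * ‖x - y‖ := by
  obtain ⟨l, hl0, hl, h⟩ := hg.2.2.exists_nonneg hp r
  refine ⟨l, hl0, hl, ?_⟩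
  filter_upwards [h] with t ht x y
  exact (ht _ _ (norm_ballRetract_le hr x) (norm_ballRetract_le hr y)).trans
    (mul_le_mul_of_nonneg_left (norm_ballRetract_sub_le hr x y) (hl0 t))

theorem exists_isSolutionOn_truncField (hp : 1 ≤ p) {g : ℝ × E N → E N} (hg : g ∈ LC p N (E N))
    {r : ℝ} (hr : 0 ≤ r) {a b : ℝ} (ha : a ≤ 0) (hb : 0 ≤ b) (w : E N) :
    ∃ z : ℝ → E N, Continuous z ∧ IsSolutionOn (truncField g r) w (Icc a b) z := by
  obtain ⟨l, hl0, hl, h⟩ := exists_truncField_lipschitz hp hg hr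
  exact exists_isSolutionOn_Icc ha hb (hl a b) hl0 (ae_restrict_of_ae h) (fun u hu =>
    integrableOn_comp_curve (x := fun t => ballRetract r (u t)) hp hg.1 hg.2.1
      ((continuous_ballRetract hr).comp hu).continuousOn) w

theorem truncField_unique (hp : 1 ≤ p) {g : ℝ × E N → E N} (hg : g ∈ LC p N (E N)) {r : ℝ}
    (hr : 0 ≤ r) {a b : ℝ} {w : E N} {z₁ z₂ : ℝ → E N}
    (h₁ : IsSolutionOn (truncField g r) w (Icc a b) z₁)
    (h₂ : IsSolutionOn (truncField g r) w (Icc a b) z₂) : EqOn z₁ z₂ (Icc a b) := by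
  obtain ⟨l, hl0, hl, h⟩ := exists_truncField_lipschitz hp hg hr
  intro t ht
  have := norm_sub_le_of_isSolutionOn h₁ h₂ hl0 (hl a b) (e := fun _ => 0) (fun _ => le_rfl)
    integrableOn_zero (ae_restrict_of_ae (h.mono fun t ht => by simpa using ht _ _)) t ht
  simpa [sub_eq_zero] using this

theorem exists_nat_norm_lt {F : Type*} [SeminormedAddCommGroup F] {z : ℝ → F} {a b : ℝ}
    (hz : ContinuousOn z (Icc a b)) : ∃ j : ℕ, ∀ t ∈ Icc a b, ‖z t‖ < j := by
  obtain ⟨C, hC⟩ := isCompact_Icc.exists_bound_of_continuousOn hz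
  obtain ⟨j, hj⟩ := exists_nat_gt C
  exact ⟨j, fun t ht => (hC t ht).trans_lt hj⟩

theorem solution_unique_Icc (hp : 1 ≤ p) {g : ℝ × E N → E N} (hg : g ∈ LC p N (E N)) {a b : ℝ}
    {w : E N} {z₁ z₂ : ℝ → E N} (h₁ : IsSolutionOn g w (Icc a b) z₁)
    (h₂ : IsSolutionOn g w (Icc a b) z₂) : EqOn z₁ z₂ (Icc a b) := by
  obtain ⟨j₁, hj₁⟩ := exists_nat_norm_lt h₁.continuousOn
  obtain ⟨j₂, hj₂⟩ := exists_nat_norm_lt h₂.continuousOn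
  refine truncField_unique (r := max j₁ j₂) hp hg (by positivity) (h₁.truncField_of_le fun t ht => ?_)
    (h₂.truncField_of_le fun t ht => ?_)
  · exact (hj₁ t ht).le.trans (le_max_left _ _)
  · exact (hj₂ t ht).le.trans (le_max_right _ _)

theorem uIcc_zero_isSolutionOn {W : Type} [NormedAddCommGroup W] [NormedSpace ℝ W]
    {φ : ℝ × W → W} {w : W} {J : Set ℝ} {z : ℝ → W} (h : IsSolutionOn φ w J z) {t : ℝ}
    (ht : t ∈ J) : IsSolutionOn φ w (Icc (min 0 t) (max 0 t)) z :=
  h.mono (h.ordConnected.uIcc_subset h.zero_mem ht) ordConnected_Icc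
    ⟨min_le_left _ _, le_max_left _ _⟩

theorem solution_unique (hp : 1 ≤ p) {g : ℝ × E N → E N} (hg : g ∈ LC p N (E N)) {w : E N}
    (J₁ : Set ℝ) (z₁ : ℝ → E N) (J₂ : Set ℝ) (z₂ : ℝ → E N) (h₁ : IsSolutionOn g w J₁ z₁)
    (h₂ : IsSolutionOn g w J₂ z₂) : EqOn z₁ z₂ (J₁ ∩ J₂) := fun _ ht =>
  solution_unique_Icc hp hg (uIcc_zero_isSolutionOn h₁ ht.1) (uIcc_zero_isSolutionOn h₂ ht.2)
    ⟨min_le_right _ _, le_max_right _ _⟩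

/-- The maximal interval is open: a solution on a compact interval is a solution of a truncated
equation, whose global solution stays in the ball for some more time. -/
theorem isOpen_maxInterval (hp : 1 ≤ p) {g : ℝ × E N → E N} (hg : g ∈ LC p N (E N)) (w : E N) :
    IsOpen (maxInterval g w) := by
  rw [isOpen_iff_mem_nhds]
  rintro t ⟨J, z, hz, ht⟩
  have hz' := uIcc_zero_isSolutionOn hz ht
  set c := min 0 t with hc
  set d := max 0 t with hd
  have hc0 : c ≤ 0 := min_le_left _ _
  have hd0 : 0 ≤ d := le_max_left _ _
  obtain ⟨j, hj⟩ := exists_nat_norm_lt hz'.continuousOn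
  -- the solution of the truncated equation extends `z` and stays in the ball a little longer;
  -- there it solves the original equation
  obtain ⟨ζ, hζc, hζ⟩ := exists_isSolutionOn_truncField hp hg (Nat.cast_nonneg j)
    (show c - 1 ≤ 0 by linarith) (show 0 ≤ d + 1 by linarith) w
  have heq : EqOn ζ z (Icc c d) := truncField_unique hp hg (Nat.cast_nonneg j)
    (hζ.mono (Icc_subset_Icc (by linarith) (by linarith)) ordConnected_Icc ⟨hc0, hd0⟩)
    (hz'.truncField_of_le fun t ht => (hj t ht).le)
  have hU : IsOpen {s | ‖ζ s‖ < j} := isOpen_lt hζc.norm continuous_const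
  have hmem : ∀ s ∈ Icc c d, ‖ζ s‖ < j := fun s hs => by rw [heq hs]; exact hj s hs
  obtain ⟨ε₁, hε₁, h₁⟩ := Metric.isOpen_iff.1 hU c (hmem c ⟨le_rfl, hc0.trans hd0⟩)
  obtain ⟨ε₂, hε₂, h₂⟩ := Metric.isOpen_iff.1 hU d (hmem d ⟨hc0.trans hd0, le_rfl⟩)
  set δ := min 1 (min (ε₁ / 2) (ε₂ / 2)) with hδ
  have hδ0 : 0 < δ := by positivity
  have hδ1 : δ ≤ 1 := min_le_left _ _
  have hδ2 : δ ≤ ε₁ / 2 := (min_le_right _ _).trans (min_le_left _ _)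
  have hδ3 : δ ≤ ε₂ / 2 := (min_le_right _ _).trans (min_le_right _ _)
  have hball : ∀ s ∈ Icc (c - δ) (d + δ), ‖ζ s‖ ≤ j := by
    intro s hs
    rcases lt_or_ge s c with h | h
    · refine (h₁ (?_ : s ∈ Metric.ball c ε₁)).le
      rw [Metric.mem_ball, Real.dist_eq, abs_lt]
      constructor <;> linarith [hs.1]
    rcases lt_or_ge d s with h' | h'
    · refine (h₂ (?_ : s ∈ Metric.ball d ε₂)).le
      rw [Metric.mem_ball, Real.dist_eq, abs_lt]
      constructor <;> linarith [hs.2]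
    · exact (hmem s ⟨h, h'⟩).le
  have hsol : IsSolutionOn g w (Icc (c - δ) (d + δ)) ζ :=
    (hζ.mono (Icc_subset_Icc (by linarith) (by linarith)) ordConnected_Icc
      ⟨by linarith, by linarith⟩).of_truncField hball
  have hct : c ≤ t := min_le_right _ _
  have htd : t ≤ d := le_max_right _ _
  exact mem_of_superset (Icc_mem_nhds (show c - δ < t by linarith) (show t < d + δ by linarith))
    fun s hs => ⟨_, ζ, hsol, hs⟩

theorem LC.isMaximalSolution (hp : 1 ≤ p) {g : ℝ × E N → E N} (hg : g ∈ LC p N (E N)) (w : E N) :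
    IsMaximalSolution g w (maxInterval g w) (maxSolution g w) :=
  isMaximalSolution_of_unique (solution_unique hp hg) (isOpen_maxInterval hp hg w)

theorem IsSolutionOn.congr_ae_forall {g g' : ℝ × E N → E N} {w : E N} {J : Set ℝ} {z : ℝ → E N}
    (h : IsSolutionOn g w J z) (hg : ∀ᵐ t : ℝ, ∀ x, g (t, x) = g' (t, x)) :
    IsSolutionOn g' w J z :=
  h.congr (fun _ _ => rfl) fun _ _ => ae_restrict_of_ae (hg.mono fun _ hs => (hs _).symm)

theorem IsMaximalSolution.congr_ae_forall {g g' : ℝ × E N → E N} {w : E N} {I : Set ℝ}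
    {z : ℝ → E N} (h : IsMaximalSolution g w I z) (hg : ∀ᵐ t : ℝ, ∀ x, g (t, x) = g' (t, x)) :
    IsMaximalSolution g' w I z :=
  ⟨h.isOpen, h.isSolutionOn.congr_ae_forall hg, fun J u hu =>
    h.unique J u (hu.congr_ae_forall (hg.mono fun _ ht x => (ht x).symm))⟩

/-- For a class in `𝔏ℭ_p`, the maximal solution does not depend on the representative. -/
theorem isMaximalSolution_of_isRep {Θ : Moduli} (hp : 1 ≤ p) {g : LCSpace Θ p N (E N)}
    {g' : ℝ × E N → E N} (h : g.IsRep g') (x₀ : E N) :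
    IsMaximalSolution g' x₀ (solInterval g x₀) (fun t => solX t g x₀) :=
  (LC.isMaximalSolution hp g.rep_mem x₀).congr_ae_forall
    ((LC.ae_forall_eq h.1 g.rep_mem h.ae_eq_rep).mono fun _ ht x => (ht x).symm)

end Truncation

/-! ### From the seminorms to `L^1` convergence along curves -/

section LOneConvergence

theorem tendsto_lintegral_enorm_of_tendsto_eLpNorm {V : Type*} [NormedAddCommGroup V] {p : ℝ≥0∞}
    (hp : 1 ≤ p) {a b : ℝ} {ι : Type*} {l : Filter ι} {u : ι → ℝ → V}
    (hu : ∀ᶠ n in l, AEStronglyMeasurable (u n) (volume.restrict (Icc a b)))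
    (h : Tendsto (fun n => eLpNorm (u n) p (volume.restrict (Icc a b))) l (𝓝 0)) :
    Tendsto (fun n => ∫⁻ t in Icc a b, ‖u n t‖ₑ) l (𝓝 0) := by
  set C : ℝ≥0∞ := (volume.restrict (Icc a b)) univ ^ (1 / (1 : ℝ≥0∞).toReal - 1 / p.toReal)
  have hC : C ≠ ∞ := by
    refine ENNReal.rpow_ne_top_of_nonneg ?_ (measure_ne_top _ _)
    rw [ENNReal.toReal_one, sub_nonneg, div_one]
    rcases eq_or_ne p ∞ with rfl | hp'
    · simp
    · have : 1 ≤ p.toReal := by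
        rw [← ENNReal.toReal_one]; exact ENNReal.toReal_mono hp' hp
      exact (div_le_one (by linarith)).2 this
  have h0 : Tendsto (fun n => eLpNorm (u n) p (volume.restrict (Icc a b)) * C) l (𝓝 0) := by
    simpa using ENNReal.Tendsto.mul_const h (Or.inr hC)
  refine tendsto_of_tendsto_of_tendsto_of_le_of_le' tendsto_const_nhds h0
    (Eventually.of_forall fun _ => zero_le) ?_
  filter_upwards [hu] with n hn
  rw [← eLpNorm_one_eq_lintegral_enorm]
  exact eLpNorm_le_eLpNorm_mul_rpow_measure_univ hp hn

theorem tendsto_integral_norm_of_tendsto_eLpNorm {V : Type*} [NormedAddCommGroup V] {p : ℝ≥0∞}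
    (hp : 1 ≤ p) {a b : ℝ} {ι : Type*} {l : Filter ι} {u : ι → ℝ → V}
    (hu : ∀ᶠ n in l, AEStronglyMeasurable (u n) (volume.restrict (Icc a b)))
    (h : Tendsto (fun n => eLpNorm (u n) p (volume.restrict (Icc a b))) l (𝓝 0)) :
    Tendsto (fun n => ∫ t in Icc a b, ‖u n t‖) l (𝓝 0) := by
  have h1 := tendsto_lintegral_enorm_of_tendsto_eLpNorm hp hu h
  have h2 := (ENNReal.tendsto_toReal ENNReal.zero_ne_top).comp h1
  rw [ENNReal.toReal_zero] at h2
  refine h2.congr' ?_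
  filter_upwards [hu] with n hn
  exact (integral_norm_eq_lintegral_enorm hn).symm

variable {N : ℕ} {Θ : Moduli} {p : ℝ≥0∞} {V : Type} [NormedAddCommGroup V] [MeasurableSpace V]
  [BorelSpace V] [SecondCountableTopology V]

/-- If `h_n → h` for the topology `𝒯_Θ` and admissible curves `x_n` converge uniformly to `x`,
then `h_n(t, x_n(t)) → h(t, x(t))` in `L^1`. -/
theorem tendsto_integral_norm_along (hp : 1 ≤ p) {h : ℕ → ℝ × E N → V} {h₀ : ℝ × E N → V}
    (hm : ∀ n, Measurable (h n)) (h₀m : h₀ ∈ ThetaC Θ p N V) {a b : ℚ} {j : ℕ}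
    (hconv : Tendsto (fun n => thetaSeminorm Θ p a b j (h n - h₀)) atTop (𝓝 0))
    {x : ℕ → ℝ → E N} {x₀ : ℝ → E N} (hx : ∀ᶠ n in atTop, x n ∈ admissible Θ N a b j)
    (hx₀ : x₀ ∈ admissible Θ N a b j) (hu : TendstoUniformlyOn x x₀ atTop (Icc (a : ℝ) b)) :
    Tendsto (fun n => ∫ t in Icc (a : ℝ) b, ‖h n (t, x n t) - h₀ (t, x₀ t)‖) atTop (𝓝 0) := by
  classical
  refine tendsto_integral_norm_of_tendsto_eLpNorm hp (hx.mono fun n hn =>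
    (aestronglyMeasurable_comp_curve (hm n) hn.1).sub
      (aestronglyMeasurable_comp_curve h₀m.1 hx₀.1)) ?_
  -- Θ-continuity asks for a sequence all of whose members are admissible
  set x' : ℕ → ℝ → E N := fun n => if x n ∈ admissible Θ N a b j then x n else x₀ with hx'
  have hxx' : ∀ᶠ n in atTop, x n = x' n := hx.mono fun n hn => by simp [hx', hn]
  have hx'm : ∀ n, x' n ∈ admissible Θ N a b j := by
    intro n
    simp only [hx']
    split_ifs with hn
    · exact hn
    · exact hx₀
  have hu' : TendstoUniformlyOn x' x₀ atTop (Icc (a : ℝ) b) :=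
    hu.congr (hxx'.mono fun n hn => by rw [hn]; exact fun _ _ => rfl)
  have k := hconv.add (h₀m.2.2 a b j x' x₀ hx'm hx₀ hu')
  rw [add_zero] at k
  refine tendsto_of_tendsto_of_tendsto_of_le_of_le' tendsto_const_nhds k
    (Eventually.of_forall fun _ => zero_le) ?_
  filter_upwards [hxx'] with n hn
  rw [hn]
  have e : (fun t => h n (t, x' n t) - h₀ (t, x₀ t)) =
      (fun t => (h n - h₀) (t, x' n t)) + fun t => h₀ (t, x' n t) - h₀ (t, x₀ t) := by
    ext t; simp
  rw [e]
  exact (eLpNorm_add_le (aestronglyMeasurable_comp_curve ((hm n).sub h₀m.1) (hx'm n).1)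
    ((aestronglyMeasurable_comp_curve h₀m.1 (hx'm n).1).sub
      (aestronglyMeasurable_comp_curve h₀m.1 hx₀.1)) hp).trans
    (add_le_add (eLpNorm_le_thetaSeminorm (hx'm n) _) le_rfl)

end LOneConvergence

/-! ### The `m`-bounds of the functions of the hull -/

section HullBounds

variable {N : ℕ} {p : ℝ≥0∞}

/-- The integrals of the optimal `m`-bounds of `g` are dominated by the moduli `θ_j` of `f`. -/
def MBoundsDominated (f g : ℝ × E N → E N) : Prop :=
  ∀ (j : ℕ) (t : ℝ) (d : ℝ≥0), ∫⁻ u in Icc t (t + d), optMBound g j u ≤ thetaENN f j d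

theorem mboundsDominated_shift (f : ℝ × E N → E N) (T : ℝ) : MBoundsDominated f (shift T f) := by
  intro j t d
  have hmp := (measurePreserving_add_right volume T).restrict_preimage
    (measurableSet_Icc (a := t + T) (b := t + T + d))
  have e : (fun s : ℝ => s + T) ⁻¹' Icc (t + T) (t + T + d) = Icc t (t + d) := by
    ext s
    simp only [mem_preimage, mem_Icc]
    constructor <;> rintro ⟨h, h'⟩ <;> constructor <;> linarith
  rw [e] at hmp
  have hemb : MeasurableEmbedding fun s : ℝ => s + T :=
    (MeasurableEquiv.addRight T).measurableEmbedding
  have h3 := hmp.lintegral_comp_emb hemb (optMBound f j)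
  exact h3.le.trans (le_iSup (fun t : ℝ => ∫⁻ u in Icc t (t + d), optMBound f j u) (t + T))

theorem const_mem_admissible {Θ : Moduli} {a b : ℚ} {j : ℕ} {x : E N} (hx : ‖x‖ ≤ j) :
    (fun _ => x) ∈ admissible Θ N a b j :=
  ⟨continuousOn_const, fun _ _ => hx, fun _ _ _ _ => by simp⟩

/-- Domination of the `m`-bounds passes to the limit for `𝒯_Θ`.  For finitely many points of the
ball, the integral of the maximum of `|g_n|` converges, since `g_n(·, x) → g(·, x)` in `L^1` for
each constant `x`; a countable dense set of the ball is then exhausted by monotone convergence. -/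
theorem MBoundsDominated.of_tendsto {Θ : Moduli} (hp : 1 ≤ p) {f : ℝ × E N → E N}
    {g : ℕ → ℝ × E N → E N} {g₀ : ℝ × E N → E N} (hg : ∀ n, Measurable (g n))
    (hdom : ∀ n, MBoundsDominated f (g n)) (hg₀ : g₀ ∈ LC p N (E N))
    (hconv : ∀ a b j, Tendsto (fun n => thetaSeminorm Θ p a b j (g n - g₀)) atTop (𝓝 0)) :
    MBoundsDominated f g₀ := by
  intro j t d
  obtain ⟨a, ha⟩ := exists_rat_lt t
  obtain ⟨b, hb⟩ := exists_rat_gt (t + d)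
  have hne : Nonempty (Metric.closedBall (0 : E N) j) := ⟨⟨0, by simp⟩⟩
  set y : ℕ → Metric.closedBall (0 : E N) j := TopologicalSpace.denseSeq _ with hy
  have hyn : ∀ i, ‖(y i : E N)‖ ≤ j := fun i => mem_closedBall_zero_iff.1 (y i).2
  have hsup : ∀ᵐ u : ℝ, optMBound g₀ j u ≤ ⨆ k : ℕ, ⨆ i ∈ Finset.range k, ‖g₀ (u, y i)‖ₑ := by
    filter_upwards [LC.ae_continuous hg₀] with u hu
    refine iSup₂_le fun x hx => ?_
    have key : ∀ z : Metric.closedBall (0 : E N) j,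
        ‖g₀ (u, z)‖ₑ ≤ ⨆ k : ℕ, ⨆ i ∈ Finset.range k, ‖g₀ (u, y i)‖ₑ := by
      intro z
      refine (TopologicalSpace.denseRange_denseSeq (Metric.closedBall (0 : E N) j)).induction_on
        (p := fun z => ‖g₀ (u, (z : E N))‖ₑ ≤ ⨆ k : ℕ, ⨆ i ∈ Finset.range k, ‖g₀ (u, y i)‖ₑ) z
        (isClosed_le (hu.comp continuous_subtype_val).enorm continuous_const) fun i => ?_
      exact le_iSup_of_le (i + 1) (le_iSup₂_of_le i (Finset.self_mem_range_succ i) le_rfl)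
    exact key ⟨x, hx⟩
  have hmeas : ∀ i, Measurable fun u => ‖g₀ (u, (y i : E N))‖ₑ := fun i =>
    (hg₀.1.comp (measurable_id.prodMk measurable_const)).enorm
  calc ∫⁻ u in Icc t (t + d), optMBound g₀ j u
      ≤ ∫⁻ u in Icc t (t + d), ⨆ k : ℕ, ⨆ i ∈ Finset.range k, ‖g₀ (u, y i)‖ₑ :=
        lintegral_mono_ae (ae_restrict_of_ae hsup)
    _ = ⨆ k : ℕ, ∫⁻ u in Icc t (t + d), ⨆ i ∈ Finset.range k, ‖g₀ (u, y i)‖ₑ := by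
        refine lintegral_iSup (fun k => ?_) fun k k' hk u => ?_
        · exact Measurable.biSup (Finset.range k : Set ℕ) (Finset.countable_toSet _) fun i _ => hmeas i
        · exact biSup_mono fun i hi => Finset.range_mono hk hi
    _ ≤ thetaENN f j d := by
        refine iSup_le fun k => ?_
        have hL1 : ∀ i, Tendsto (fun n => ∫⁻ u in Icc t (t + d),
            ‖g₀ (u, y i) - g n (u, y i)‖ₑ) atTop (𝓝 0) := by
          intro i
          refine tendsto_lintegral_enorm_of_tendsto_eLpNorm (p := p) hp (Eventually.of_forall fun n =>
            (aestronglyMeasurable_comp_curve hg₀.1 continuousOn_const).sub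
            (aestronglyMeasurable_comp_curve (hg n) continuousOn_const)) ?_
          refine tendsto_of_tendsto_of_tendsto_of_le_of_le tendsto_const_nhds (hconv a b j)
            (fun _ => zero_le) fun n => ?_
          refine (eLpNorm_mono_measure _ (Measure.restrict_mono
            (Icc_subset_Icc ha.le hb.le) le_rfl)).trans ?_
          rw [thetaSeminorm_sub_comm]
          exact eLpNorm_le_thetaSeminorm (const_mem_admissible (hyn i)) (g₀ - g n)
        have hsum : Tendsto (fun n => thetaENN f j d + ∑ i ∈ Finset.range k,
            ∫⁻ u in Icc t (t + d), ‖g₀ (u, y i) - g n (u, y i)‖ₑ) atTop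
            (𝓝 (thetaENN f j d + ∑ i ∈ Finset.range k, 0)) :=
          tendsto_const_nhds.add (tendsto_finsetSum _ fun i _ => hL1 i)
        rw [Finset.sum_const_zero, add_zero] at hsum
        refine ge_of_tendsto' hsum fun n => ?_
        have hdiff : ∀ i, Measurable fun u => ‖g₀ (u, (y i : E N)) - g n (u, y i)‖ₑ := fun i =>
          ((hg₀.1.comp (measurable_id.prodMk measurable_const)).sub
            ((hg n).comp (measurable_id.prodMk measurable_const))).enorm
        calc ∫⁻ u in Icc t (t + d), ⨆ i ∈ Finset.range k, ‖g₀ (u, y i)‖ₑ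
            ≤ ∫⁻ u in Icc t (t + d), (optMBound (g n) j u +
                ∑ i ∈ Finset.range k, ‖g₀ (u, y i) - g n (u, y i)‖ₑ) := by
              refine lintegral_mono fun u => iSup₂_le fun i hi => ?_
              calc ‖g₀ (u, y i)‖ₑ = ‖g n (u, y i) + (g₀ (u, y i) - g n (u, y i))‖ₑ := by
                    rw [add_sub_cancel]
                _ ≤ ‖g n (u, y i)‖ₑ + ‖g₀ (u, y i) - g n (u, y i)‖ₑ := enorm_add_le _ _
                _ ≤ _ := add_le_add
                    (le_iSup₂ (f := fun (x : E N) (_ : x ∈ Metric.closedBall (0 : E N) j) =>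
                      ‖g n (u, x)‖ₑ) (y i : E N) (y i).2)
                    (Finset.single_le_sum (f := fun i => ‖g₀ (u, (y i : E N)) - g n (u, y i)‖ₑ)
                      (fun _ _ => zero_le) hi)
          _ = (∫⁻ u in Icc t (t + d), optMBound (g n) j u) +
                ∑ i ∈ Finset.range k, ∫⁻ u in Icc t (t + d), ‖g₀ (u, y i) - g n (u, y i)‖ₑ := by
              rw [lintegral_add_right _ (Finset.measurable_fun_sum _ fun i _ => hdiff i),
                lintegral_finsetSum _ fun i _ => hdiff i]
          _ ≤ _ := add_le_add (hdom n j t d) le_rfl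

/-- The functions of the hull have `m`-bounds dominated by those of `f`. -/
theorem mboundsDominated_of_mem_hullLC (hp : 1 ≤ p) {f : ℝ × E N → E N} {hf : f ∈ LC p N (E N)}
    {hm : HasL1LocEquicontinuousMBounds f} {g : LCSpace (moduliOf f hm) p N (E N)}
    (hg : g ∈ hullLC p f hf hm) : MBoundsDominated f g.rep := by
  have := ThetaSpace.firstCountableTopology (Θ := moduliOf f hm) hp
    (LC_subset_ThetaC (p := p) (N := N) (V := E N))
  obtain ⟨u, hu, hlim⟩ := mem_closure_iff_seq_limit.1 hg
  choose T hT using hu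
  refine MBoundsDominated.of_tendsto (Θ := moduliOf f hm) (g := fun n => shift (T n) f) hp
    (fun n => measurable_shift hf.1 _) (fun n => mboundsDominated_shift f _) g.rep_mem
    fun a b j => ?_
  refine ((ThetaSpace.tendsto_nhds_iff hp LC_subset_ThetaC).1 hlim a b j).congr fun n => ?_
  have hrep : (u n).IsRep (shift (T n) f) := ⟨shift_mem_LC hf _, hT n⟩
  exact thetaSeminorm_congr hp (LC_subset_ThetaC (u n).rep_mem)
    (LC_subset_ThetaC (shift_mem_LC hf _)) (LC_subset_ThetaC g.rep_mem)
    (LC_subset_ThetaC g.rep_mem) hrep.ae_eq_rep.symm EventuallyEq.rfl a b j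

end HullBounds

/-! ### Solutions are admissible curves and depend continuously on the field -/

section Dependence

variable {N : ℕ} {p : ℝ≥0∞} {f : ℝ × E N → E N} {hm : HasL1LocEquicontinuousMBounds f}

/-- The retraction onto `B_j` of a solution of the equation truncated at `B_j` is admissible. -/
theorem ballRetract_mem_admissible {g : ℝ × E N → E N}
    (hdom : MBoundsDominated f g) {a b : ℚ} {j : ℕ} {w : E N} {z : ℝ → E N}
    (hz : IsSolutionOn (truncField g j) w (Icc (a : ℝ) b) z) :
    (fun t => ballRetract j (z t)) ∈ admissible (moduliOf f hm) N a b j := by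
  have hj : (0 : ℝ) ≤ j := Nat.cast_nonneg j
  have key : ∀ s ∈ Icc (a : ℝ) b, ∀ t ∈ Icc (a : ℝ) b, s ≤ t →
      ‖z t - z s‖ ≤ (moduliOf f hm).θ a b j (nndist s t) := by
    intro s hs t ht hst
    have h1 : ‖z t - z s‖ₑ ≤ thetaENN f j (nndist s t) := by
      rw [hz.sub_eq hs ht, intervalIntegral.integral_of_le hst, ← integral_Icc_eq_integral_Ioc]
      refine (enorm_integral_le_lintegral_enorm _).trans ?_
      have ht' : t = s + (nndist s t : ℝ) := by
        rw [coe_nndist, Real.dist_eq, abs_sub_comm, abs_of_nonneg (by linarith)]; ring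
      have h2 := hdom j s (nndist s t)
      rw [← ht'] at h2
      refine le_trans (lintegral_mono fun u => ?_) h2
      exact le_iSup₂ (f := fun (x : E N) (_ : x ∈ Metric.closedBall (0 : E N) j) =>
        ‖g (u, x)‖ₑ) (ballRetract j (z u)) (by simpa using norm_ballRetract_le hj (z u))
    have h3 := ENNReal.toReal_mono (thetaENN_ne_top hm j _) h1
    rwa [toReal_enorm] at h3
  refine ⟨(continuous_ballRetract hj).comp_continuousOn hz.continuousOn,
    fun t _ => norm_ballRetract_le hj _, fun s hs t ht => ?_⟩
  refine (norm_ballRetract_sub_le hj _ _).trans ?_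
  rcases le_total s t with h | h
  · rw [norm_sub_rev]; exact key s hs t ht h
  · rw [nndist_comm]; exact key t ht s hs h

theorem IsSolutionOn.mem_admissible {g : ℝ × E N → E N}
    (hdom : MBoundsDominated f g) {a b : ℚ} {j : ℕ} {w : E N} {z : ℝ → E N}
    (hz : IsSolutionOn g w (Icc (a : ℝ) b) z) (hj : ∀ t ∈ Icc (a : ℝ) b, ‖z t‖ ≤ j) :
    z ∈ admissible (moduliOf f hm) N a b j :=
  admissible_congr (fun t ht => ballRetract_of_le (hj t ht))
    (ballRetract_mem_admissible hdom (hz.truncField_of_le hj))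

/-- Continuous dependence.  The solutions `ζ_n` of the truncated equations are global and their
retractions are admissible, so that `∫ |(g_n - g)(t, π ζ_n(t))| dt → 0`; Gronwall's inequality, with
the `l`-bound of `g` only, gives uniform convergence, and then the truncation is not felt. -/
theorem tendstoUniformlyOn_maxSolution (hp : 1 ≤ p) {g : ℕ → ℝ × E N → E N}
    {g₀ : ℝ × E N → E N} (hg : ∀ n, g n ∈ LC p N (E N)) (hdom : ∀ n, MBoundsDominated f (g n))
    (hg₀ : g₀ ∈ LC p N (E N)) (hdom₀ : MBoundsDominated f g₀)
    (hconv : ∀ a b j,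
      Tendsto (fun n => thetaSeminorm (moduliOf f hm) p a b j (g n - g₀)) atTop (𝓝 0))
    {x : ℕ → E N} {x₀ : E N} (hx : Tendsto x atTop (𝓝 x₀)) {a b : ℚ} (ha : (a : ℝ) ≤ 0)
    (hb : (0 : ℝ) ≤ b) (hI : Icc (a : ℝ) b ⊆ maxInterval g₀ x₀) :
    ∃ j : ℕ, maxSolution g₀ x₀ ∈ admissible (moduliOf f hm) N a b j ∧
      (∀ᶠ n in atTop, Icc (a : ℝ) b ⊆ maxInterval (g n) (x n) ∧
        maxSolution (g n) (x n) ∈ admissible (moduliOf f hm) N a b j) ∧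
      TendstoUniformlyOn (fun n => maxSolution (g n) (x n)) (maxSolution g₀ x₀) atTop
        (Icc (a : ℝ) b) := by
  have hz₀ : IsSolutionOn g₀ x₀ (Icc (a : ℝ) b) (maxSolution g₀ x₀) :=
    (LC.isMaximalSolution hp hg₀ x₀).isSolutionOn.mono hI ordConnected_Icc ⟨ha, hb⟩
  set z₀ := maxSolution g₀ x₀ with hz₀def
  obtain ⟨i, hi⟩ := exists_nat_norm_lt hz₀.continuousOn
  -- the limit stays in `B_i`, so curves uniformly within distance one of it stay in `B_{i+1}`
  set j := i + 1 with hj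
  have hj0 : (0 : ℝ) ≤ j := Nat.cast_nonneg j
  have hij : (j : ℝ) = i + 1 := by rw [hj]; push_cast; rfl
  have hbd₀ : ∀ t ∈ Icc (a : ℝ) b, ‖z₀ t‖ ≤ j := fun t ht => by
    have := hi t ht
    linarith
  have htr₀ := hz₀.truncField_of_le hbd₀
  choose ζ hζc hζ using fun n =>
    exists_isSolutionOn_truncField hp (hg n) hj0 ha hb (x n)
  obtain ⟨l, hl0, hl, hlip⟩ := exists_truncField_lipschitz hp hg₀ hj0
  -- only the Lipschitz bound of `g₀` enters: the difference of the fields is evaluated along the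
  -- retracted curve of `g n`, which is admissible
  set e : ℕ → ℝ → ℝ := fun n t =>
    ‖g n (t, ballRetract j (ζ n t)) - g₀ (t, ballRetract j (ζ n t))‖ with he
  have hπc : ∀ n, ContinuousOn (fun t => ballRetract (j : ℝ) (ζ n t)) (Icc (a : ℝ) b) := fun n =>
    ((continuous_ballRetract hj0).comp (hζc n)).continuousOn
  have hei : ∀ n, IntegrableOn (e n) (Icc (a : ℝ) b) := fun n =>
    ((integrableOn_comp_curve hp (hg n).1 (hg n).2.1 (hπc n)).sub
      (integrableOn_comp_curve hp hg₀.1 hg₀.2.1 (hπc n))).norm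
  have hadm : ∀ n, (fun t => ballRetract (j : ℝ) (ζ n t)) ∈ admissible (moduliOf f hm) N a b j :=
    fun n => ballRetract_mem_admissible (hdom n) (hζ n)
  have hetend : Tendsto (fun n => ∫ t in Icc (a : ℝ) b, e n t) atTop (𝓝 0) := by
    refine tendsto_integral_norm_of_tendsto_eLpNorm hp (Eventually.of_forall fun n =>
      (aestronglyMeasurable_comp_curve (hg n).1 (hπc n)).sub
        (aestronglyMeasurable_comp_curve hg₀.1 (hπc n))) ?_
    exact tendsto_of_tendsto_of_tendsto_of_le_of_le tendsto_const_nhds (hconv a b j)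
      (fun _ => zero_le) fun n => eLpNorm_le_thetaSeminorm (hadm n) (g n - g₀)
  have hbound : ∀ n, ∀ t ∈ Icc (a : ℝ) b, ‖ζ n t - z₀ t‖ ≤
      2 * (‖x n - x₀‖ + ∫ s in Icc (a : ℝ) b, e n s) *
        Real.exp (2 * ∫ s in Icc (a : ℝ) b, l s) := by
    intro n
    refine norm_sub_le_of_isSolutionOn (hζ n) htr₀ hl0 (hl a b) (fun t => norm_nonneg _) (hei n) ?_
    filter_upwards [ae_restrict_of_ae hlip] with t ht
    have h1 := ht (ζ n t) (z₀ t)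
    have h2 := norm_add_le (truncField g₀ j (t, ζ n t) - truncField g₀ j (t, z₀ t))
      (truncField (g n) j (t, ζ n t) - truncField g₀ j (t, ζ n t))
    rw [sub_add_sub_comm, add_comm (truncField g₀ j (t, ζ n t)), add_sub_add_right_eq_sub] at h2
    refine h2.trans (add_le_add h1 le_rfl)
  have hBtend : Tendsto (fun n => 2 * (‖x n - x₀‖ + ∫ s in Icc (a : ℝ) b, e n s) *
      Real.exp (2 * ∫ s in Icc (a : ℝ) b, l s)) atTop (𝓝 0) := by
    have h1 := tendsto_iff_norm_sub_tendsto_zero.1 hx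
    simpa using (((h1.add hetend).const_mul 2).mul_const
      (Real.exp (2 * ∫ s in Icc (a : ℝ) b, l s)))
  have hunif : TendstoUniformlyOn ζ z₀ atTop (Icc (a : ℝ) b) := by
    rw [Metric.tendstoUniformlyOn_iff]
    intro ε hε
    filter_upwards [hBtend.eventually (gt_mem_nhds hε)] with n hn t ht
    rw [dist_comm, dist_eq_norm]
    exact (hbound n t ht).trans_lt hn
  have hev : ∀ᶠ n in atTop, Icc (a : ℝ) b ⊆ maxInterval (g n) (x n) ∧
      EqOn (ζ n) (maxSolution (g n) (x n)) (Icc (a : ℝ) b) ∧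
      ∀ t ∈ Icc (a : ℝ) b, ‖ζ n t‖ ≤ j := by
    filter_upwards [Metric.tendstoUniformlyOn_iff.1 hunif 1 one_pos] with n hn
    have hle : ∀ t ∈ Icc (a : ℝ) b, ‖ζ n t‖ ≤ j := by
      intro t ht
      have h1 := hn t ht
      rw [dist_comm, dist_eq_norm] at h1
      have h2 := norm_sub_norm_le (ζ n t) (z₀ t)
      have h3 := hi t ht
      linarith
    obtain ⟨h1, h2⟩ := (LC.isMaximalSolution hp (hg n) (x n)).unique _ _
      ((hζ n).of_truncField hle)
    exact ⟨h1, h2, hle⟩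
  refine ⟨j, hz₀.mem_admissible hdom₀ hbd₀, ?_, ?_⟩
  · filter_upwards [hev] with n hn
    refine ⟨hn.1, admissible_congr hn.2.1 ?_⟩
    exact ((hζ n).of_truncField hn.2.2).mem_admissible (hdom n) hn.2.2
  · exact hunif.congr (hev.mono fun n hn => hn.2.1)

end Dependence

/-! ### The triangular system -/

section Triangular

/-- The affine field `y ↦ G(t, x(t)) y + k(t, x(t))` along the curve `x`. -/
def linField {W : Type} [NormedAddCommGroup W] [NormedSpace ℝ W] (G : ℝ × W → W →L[ℝ] W)
    (k : ℝ × W → W) (x : ℝ → W) : ℝ × W → W :=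
  fun q => G (q.1, x q.1) q.2 + k (q.1, x q.1)

theorem isSolutionOn_triangular_iff {W : Type} [NormedAddCommGroup W] [NormedSpace ℝ W]
    [CompleteSpace W] {g : ℝ × W → W} {G : ℝ × W → W →L[ℝ] W} {k : ℝ × W → W} {w : W × W}
    {J : Set ℝ} {z : ℝ → W × W} :
    IsSolutionOn (triangular g G k) w J z ↔
      IsSolutionOn g w.1 J (fun t => (z t).1) ∧
        IsSolutionOn (linField G k fun t => (z t).1) w.2 J (fun t => (z t).2) := by
  have hfst : ∀ {F : ℝ → W × W} {t : ℝ}, IntervalIntegrable F volume 0 t →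
      (∫ s in (0 : ℝ)..t, F s).1 = ∫ s in (0 : ℝ)..t, (F s).1 := fun hF =>
    ((ContinuousLinearMap.fst ℝ W W).intervalIntegral_comp_comm hF).symm
  have hsnd : ∀ {F : ℝ → W × W} {t : ℝ}, IntervalIntegrable F volume 0 t →
      (∫ s in (0 : ℝ)..t, F s).2 = ∫ s in (0 : ℝ)..t, (F s).2 := fun hF =>
    ((ContinuousLinearMap.snd ℝ W W).intervalIntegral_comp_comm hF).symm
  constructor
  · intro h
    refine ⟨⟨h.ordConnected, h.zero_mem, continuous_fst.comp_continuousOn h.continuousOn,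
      fun t ht => ?_, fun t ht => ?_⟩, ⟨h.ordConnected, h.zero_mem,
      continuous_snd.comp_continuousOn h.continuousOn, fun t ht => ?_, fun t ht => ?_⟩⟩
    · exact intervalIntegrable_iff.2 (intervalIntegrable_iff.1 (h.intervalIntegrable t ht)).fst
    · have := congrArg Prod.fst (h.eq_integral t ht)
      rwa [Prod.fst_add, hfst (h.intervalIntegrable t ht)] at this
    · exact intervalIntegrable_iff.2 (intervalIntegrable_iff.1 (h.intervalIntegrable t ht)).snd
    · have := congrArg Prod.snd (h.eq_integral t ht)
      rwa [Prod.snd_add, hsnd (h.intervalIntegrable t ht)] at this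
  · rintro ⟨h1, h2⟩
    have hi : ∀ t ∈ J, IntervalIntegrable (fun s => triangular g G k (s, z s)) volume 0 t :=
      fun t ht => intervalIntegrable_iff.2 ((intervalIntegrable_iff.1
        (h1.intervalIntegrable t ht)).prodMk (intervalIntegrable_iff.1 (h2.intervalIntegrable t ht)))
    refine ⟨h1.ordConnected, h1.zero_mem, h1.continuousOn.prodMk h2.continuousOn, hi,
      fun t ht => Prod.ext ?_ ?_⟩
    · rw [Prod.fst_add, hfst (hi t ht)]
      exact h1.eq_integral t ht
    · rw [Prod.snd_add, hsnd (hi t ht)]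
      exact h2.eq_integral t ht

variable {N : ℕ} {p : ℝ≥0∞}

theorem linField_lipschitz (G : ℝ × E N → E N →L[ℝ] E N) (k : ℝ × E N → E N) (x : ℝ → E N)
    (t : ℝ) (y y' : E N) :
    ‖linField G k x (t, y) - linField G k x (t, y')‖ ≤ ‖G (t, x t)‖ * ‖y - y'‖ := by
  simp only [linField, add_sub_add_right_eq_sub, ← map_sub]
  exact (G (t, x t)).le_opNorm _

theorem exists_isSolutionOn_linField (hp : 1 ≤ p) {G : ℝ × E N → E N →L[ℝ] E N}
    {k : ℝ × E N → E N} (hG : Measurable G) (hGm : HasMBounds p G) (hk : Measurable k)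
    (hkm : HasMBounds p k) {a b : ℝ} (ha : a ≤ 0) (hb : 0 ≤ b) {x : ℝ → E N}
    (hx : ContinuousOn x (Icc a b)) (y₀ : E N) :
    ∃ y : ℝ → E N, IsSolutionOn (linField G k x) y₀ (Icc a b) y := by
  have hGi := integrableOn_comp_curve hp hG hGm hx
  have hki := integrableOn_comp_curve hp hk hkm hx
  obtain ⟨y, -, hy⟩ := exists_isSolutionOn_Icc ha hb hGi.norm (fun t => norm_nonneg _)
    (Eventually.of_forall fun t => linField_lipschitz G k x t) (fun u hu => by
      refine Integrable.add ?_ hki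
      obtain ⟨C, hC⟩ := isCompact_Icc.exists_bound_of_continuousOn (hu.continuousOn (s := Icc a b))
      refine Integrable.mono' (g := fun t => ‖G (t, x t)‖ * C) (hGi.norm.mul_const C) ?_ ?_
      · exact isBoundedBilinearMap_apply.continuous.comp_aestronglyMeasurable
          (hGi.aestronglyMeasurable.prodMk hu.aestronglyMeasurable)
      · filter_upwards [ae_restrict_mem measurableSet_Icc] with t ht
        exact ((G (t, x t)).le_opNorm _).trans
          (mul_le_mul_of_nonneg_left (hC t ht) (norm_nonneg _))) y₀
  exact ⟨y, hy⟩

theorem linField_unique (hp : 1 ≤ p) {G : ℝ × E N → E N →L[ℝ] E N} {k : ℝ × E N → E N}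
    (hG : Measurable G) (hGm : HasMBounds p G) {a b : ℝ} {x : ℝ → E N}
    (hx : ContinuousOn x (Icc a b)) {y₀ : E N} {y₁ y₂ : ℝ → E N}
    (h₁ : IsSolutionOn (linField G k x) y₀ (Icc a b) y₁)
    (h₂ : IsSolutionOn (linField G k x) y₀ (Icc a b) y₂) : EqOn y₁ y₂ (Icc a b) := by
  intro t ht
  have := norm_sub_le_of_isSolutionOn h₁ h₂ (fun t => norm_nonneg (G (t, x t)))
    (integrableOn_comp_curve hp hG hGm hx).norm (e := fun _ => 0) (fun _ => le_rfl)
    integrableOn_zero (Eventually.of_forall fun t => by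
      simpa using linField_lipschitz G k x t (y₁ t) (y₂ t)) t ht
  simpa [sub_eq_zero] using this

theorem IsSolutionOn.linField_congr {G : ℝ × E N → E N →L[ℝ] E N} {k : ℝ × E N → E N}
    {x x' : ℝ → E N} {y₀ : E N} {J : Set ℝ} {y : ℝ → E N}
    (h : IsSolutionOn (linField G k x) y₀ J y) (hx : EqOn x x' J) :
    IsSolutionOn (linField G k x') y₀ J y := by
  refine h.congr (fun _ _ => rfl) fun t ht => ?_
  filter_upwards [ae_restrict_mem measurableSet_uIoc] with s hs
  have hs' := h.ordConnected.uIcc_subset h.zero_mem ht (uIoc_subset_uIcc hs)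
  simp only [linField, hx hs']

theorem maxInterval_triangular (hp : 1 ≤ p) {g : ℝ × E N → E N} {G : ℝ × E N → E N →L[ℝ] E N}
    {k : ℝ × E N → E N} (hG : Measurable G) (hGm : HasMBounds p G)
    (hk : Measurable k) (hkm : HasMBounds p k) (x₀ y₀ : E N) :
    maxInterval (triangular g G k) (x₀, y₀) = maxInterval g x₀ := by
  refine Subset.antisymm ?_ ?_
  · rintro t ⟨J, z, hz, ht⟩
    exact ⟨J, _, (isSolutionOn_triangular_iff.1 hz).1, ht⟩
  · rintro t ⟨J, x, hx, ht⟩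
    have hx' := uIcc_zero_isSolutionOn hx ht
    obtain ⟨y, hy⟩ := exists_isSolutionOn_linField hp hG hGm hk hkm (min_le_left 0 t)
      (le_max_left 0 t) hx'.continuousOn y₀
    exact ⟨_, fun t => (x t, y t), isSolutionOn_triangular_iff.2 ⟨hx', hy⟩,
      min_le_right _ _, le_max_right _ _⟩

/-- The triangular system has a unique maximal solution, on the interval of its first
component: the second equation is affine along the first component. -/
theorem isMaximalSolution_triangular (hp : 1 ≤ p) {g : ℝ × E N → E N}
    {G : ℝ × E N → E N →L[ℝ] E N} {k : ℝ × E N → E N} (hg : g ∈ LC p N (E N))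
    (hG : Measurable G) (hGm : HasMBounds p G) (hk : Measurable k) (hkm : HasMBounds p k)
    (x₀ y₀ : E N) :
    IsMaximalSolution (triangular g G k) (x₀, y₀) (maxInterval g x₀)
      (maxSolution (triangular g G k) (x₀, y₀)) := by
  have hI := maxInterval_triangular (g := g) hp hG hGm hk hkm x₀ y₀
  rw [← hI]
  refine isMaximalSolution_of_unique (fun J₁ z₁ J₂ z₂ h₁ h₂ t ht => ?_)
    (hI ▸ isOpen_maxInterval hp hg x₀)
  obtain ⟨a₁, b₁⟩ := isSolutionOn_triangular_iff.1 (uIcc_zero_isSolutionOn h₁ ht.1)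
  obtain ⟨a₂, b₂⟩ := isSolutionOn_triangular_iff.1 (uIcc_zero_isSolutionOn h₂ ht.2)
  have hx := solution_unique_Icc hp hg a₁ a₂
  have hy := linField_unique hp hG hGm a₁.continuousOn b₁
    (b₂.linField_congr fun s hs => (hx hs).symm)
  have ht' : t ∈ Icc (min 0 t) (max 0 t) := ⟨min_le_right _ _, le_max_right _ _⟩
  exact Prod.ext (hx ht') (hy ht')

theorem IsMaximalSolution.congr_curve {W : Type} [NormedAddCommGroup W] [NormedSpace ℝ W]
    {φ : ℝ × W → W} {w : W} {I : Set ℝ} {z z' : ℝ → W} (h : IsMaximalSolution φ w I z)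
    (hz : EqOn z' z I) : IsMaximalSolution φ w I z' :=
  ⟨h.isOpen, h.isSolutionOn.congr hz fun _ _ => Eventually.of_forall fun _ => rfl, fun J u hu =>
    ⟨(h.unique J u hu).1, fun _ ht =>
      ((h.unique J u hu).2 ht).trans (hz ((h.unique J u hu).1 ht)).symm⟩⟩

/-- A compact part of an open interval around `0` is enclosed in an interval with rational
end points. -/
theorem exists_rat_Icc_subset {I : Set ℝ} (hI : IsOpen I) (hI' : I.OrdConnected)
    (h0 : (0 : ℝ) ∈ I) {t : ℝ} (ht : t ∈ I) :
    ∃ a b : ℚ, (a : ℝ) < 0 ∧ (0 : ℝ) < b ∧ (a : ℝ) < t ∧ t < b ∧ Icc (a : ℝ) b ⊆ I := by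
  have hc : min 0 t ∈ I := by rcases min_choice 0 t with h | h <;> rw [h] <;> assumption
  have hd : max 0 t ∈ I := by rcases max_choice 0 t with h | h <;> rw [h] <;> assumption
  obtain ⟨ε, hε, h1⟩ := Metric.isOpen_iff.1 hI _ hc
  obtain ⟨δ, hδ, h2⟩ := Metric.isOpen_iff.1 hI _ hd
  obtain ⟨a, ha, ha'⟩ := exists_rat_btwn (show min 0 t - ε < min 0 t by linarith)
  obtain ⟨b, hb, hb'⟩ := exists_rat_btwn (show max 0 t < max 0 t + δ by linarith)
  have haI : (a : ℝ) ∈ I := h1 (by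
    rw [Metric.mem_ball, Real.dist_eq, abs_lt]; constructor <;> linarith)
  have hbI : (b : ℝ) ∈ I := h2 (by
    rw [Metric.mem_ball, Real.dist_eq, abs_lt]; constructor <;> linarith)
  exact ⟨a, b, ha'.trans_le (min_le_left _ _), (le_max_left _ _).trans_lt hb,
    ha'.trans_le (min_le_right _ _), (le_max_right _ _).trans_lt hb, hI'.out haI hbI⟩

variable {f : ℝ × E N → E N} {hm : HasL1LocEquicontinuousMBounds f}

/-- The triangular system does not depend on the representatives of its coefficients: a solution
of the first equation is an admissible curve, along which equivalent coefficients coincide. -/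
theorem IsMaximalSolution.triangular_congr (hp : 1 ≤ p) {g g' : ℝ × E N → E N}
    {G G' : ℝ × E N → E N →L[ℝ] E N} {k k' : ℝ × E N → E N} (hg : g ∈ LC p N (E N))
    (hdom : MBoundsDominated f g) (hg' : g' ∈ LC p N (E N)) (hgg' : g =ᵐ[volume] g')
    (hG : G ∈ ThetaC (moduliOf f hm) p N (E N →L[ℝ] E N))
    (hG' : G' ∈ ThetaC (moduliOf f hm) p N (E N →L[ℝ] E N)) (hGG' : G =ᵐ[volume] G')
    (hk : k ∈ ThetaC (moduliOf f hm) p N (E N)) (hk' : k' ∈ ThetaC (moduliOf f hm) p N (E N))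
    (hkk' : k =ᵐ[volume] k') {x₀ y₀ : E N} {I : Set ℝ} {z : ℝ → E N × E N}
    (h : IsMaximalSolution (triangular g G k) (x₀, y₀) I z) :
    IsMaximalSolution (triangular g' G' k') (x₀, y₀) I z := by
  have hae := LC.ae_forall_eq hg hg' hgg'
  have hI : maxInterval g' x₀ = I := by
    rw [← (((LC.isMaximalSolution hp hg x₀).congr_ae_forall hae).eq
      (LC.isMaximalSolution hp hg' x₀)).1]
    exact ((isMaximalSolution_triangular hp hg hG.1 hG.2.1 hk.1 hk.2.1 x₀ y₀).eq h).1
  have h' := isMaximalSolution_triangular hp hg' hG'.1 hG'.2.1 hk'.1 hk'.2.1 x₀ y₀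
  rw [hI] at h'
  refine h'.congr_curve (h'.unique I z ?_).2
  refine h.isSolutionOn.congr (fun _ _ => rfl) fun t ht => ?_
  obtain ⟨a, b, ha, hb, hat, htb, hsub⟩ := exists_rat_Icc_subset h.isOpen
    h.isSolutionOn.ordConnected h.isSolutionOn.zero_mem ht
  have hx : IsSolutionOn g x₀ (Icc (a : ℝ) b) fun t => (z t).1 :=
    (isSolutionOn_triangular_iff.1 h.isSolutionOn).1.mono hsub ordConnected_Icc ⟨ha.le, hb.le⟩
  obtain ⟨j, hj⟩ := exists_nat_norm_lt hx.continuousOn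
  have hadm : (fun t => (z t).1) ∈ admissible (moduliOf f hm) N a b j :=
    hx.mem_admissible hdom fun t ht => (hj t ht).le
  have hsub' : uIoc 0 t ⊆ Icc (a : ℝ) b :=
    uIoc_subset_uIcc.trans (uIcc_subset_Icc ⟨ha.le, hb.le⟩ ⟨hat.le, htb.le⟩)
  filter_upwards [ae_restrict_of_ae hae,
    ae_restrict_of_ae_restrict_of_subset hsub' (ae_eq_along_of_ae_eq hp hG hG' hGG' hadm),
    ae_restrict_of_ae_restrict_of_subset hsub' (ae_eq_along_of_ae_eq hp hk hk' hkk' hadm)]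
    with s h1 h2 h3
  simp only [triangular, h1, h2, h3]

/-- Continuous dependence for the second equation. -/
theorem tendstoUniformlyOn_linField {Θ : Moduli} (hp : 1 ≤ p) {G : ℕ → ℝ × E N → E N →L[ℝ] E N}
    {G₀ : ℝ × E N → E N →L[ℝ] E N} {k : ℕ → ℝ × E N → E N} {k₀ : ℝ × E N → E N}
    (hG : ∀ n, G n ∈ ThetaC Θ p N (E N →L[ℝ] E N)) (hG₀ : G₀ ∈ ThetaC Θ p N (E N →L[ℝ] E N))
    (hk : ∀ n, k n ∈ ThetaC Θ p N (E N)) (hk₀ : k₀ ∈ ThetaC Θ p N (E N)) {a b : ℚ} {j : ℕ}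
    (hGconv : Tendsto (fun n => thetaSeminorm Θ p a b j (G n - G₀)) atTop (𝓝 0))
    (hkconv : Tendsto (fun n => thetaSeminorm Θ p a b j (k n - k₀)) atTop (𝓝 0))
    {x : ℕ → ℝ → E N} {x₀ : ℝ → E N} (hx : ∀ᶠ n in atTop, x n ∈ admissible Θ N a b j)
    (hx₀ : x₀ ∈ admissible Θ N a b j) (hu : TendstoUniformlyOn x x₀ atTop (Icc (a : ℝ) b))
    {v : ℕ → E N} {v₀ : E N} (hv : Tendsto v atTop (𝓝 v₀)) {y : ℕ → ℝ → E N} {y₀ : ℝ → E N}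
    (hy : ∀ᶠ n in atTop, IsSolutionOn (linField (G n) (k n) (x n)) (v n) (Icc (a : ℝ) b) (y n))
    (hy₀ : IsSolutionOn (linField G₀ k₀ x₀) v₀ (Icc (a : ℝ) b) y₀) :
    TendstoUniformlyOn y y₀ atTop (Icc (a : ℝ) b) := by
  have cG := tendsto_integral_norm_along hp (fun n => (hG n).1) hG₀ hGconv hx hx₀ hu
  have ck := tendsto_integral_norm_along hp (fun n => (hk n).1) hk₀ hkconv hx hx₀ hu
  obtain ⟨R, hR⟩ := exists_nat_norm_lt hy₀.continuousOn
  set α : ℕ → ℝ := fun n => ∫ t in Icc (a : ℝ) b, ‖G n (t, x n t) - G₀ (t, x₀ t)‖ with hα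
  set β : ℕ → ℝ := fun n => ∫ t in Icc (a : ℝ) b, ‖k n (t, x n t) - k₀ (t, x₀ t)‖ with hβ
  set A : ℝ := ∫ t in Icc (a : ℝ) b, ‖G₀ (t, x₀ t)‖ with hA
  have iG₀ := integrableOn_comp_curve hp hG₀.1 hG₀.2.1 hx₀.1
  have ik₀ := integrableOn_comp_curve hp hk₀.1 hk₀.2.1 hx₀.1
  have hBtend : Tendsto (fun n => 2 * (‖v n - v₀‖ + (α n * R + β n)) *
      Real.exp (2 * (A + α n))) atTop (𝓝 0) := by
    have h1 := tendsto_iff_norm_sub_tendsto_zero.1 hv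
    have h2 := (h1.add ((cG.mul_const (R : ℝ)).add ck)).const_mul 2
    have h3 : Tendsto (fun n => Real.exp (2 * (A + α n))) atTop (𝓝 (Real.exp (2 * (A + 0)))) :=
      (Real.continuous_exp.tendsto _).comp ((cG.const_add A).const_mul 2)
    simpa using h2.mul h3
  rw [Metric.tendstoUniformlyOn_iff]
  intro ε hε
  filter_upwards [hBtend.eventually (gt_mem_nhds hε), hx, hy] with n hn hxn hyn t ht
  have iG := integrableOn_comp_curve hp (hG n).1 (hG n).2.1 hxn.1
  have ik := integrableOn_comp_curve hp (hk n).1 (hk n).2.1 hxn.1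
  have iGd : IntegrableOn (fun s => ‖G n (s, x n s) - G₀ (s, x₀ s)‖) (Icc (a : ℝ) b) :=
    (iG.sub iG₀).norm
  have ikd : IntegrableOn (fun s => ‖k n (s, x n s) - k₀ (s, x₀ s)‖) (Icc (a : ℝ) b) :=
    (ik.sub ik₀).norm
  rw [dist_comm, dist_eq_norm]
  refine lt_of_le_of_lt ?_ hn
  -- splitting off `(G n - G₀) y₀`, with `‖y₀‖ ≤ R`, leaves `‖G n (t, x n t)‖` as the Gronwall
  -- coefficient
  have key := norm_sub_le_of_isSolutionOn hyn hy₀ (l := fun t => ‖G n (t, x n t)‖)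
    (e := fun t => ‖G n (t, x n t) - G₀ (t, x₀ t)‖ * R + ‖k n (t, x n t) - k₀ (t, x₀ t)‖)
    (fun t => norm_nonneg _) iG.norm (fun t => by positivity) ((iGd.mul_const _).add ikd) (by
      filter_upwards [ae_restrict_mem measurableSet_Icc] with s hs
      have e1 : linField (G n) (k n) (x n) (s, y n s) - linField G₀ k₀ x₀ (s, y₀ s) =
          G n (s, x n s) (y n s - y₀ s) + ((G n (s, x n s) - G₀ (s, x₀ s)) (y₀ s) +
            (k n (s, x n s) - k₀ (s, x₀ s))) := by
        simp only [linField, map_sub, sub_apply]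
        abel
      rw [e1]
      refine (norm_add_le _ _).trans (add_le_add ((G n (s, x n s)).le_opNorm _)
        ((norm_add_le _ _).trans (add_le_add ?_ le_rfl)))
      exact ((G n (s, x n s) - G₀ (s, x₀ s)).le_opNorm _).trans
        (mul_le_mul_of_nonneg_left (hR s hs).le (norm_nonneg _))) t ht
  refine key.trans ?_
  have e2 : ∫ s in Icc (a : ℝ) b, (‖G n (s, x n s) - G₀ (s, x₀ s)‖ * R +
      ‖k n (s, x n s) - k₀ (s, x₀ s)‖) = α n * R + β n := by
    rw [integral_add (iGd.mul_const _) ikd, integral_mul_const]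
  have e3 : ∫ s in Icc (a : ℝ) b, ‖G n (s, x n s)‖ ≤ A + α n := by
    have e4 : A + α n = ∫ s in Icc (a : ℝ) b,
        (‖G₀ (s, x₀ s)‖ + ‖G n (s, x n s) - G₀ (s, x₀ s)‖) := (integral_add iG₀.norm iGd).symm
    rw [e4]
    refine integral_mono iG.norm (iG₀.norm.add iGd) fun s => ?_
    have := norm_add_le (G₀ (s, x₀ s)) (G n (s, x n s) - G₀ (s, x₀ s))
    rwa [add_sub_cancel] at this
  rw [e2]
  have hα0 : 0 ≤ α n := integral_nonneg fun _ => norm_nonneg _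
  have hβ0 : 0 ≤ β n := integral_nonneg fun _ => norm_nonneg _
  exact mul_le_mul_of_nonneg_left (Real.exp_le_exp.2 (by linarith)) (by positivity)

end Triangular

/-! ### The skew-product flows -/

section Sequential

theorem exists_isOpen_eq_inter_of_seq {X : Type*} [TopologicalSpace X] [FirstCountableTopology X]
    {U C : Set X} (hUC : U ⊆ C)
    (h : ∀ q ∈ U, ∀ u : ℕ → X, Tendsto u atTop (𝓝 q) → (∀ n, u n ∈ C) →
      ∀ᶠ n in atTop, u n ∈ U) : ∃ O, IsOpen O ∧ U = O ∩ C := by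
  refine ⟨interior (U ∪ Cᶜ), isOpen_interior, Subset.antisymm (fun q hq => ⟨?_, hUC hq⟩) ?_⟩
  · rw [mem_interior_iff_mem_nhds]
    by_contra hcon
    have hfr : ∃ᶠ r in 𝓝 q, r ∉ U ∪ Cᶜ := not_eventually.1 hcon
    obtain ⟨u, hu, hu'⟩ := exists_seq_forall_of_frequently hfr
    simp only [mem_union, mem_compl_iff, not_or, not_not] at hu'
    obtain ⟨n, hn⟩ := (h q hq u hu fun n => (hu' n).2).exists
    exact (hu' n).1 hn
  · rintro q ⟨hq, hC⟩
    exact (interior_subset hq).resolve_right fun h => h hC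

theorem continuousOn_of_seq {X Y : Type*} [TopologicalSpace X] [FirstCountableTopology X]
    [TopologicalSpace Y] {U : Set X} {φ : X → Y}
    (h : ∀ q ∈ U, ∀ u : ℕ → X, Tendsto u atTop (𝓝 q) → (∀ n, u n ∈ U) →
      Tendsto (fun n => φ (u n)) atTop (𝓝 (φ q))) : ContinuousOn φ U := by
  rw [continuousOn_iff_continuous_domRestrict, continuous_iff_seqContinuous]
  intro u q hu
  exact h q q.2 (fun n => u n) ((continuous_subtype_val.tendsto q).comp hu) fun n => (u n).2

theorem tendsto_eval_of_tendstoUniformlyOn {Y : Type*} [PseudoMetricSpace Y] {z : ℕ → ℝ → Y}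
    {z₀ : ℝ → Y} {a b : ℝ} (h : TendstoUniformlyOn z z₀ atTop (Icc a b))
    (hz₀ : ContinuousOn z₀ (Icc a b)) {t : ℕ → ℝ} {t₀ : ℝ} (ht : Tendsto t atTop (𝓝 t₀))
    (ha : a < t₀) (hb : t₀ < b) : Tendsto (fun n => z n (t n)) atTop (𝓝 (z₀ t₀)) := by
  have hmem : Icc a b ∈ 𝓝 t₀ := Icc_mem_nhds ha hb
  refine tendsto_comp_of_locally_uniform_limit (hz₀.continuousAt hmem) ht fun u hu => ?_
  exact ⟨Icc a b, hmem, h u hu⟩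

theorem mapsTo_hull {B : Type} [TopologicalSpace B] {σ : ℝ → B → B}
    (hc : ∀ t, Continuous (σ t)) (hadd : ∀ s t b, σ (s + t) b = σ t (σ s b)) (b : B) (t : ℝ) :
    MapsTo (σ t) (hull σ b) (hull σ b) := fun _ hx =>
  map_mem_closure (hc t) hx (by
    rintro _ ⟨s, rfl⟩
    exact ⟨s + t, hadd s t b⟩)

end Sequential

section Flow

variable {N : ℕ} {p : ℝ≥0∞} {f : ℝ × E N → E N} {hf : f ∈ LC p N (E N)}
  {hm : HasL1LocEquicontinuousMBounds f}

theorem continuous_translateLC (Θ : Moduli) (hp : 1 ≤ p) (hp' : p ≠ ∞) :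
    Continuous fun q : ℝ × LCSpace Θ p N (E N) => translateLC q.1 q.2 :=
  ThetaSpace.continuous_translate hp hp' LC_subset_ThetaC _

theorem continuous_translateTriple (Θ : Moduli) (hp : 1 ≤ p) (hp' : p ≠ ∞) :
    Continuous fun q : ℝ × Coeff Θ p N => translateTriple q.1 q.2 := by
  refine ((continuous_translateLC Θ hp hp').comp (by fun_prop :
    Continuous fun q : ℝ × Coeff Θ p N => (q.1, q.2.1))).prodMk (Continuous.prodMk ?_ ?_)
  · exact (ThetaSpace.continuous_translate (Θ := Θ) (V := E N →L[ℝ] E N) hp hp' Subset.rfl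
      fun _ hf t => shift_mem_ThetaC hf t).comp (by fun_prop :
      Continuous fun q : ℝ × Coeff Θ p N => (q.1, q.2.2.1))
  · exact (ThetaSpace.continuous_translate (Θ := Θ) (V := E N) hp hp' Subset.rfl
      fun _ hf t => shift_mem_ThetaC hf t).comp (by fun_prop :
      Continuous fun q : ℝ × Coeff Θ p N => (q.1, q.2.2.2))

theorem translateLC_zero {Θ : Moduli} (g : LCSpace Θ p N (E N)) : translateLC 0 g = g :=
  ThetaSpace.translate_zero (fun _ hf t => shift_mem_LC hf t) g

theorem translateLC_add {Θ : Moduli} (s t : ℝ) (g : LCSpace Θ p N (E N)) :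
    translateLC (s + t) g = translateLC t (translateLC s g) :=
  ThetaSpace.translate_add (fun _ hf t => shift_mem_LC hf t) s t g

theorem translateTriple_zero {Θ : Moduli} (c : Coeff Θ p N) : translateTriple 0 c = c :=
  Prod.ext (translateLC_zero _)
    (Prod.ext (ThetaSpace.translate_zero (fun _ hf t => shift_mem_ThetaC hf t) _)
      (ThetaSpace.translate_zero (fun _ hf t => shift_mem_ThetaC hf t) _))

theorem translateTriple_add {Θ : Moduli} (s t : ℝ) (c : Coeff Θ p N) :
    translateTriple (s + t) c = translateTriple t (translateTriple s c) :=
  Prod.ext (translateLC_add _ _ _)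
    (Prod.ext (ThetaSpace.translate_add (fun _ hf t => shift_mem_ThetaC hf t) _ _ _)
      (ThetaSpace.translate_add (fun _ hf t => shift_mem_ThetaC hf t) _ _ _))

theorem fst_mem_hullLC {F : ThetaCSpace (moduliOf f hm) p N (E N →L[ℝ] E N)}
    {h : ThetaCSpace (moduliOf f hm) p N (E N)} {c : Coeff (moduliOf f hm) p N}
    (hc : c ∈ hullTriple p f hf hm F h) : c.1 ∈ hullLC p f hf hm :=
  map_mem_closure continuous_fst hc (by
    rintro _ ⟨t, rfl⟩
    exact ⟨t, rfl⟩)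

/-- Continuous dependence of `x(·, g, x₀)` on `(g, x₀)`, on a neighbourhood with rational end
points of `0` and of a given time of the maximal interval. -/
theorem exists_tendstoUniformlyOn_solX (hp : 1 ≤ p) {g : ℕ → LCSpace (moduliOf f hm) p N (E N)}
    {g₀ : LCSpace (moduliOf f hm) p N (E N)} (hg : ∀ n, g n ∈ hullLC p f hf hm)
    (hg₀ : g₀ ∈ hullLC p f hf hm) (hlim : Tendsto g atTop (𝓝 g₀)) {x : ℕ → E N} {x₀ : E N}
    (hx : Tendsto x atTop (𝓝 x₀)) {t : ℝ} (ht : t ∈ solInterval g₀ x₀) :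
    ∃ (a b : ℚ) (j : ℕ), (a : ℝ) < 0 ∧ (0 : ℝ) < b ∧ (a : ℝ) < t ∧ t < b ∧
      Icc (a : ℝ) b ⊆ solInterval g₀ x₀ ∧
      (fun t => solX t g₀ x₀) ∈ admissible (moduliOf f hm) N a b j ∧
      (∀ᶠ n in atTop, Icc (a : ℝ) b ⊆ solInterval (g n) (x n) ∧
        (fun t => solX t (g n) (x n)) ∈ admissible (moduliOf f hm) N a b j) ∧
      TendstoUniformlyOn (fun n t => solX t (g n) (x n)) (fun t => solX t g₀ x₀) atTop
        (Icc (a : ℝ) b) := by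
  obtain ⟨a, b, ha, hb, hat, htb, hsub⟩ := exists_rat_Icc_subset
    (isOpen_maxInterval hp g₀.rep_mem x₀) (ordConnected_maxInterval _ _)
    (zero_mem_maxInterval _ _) ht
  obtain ⟨j, h1, h2, h3⟩ := tendstoUniformlyOn_maxSolution (hm := hm) hp
    (fun n => (g n).rep_mem) (fun n => mboundsDominated_of_mem_hullLC hp (hg n)) g₀.rep_mem
    (mboundsDominated_of_mem_hullLC hp hg₀)
    ((ThetaSpace.tendsto_nhds_iff hp LC_subset_ThetaC).1 hlim) hx ha.le hb.le hsub
  exact ⟨a, b, j, ha, hb, hat, htb, hsub, h1, h2, h3⟩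

theorem solX_cocycle {Θ : Moduli} (hp : 1 ≤ p) {s : ℝ} {g : LCSpace Θ p N (E N)} {x₀ : E N}
    (hs : s ∈ solInterval g x₀) :
    (∀ t, t ∈ solInterval (translateLC s g) (solX s g x₀) ↔ s + t ∈ solInterval g x₀) ∧
      ∀ t, s + t ∈ solInterval g x₀ →
        solX (s + t) g x₀ = solX t (translateLC s g) (solX s g x₀) :=
  IsMaximalSolution.translate (isMaximalSolution_of_isRep hp g.isRep_rep x₀) hs
    (isMaximalSolution_of_isRep hp
      (ThetaSpace.isRep_translate (fun _ hf t => shift_mem_LC hf t) s g.isRep_rep) (solX s g x₀))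

theorem tendsto_solX (hp : 1 ≤ p) {q : ℝ × LCSpace (moduliOf f hm) p N (E N) × E N}
    (hq : q ∈ domain₁ (hullLC p f hf hm))
    {u : ℕ → ℝ × LCSpace (moduliOf f hm) p N (E N) × E N} (hu : Tendsto u atTop (𝓝 q))
    (huH : ∀ n, (u n).2.1 ∈ hullLC p f hf hm) :
    (∀ᶠ n in atTop, u n ∈ domain₁ (hullLC p f hf hm)) ∧
      Tendsto (fun n => solX (u n).1 (u n).2.1 (u n).2.2) atTop
        (𝓝 (solX q.1 q.2.1 q.2.2)) := by
  have htime : Tendsto (fun n => (u n).1) atTop (𝓝 q.1) :=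
    (continuous_fst.tendsto q).comp hu
  obtain ⟨a, b, j, ha, hb, hat, htb, -, hadm, hev, hunif⟩ :=
    exists_tendstoUniformlyOn_solX hp huH hq.1
      (((continuous_fst.comp continuous_snd).tendsto q).comp hu)
      (((continuous_snd.comp continuous_snd).tendsto q).comp hu) hq.2
  refine ⟨?_, tendsto_eval_of_tendstoUniformlyOn hunif hadm.1 htime hat htb⟩
  filter_upwards [hev, htime.eventually (Icc_mem_nhds hat htb)] with n hn hn'
  exact ⟨huH n, hn.1 hn'⟩

/-- The equation `ẋ = g(t, x)` induces a local skew-product flow over the hull. -/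
theorem isLocalSkewProductFlow_hullLC (hp : 1 ≤ p) (hp' : p ≠ ∞) :
    IsLocalSkewProductFlow (hullLC p f hf hm) translateLC (domain₁ (hullLC p f hf hm))
      (fun q => solX q.1 q.2.1 q.2.2) := by
  have := ThetaSpace.firstCountableTopology (Θ := moduliOf f hm) hp
    (LC_subset_ThetaC (p := p) (N := N) (V := E N))
  have hσ := continuous_translateLC (N := N) (moduliOf f hm) hp hp'
  have hmaps : ∀ t, MapsTo (translateLC t) (hullLC p f hf hm) (hullLC p f hf hm) :=
    mapsTo_hull (σ := translateLC) (fun t => hσ.comp (continuous_const.prodMk continuous_id))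
      translateLC_add _
  refine ⟨hmaps, fun b _ => translateLC_zero b, fun s t b _ => translateLC_add s t b,
    hσ.continuousOn, ?_, fun b hb z => ⟨hb, zero_mem_maxInterval _ _⟩, fun b z => ?_, ?_,
    fun b _ z => ?_, fun s t b z hs => ?_, fun s t b z hs hst => ?_⟩
  · exact exists_isOpen_eq_inter_of_seq (fun q hq => hq.1) fun q hq u hu huC =>
      (tendsto_solX hp hq hu huC).1
  · exact ⟨fun s hs t ht r hr => ⟨hs.1, (ordConnected_maxInterval _ _).out hs.2 ht.2 hr⟩⟩
  · refine ContinuousOn.prodMk (hσ.comp (by fun_prop :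
      Continuous fun q : ℝ × LCSpace (moduliOf f hm) p N (E N) × E N =>
        (q.1, q.2.1))).continuousOn (continuousOn_of_seq fun q hq u hu huU => ?_)
    exact (tendsto_solX hp hq hu fun n => (huU n).1).2
  · exact (isMaximalSolution_of_isRep hp b.isRep_rep z).isSolutionOn.map_zero
  · have := (solX_cocycle hp hs.2).1 t
    exact ⟨fun h => ⟨hs.1, this.1 h.2⟩, fun h => ⟨hmaps s hs.1, this.2 h.2⟩⟩
  · exact (solX_cocycle hp hs.2).2 t hst.2

variable {F : ThetaCSpace (moduliOf f hm) p N (E N →L[ℝ] E N)}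
  {h : ThetaCSpace (moduliOf f hm) p N (E N)}

/-- The maximal solution of the triangular system, for any representatives of the coefficients. -/
theorem isMaximalSolution_triangular_of_isRep (hp : 1 ≤ p) {c : Coeff (moduliOf f hm) p N}
    (hc : c ∈ hullTriple p f hf hm F h) (x₀ y₀ : E N) {g' : ℝ × E N → E N}
    {G' : ℝ × E N → E N →L[ℝ] E N} {k' : ℝ × E N → E N} (hg' : c.1.IsRep g')
    (hG' : c.2.1.IsRep G') (hk' : c.2.2.IsRep k') :
    IsMaximalSolution (triangular g' G' k') (x₀, y₀) (solInterval c.1 x₀)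
      (fun t => (solX t c.1 x₀, solY t c x₀ y₀)) := by
  have hmax := isMaximalSolution_triangular hp c.1.rep_mem c.2.1.rep_mem.1 c.2.1.rep_mem.2.1
    c.2.2.rep_mem.1 c.2.2.rep_mem.2.1 x₀ y₀
  have hx := ((LC.isMaximalSolution hp c.1.rep_mem x₀).unique _ _
    (isSolutionOn_triangular_iff.1 hmax.isSolutionOn).1).2
  refine IsMaximalSolution.triangular_congr (hm := hm) hp c.1.rep_mem
    (mboundsDominated_of_mem_hullLC hp (fst_mem_hullLC hc)) hg'.1 hg'.ae_eq_rep.symm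
    c.2.1.rep_mem hG'.1 hG'.ae_eq_rep.symm c.2.2.rep_mem hk'.1 hk'.ae_eq_rep.symm
    (hmax.congr_curve fun t ht => Prod.ext (hx ht).symm rfl)

theorem solY_cocycle (hp : 1 ≤ p) {s : ℝ} {c : Coeff (moduliOf f hm) p N}
    (hc : c ∈ hullTriple p f hf hm F h) (hc' : translateTriple s c ∈ hullTriple p f hf hm F h)
    {x₀ y₀ : E N} (hs : s ∈ solInterval c.1 x₀) {t : ℝ} (ht : s + t ∈ solInterval c.1 x₀) :
    solY (s + t) c x₀ y₀ = solY t (translateTriple s c) (solX s c.1 x₀) (solY s c x₀ y₀) :=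
  (Prod.ext_iff.1 ((IsMaximalSolution.translate (isMaximalSolution_triangular_of_isRep hp hc
    x₀ y₀ c.1.isRep_rep c.2.1.isRep_rep c.2.2.isRep_rep) hs
    (isMaximalSolution_triangular_of_isRep hp hc' (solX s c.1 x₀) (solY s c x₀ y₀)
      (ThetaSpace.isRep_translate (fun _ hf t => shift_mem_LC hf t) s c.1.isRep_rep)
      (ThetaSpace.isRep_translate (fun _ hf t => shift_mem_ThetaC hf t) s c.2.1.isRep_rep)
      (ThetaSpace.isRep_translate (fun _ hf t => shift_mem_ThetaC hf t) s
        c.2.2.isRep_rep))).2 t ht)).2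

theorem tendsto_solX_solY (hp : 1 ≤ p) {q : ℝ × Coeff (moduliOf f hm) p N × (E N × E N)}
    (hq : q ∈ domain₂ (hullTriple p f hf hm F h))
    {u : ℕ → ℝ × Coeff (moduliOf f hm) p N × (E N × E N)} (hu : Tendsto u atTop (𝓝 q))
    (huH : ∀ n, (u n).2.1 ∈ hullTriple p f hf hm F h) :
    (∀ᶠ n in atTop, u n ∈ domain₂ (hullTriple p f hf hm F h)) ∧
      Tendsto (fun n => (solX (u n).1 (u n).2.1.1 (u n).2.2.1,
          solY (u n).1 (u n).2.1 (u n).2.2.1 (u n).2.2.2)) atTop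
        (𝓝 (solX q.1 q.2.1.1 q.2.2.1, solY q.1 q.2.1 q.2.2.1 q.2.2.2)) := by
  have htime : Tendsto (fun n => (u n).1) atTop (𝓝 q.1) :=
    (continuous_fst.tendsto q).comp hu
  have hc : Tendsto (fun n => (u n).2.1) atTop (𝓝 q.2.1) :=
    ((continuous_fst.comp continuous_snd).tendsto q).comp hu
  have hw : Tendsto (fun n => (u n).2.2) atTop (𝓝 q.2.2) :=
    ((continuous_snd.comp continuous_snd).tendsto q).comp hu
  have hg : Tendsto (fun n => (u n).2.1.1) atTop (𝓝 q.2.1.1) := hc.fst_nhds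
  have hG : Tendsto (fun n => (u n).2.1.2.1) atTop (𝓝 q.2.1.2.1) := hc.snd_nhds.fst_nhds
  have hk : Tendsto (fun n => (u n).2.1.2.2) atTop (𝓝 q.2.1.2.2) := hc.snd_nhds.snd_nhds
  obtain ⟨a, b, j, ha, hb, hat, htb, hsub, hadm, hev, hunif⟩ :=
    exists_tendstoUniformlyOn_solX hp (fun n => fst_mem_hullLC (huH n)) (fst_mem_hullLC hq.1) hg
      hw.fst_nhds hq.2
  have hsol : ∀ {c : Coeff (moduliOf f hm) p N}, c ∈ hullTriple p f hf hm F h →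
      ∀ {w : E N × E N}, Icc (a : ℝ) b ⊆ solInterval c.1 w.1 →
      IsSolutionOn (linField c.2.1.rep c.2.2.rep fun t => solX t c.1 w.1) w.2 (Icc (a : ℝ) b)
        fun t => solY t c w.1 w.2 := fun {c} hc {w} hI =>
    (isSolutionOn_triangular_iff.1 (isMaximalSolution_triangular_of_isRep hp hc w.1 w.2
      c.1.isRep_rep c.2.1.isRep_rep c.2.2.isRep_rep).isSolutionOn).2.mono hI ordConnected_Icc
      ⟨ha.le, hb.le⟩
  have hsol₀ := hsol hq.1 hsub
  have hunifY := tendstoUniformlyOn_linField hp (fun n => (u n).2.1.2.1.rep_mem)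
    q.2.1.2.1.rep_mem (fun n => (u n).2.1.2.2.rep_mem) q.2.1.2.2.rep_mem
    ((ThetaSpace.tendsto_nhds_iff hp Subset.rfl).1 hG a b j)
    ((ThetaSpace.tendsto_nhds_iff hp Subset.rfl).1 hk a b j)
    (hev.mono fun n hn => hn.2) hadm hunif hw.snd_nhds
    (hev.mono fun n hn => hsol (huH n) hn.1) hsol₀
  refine ⟨?_, (tendsto_eval_of_tendstoUniformlyOn hunif hadm.1 htime hat htb).prodMk_nhds
    (tendsto_eval_of_tendstoUniformlyOn hunifY hsol₀.continuousOn htime hat htb)⟩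
  filter_upwards [hev, htime.eventually (Icc_mem_nhds hat htb)] with n hn hn'
  exact ⟨huH n, hn.1 hn'⟩

/-- The triangular system induces a local skew-product flow over the hull of the coefficients. -/
theorem isLocalSkewProductFlow_hullTriple (hp : 1 ≤ p) (hp' : p ≠ ∞) :
    IsLocalSkewProductFlow (hullTriple p f hf hm F h) translateTriple
      (domain₂ (hullTriple p f hf hm F h))
      (fun q => (solX q.1 q.2.1.1 q.2.2.1, solY q.1 q.2.1 q.2.2.1 q.2.2.2)) := by
  have := ThetaSpace.firstCountableTopology (Θ := moduliOf f hm) hp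
    (LC_subset_ThetaC (p := p) (N := N) (V := E N))
  have := ThetaSpace.firstCountableTopology (Θ := moduliOf f hm) hp
    (Subset.refl (ThetaC (moduliOf f hm) p N (E N)))
  have := ThetaSpace.firstCountableTopology (Θ := moduliOf f hm) hp
    (Subset.refl (ThetaC (moduliOf f hm) p N (E N →L[ℝ] E N)))
  have hσ := continuous_translateTriple (N := N) (moduliOf f hm) hp hp'
  have hmaps : ∀ t, MapsTo (translateTriple t) (hullTriple p f hf hm F h)
      (hullTriple p f hf hm F h) :=
    mapsTo_hull (σ := translateTriple) (fun t => hσ.comp (continuous_const.prodMk continuous_id))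
      translateTriple_add _
  refine ⟨hmaps, fun b _ => translateTriple_zero b, fun s t b _ => translateTriple_add s t b,
    hσ.continuousOn, ?_, fun b hb z => ⟨hb, zero_mem_maxInterval _ _⟩, fun b z => ?_, ?_,
    fun b hb z => ?_, fun s t b z hs => ?_, fun s t b z hs hst => ?_⟩
  · exact exists_isOpen_eq_inter_of_seq (fun q hq => hq.1) fun q hq u hu huC =>
      (tendsto_solX_solY hp hq hu huC).1
  · exact ⟨fun s hs t ht r hr => ⟨hs.1, (ordConnected_maxInterval _ _).out hs.2 ht.2 hr⟩⟩
  · refine ContinuousOn.prodMk (hσ.comp (by fun_prop :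
      Continuous fun q : ℝ × Coeff (moduliOf f hm) p N × (E N × E N) =>
        (q.1, q.2.1))).continuousOn (continuousOn_of_seq fun q hq u hu huU => ?_)
    exact (tendsto_solX_solY hp hq hu fun n => (huU n).1).2
  · exact (isMaximalSolution_triangular_of_isRep hp hb z.1 z.2 b.1.isRep_rep b.2.1.isRep_rep
      b.2.2.isRep_rep).isSolutionOn.map_zero
  · have := (solX_cocycle hp hs.2).1 t
    exact ⟨fun h => ⟨hs.1, this.1 h.2⟩, fun h => ⟨hmaps s hs.1, this.2 h.2⟩⟩
  · exact Prod.ext ((solX_cocycle hp hs.2).2 t hst.2)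
      (solY_cocycle hp hs.1 (hmaps s hs.1) hs.2 hst.2)

end Flow

end Caratheodory

end

theorem mainTheorem2 (N : ℕ) (p : ℝ≥0∞) (hp : 1 ≤ p) (hp' : p ≠ ∞)
    (f : ℝ × E N → E N) (hf : f ∈ LC p N (E N)) (hm : HasL1LocEquicontinuousMBounds f) :
    -- the equation `ẋ = g(t, x)`, with `g` in the hull of `f`
    ((∀ g ∈ hullLC p f hf hm, ∀ (x₀ : E N) (g' : ℝ × E N → E N), g.IsRep g' →
        IsMaximalSolution g' x₀ (solInterval g x₀) (fun t => solX t g x₀)) ∧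
      IsLocalSkewProductFlow (hullLC p f hf hm) translateLC (domain₁ (hullLC p f hf hm))
        (fun q => solX q.1 q.2.1 q.2.2)) ∧
    -- the triangular system, with `(g, G, k)` in the hull of `(f, F, h)`
    (∀ (F : ThetaCSpace (moduliOf f hm) p N (E N →L[ℝ] E N))
        (h : ThetaCSpace (moduliOf f hm) p N (E N)),
      (∀ c ∈ hullTriple p f hf hm F h, ∀ (x₀ y₀ : E N) (g' : ℝ × E N → E N)
          (G' : ℝ × E N → E N →L[ℝ] E N) (k' : ℝ × E N → E N),
          c.1.IsRep g' → c.2.1.IsRep G' → c.2.2.IsRep k' →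
          IsMaximalSolution (triangular g' G' k') (x₀, y₀) (solInterval c.1 x₀)
            (fun t => (solX t c.1 x₀, solY t c x₀ y₀))) ∧
      IsLocalSkewProductFlow (hullTriple p f hf hm F h) translateTriple
        (domain₂ (hullTriple p f hf hm F h))
        (fun q => (solX q.1 q.2.1.1 q.2.2.1, solY q.1 q.2.1 q.2.2.1 q.2.2.2))) := by
  refine ⟨⟨fun g _ x₀ g' hg' => isMaximalSolution_of_isRep hp hg' x₀,
    isLocalSkewProductFlow_hullLC hp hp'⟩, fun F h => ⟨fun c hc x₀ y₀ g' G' k' hg' hG' hk' =>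
    isMaximalSolution_triangular_of_isRep hp hc x₀ y₀ hg' hG' hk',
    isLocalSkewProductFlow_hullTriple hp hp'⟩⟩
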